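/- For an unweighted undirected graph $G=(V,E)$, a \emph{coalition structure} is a partition $\mathcal C$ of $V$ into non-empty sets (coalitions); the utility of $v$ in its coalition $C$ is $U(v,C)=|N_G(v)\cap C|/|C|$, and the utilitarian welfare of $\mathcal C$ is $\mathrm{uw}(\mathcal C)=\sum_{C\in\mathcal C}\sum_{v\in C}U(v,C)$. A \emph{block graph} is a graph in which every biconnected component (maximal set of vertices inducing a connected subgraph without cut vertex) is a clique. \textbf{Theorem.} There is an algorithm which, given the adjacency lists (in any order) of a non-empty unweighted block graph $G$ with $n$ vertices and maximum degree $\Delta$, computes a coalition structure of maximum utilitarian welfare in time $O(n\Delta^4)$ on a uniform-cost random access machine. (If $\Delta=0$, the factor $\Delta^4$ is read as $1$, i.e. the bound is $O(n\cdot\max(\Delta,1)^4)$.) The machine has finitely many registers and an indirectly addressed memory, both holding natural numbers; a step is loading a constant, an addition or a truncated subtraction of two registers, a load or a store, or a test of a register for zero. The output is one label per vertex, two vertices having the same label if and only if they lie in the same coalition. -/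

import Mathlib

/-! ### Fractional hedonic games on unweighted graphs -/

namespace FHG

/-- The utility of the agent `v` in the coalition `C` (unweighted graph, every edge has weight `1`):
the number of neighbours of `v` in `C` divided by the size of `C`. -/
def utility {V : Type*} (G : SimpleGraph V) [DecidableRel G.Adj] (v : V) (C : Finset V) : ℚ :=
  ((C.filter (fun u => G.Adj v u)).card : ℚ) / (C.card : ℚ)

/-- The utilitarian welfare of a coalition. -/
def coalitionWelfare {V : Type*} (G : SimpleGraph V) [DecidableRel G.Adj] (C : Finset V) : ℚ :=
  ∑ v ∈ C, utility G v C

/-- The utilitarian welfare of a coalition structure, i.e. of a partition of the vertex set. -/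
def welfare {V : Type*} [Fintype V] [DecidableEq V] (G : SimpleGraph V) [DecidableRel G.Adj]
    (P : Finpartition (Finset.univ : Finset V)) : ℚ :=
  ∑ C ∈ P.parts, coalitionWelfare G C

/-- `P` is a maximum utilitarian welfare coalition structure. -/
def IsMaxWelfare {V : Type*} [Fintype V] [DecidableEq V] (G : SimpleGraph V) [DecidableRel G.Adj]
    (P : Finpartition (Finset.univ : Finset V)) : Prop :=
  ∀ Q : Finpartition (Finset.univ : Finset V), welfare G Q ≤ welfare G P

/-! ### Block graphs -/

/-- `G[B]` is connected and has no cut vertex. (Single vertices and single edges qualify.) -/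
def IsNonseparable {V : Type*} (G : SimpleGraph V) (B : Set V) : Prop :=
  (G.induce B).Connected ∧ ∀ v ∈ B, (G.induce (B \ {v})).Preconnected

/-- A biconnected component (block): a maximal vertex set inducing a connected subgraph without cut
vertex. -/
def IsBiconnectedComponent {V : Type*} (G : SimpleGraph V) (B : Set V) : Prop :=
  Maximal (IsNonseparable G) B

/-- A block graph: every biconnected component is a clique. -/
def IsBlockGraph {V : Type*} (G : SimpleGraph V) : Prop :=
  ∀ B : Set V, IsBiconnectedComponent G B → G.IsClique B

/-! ### Adjacency lists -/

/-- `adj v` lists the neighbours of `v`, each exactly once, in any order. -/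
def IsAdjacencyList {n : ℕ} (G : SimpleGraph (Fin n)) (adj : Fin n → List (Fin n)) : Prop :=
  ∀ v, (adj v).Nodup ∧ ∀ w, w ∈ adj v ↔ G.Adj v w

/-- The input word: the number `n` of vertices, then the lengths of the `n` adjacency lists, then
the adjacency lists themselves, one after the other. -/
def inputWord {n : ℕ} (adj : Fin n → List (Fin n)) : List ℕ :=
  n :: (List.ofFn (fun v => (adj v).length) ++
    ((List.ofFn adj).flatten.map (fun w => (w : ℕ))))

end FHG

/-! ### Random access machines with uniform cost -/

namespace RAM

/-- A memory configuration: registers (addressed directly by the program) and a random access memory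
(addressed through registers), all holding natural numbers. -/
structure State where
  /-- contents of the registers -/
  reg : ℕ → ℕ
  /-- contents of the memory cells -/
  mem : ℕ → ℕ

/-- Programs, with structured control flow. A program is a finite object and so mentions only
finitely many registers. The only arithmetic is addition and truncated subtraction. -/
inductive Prog where
  /-- `r := k` -/
  | const (r k : ℕ)
  /-- `r := a + b` -/
  | add (r a b : ℕ)
  /-- `r := max (a - b) 0` -/
  | sub (r a b : ℕ)
  /-- `r := mem[a]` -/
  | load (r a : ℕ)
  /-- `mem[a] := b` -/
  | store (a b : ℕ)
  /-- `p; q` -/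
  | seq (p q : Prog)
  /-- `if r ≠ 0 then p else q` -/
  | ite (r : ℕ) (p q : Prog)
  /-- `while r ≠ 0 do p` -/
  | loop (r : ℕ) (p : Prog)

/-- `s` with register `r` set to `x`. -/
def State.setReg (s : State) (r x : ℕ) : State := { s with reg := Function.update s.reg r x }

/-- `s` with memory cell `i` set to `x`. -/
def State.setMem (s : State) (i x : ℕ) : State := { s with mem := Function.update s.mem i x }

/-- `Exec p s t s'`: started in `s`, the program `p` halts in `s'` after exactly `t` steps. Every
assignment, load, store and every evaluation of a test is one step. -/
inductive Exec : Prog → State → ℕ → State → Prop where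
  | const (r k : ℕ) (s : State) : Exec (.const r k) s 1 (s.setReg r k)
  | add (r a b : ℕ) (s : State) : Exec (.add r a b) s 1 (s.setReg r (s.reg a + s.reg b))
  | sub (r a b : ℕ) (s : State) : Exec (.sub r a b) s 1 (s.setReg r (s.reg a - s.reg b))
  | load (r a : ℕ) (s : State) : Exec (.load r a) s 1 (s.setReg r (s.mem (s.reg a)))
  | store (a b : ℕ) (s : State) : Exec (.store a b) s 1 (s.setMem (s.reg a) (s.reg b))
  | seq {p q : Prog} {s s₁ s₂ : State} {t₁ t₂ : ℕ} :
      Exec p s t₁ s₁ → Exec q s₁ t₂ s₂ → Exec (.seq p q) s (t₁ + t₂) s₂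
  | ite_true {r : ℕ} {p q : Prog} {s s₁ : State} {t : ℕ} :
      s.reg r ≠ 0 → Exec p s t s₁ → Exec (.ite r p q) s (1 + t) s₁
  | ite_false {r : ℕ} {p q : Prog} {s s₁ : State} {t : ℕ} :
      s.reg r = 0 → Exec q s t s₁ → Exec (.ite r p q) s (1 + t) s₁
  | loop_done {r : ℕ} {p : Prog} {s : State} :
      s.reg r = 0 → Exec (.loop r p) s 1 s
  | loop_step {r : ℕ} {p : Prog} {s s₁ s₂ : State} {t₁ t₂ : ℕ} :
      s.reg r ≠ 0 → Exec p s t₁ s₁ → Exec (.loop r p) s₁ t₂ s₂ →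
        Exec (.loop r p) s (1 + t₁ + t₂) s₂

/-- The initial configuration: the input in the memory cells `0, 1, 2, …`, and `0` in all other cells
and in all registers. -/
def initial (w : List ℕ) : State where
  reg := fun _ => 0
  mem := fun i => w.getD i 0

end RAM

/-!
The welfare of a coalition is the number of its ordered adjacent pairs divided by its size. Coalition
structures are given by labellings of the vertices. In a block graph the vertices and blocks form a
forest. Numbering the vertices in the order of a search makes this forest explicit: the earlier
neighbours of a vertex are pairwise adjacent, so a vertex lies in at most one block that also
contains earlier vertices, and this block is known once its first two vertices are known
(`IsSearchOrder.isBlockOrder`). Adding a root and a node for each block turns the forest into a tree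
(`IsBlockTree`).

*Shape of an optimum.* Take an optimal coalition structure with as many coalitions as possible. Its
coalitions are cliques and induced stars: from any other connected coalition one can split off the
part in an outermost block, or cut an edge between two inner vertices, without loss
(`IsBlockOrder.clique_or_star`). Moreover at most one coalition has two vertices in a given block,
since otherwise two coalitions could be united, or give away a vertex, with a gain
(`IsBlockOrder.label_eq_of_clique`).

*Merging.* Such a coalition structure can be assembled along the tree, by merging the nodes one
after the other into their parents, the last one first. Of the coalition to which a node belongs
only a state needs to be remembered: a vertex is complete or the centre of a star with `k ≤ Δ`
leaves, and a block is in one of four states. A merge follows one of `O(Δ)` rules (`IsRule`), each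
with a fixed gain. Every sequence of merges produces a coalition structure with at least its total
gain as welfare (`IsRun.le_labelWelfare`), and some sequence gains as much as an optimal structure
(`exists_run`). So dynamic programming over the states, followed by backtracking, finds an optimum
(`labelWelfare_le_of_isTable`). The gains are fractions; they are multiplied by `(Δ + 2)!` so that
the machine computes with natural numbers.

*Running time.* The algorithm is written in a small language with bounded loops, variables and
arrays. Its commands compile to machine programs that take exactly the number of steps counted by
`Imp.Cmd.cost` (`Imp.Cmd.exec_compile`). The search takes `O(n * max Δ 1)` steps, and so do the
`2 * n` merges, each of which goes through `O(max Δ 1)` states and rules; the gains are products of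
`O(Δ)` factors, computed by repeated addition in `O(max Δ 1 ^ 3)` steps in total. All of this is
`O(n * max Δ 1 ^ 4)`.
-/

set_option linter.unusedSectionVars false

namespace FHG

open Finset

/-! ### Welfare of coalitions -/

section Welfare
variable {V : Type*} [DecidableEq V] (G : SimpleGraph V) [DecidableRel G.Adj]

/-- The number of ordered adjacent pairs with first vertex in `C` and second vertex in `D`. -/
def ends (C D : Finset V) : ℕ := ∑ v ∈ C, #(D.filter (fun u => G.Adj v u))

theorem coalitionWelfare_eq (C : Finset V) :
    coalitionWelfare G C = (ends G C C : ℚ) / #C := by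
  simp [coalitionWelfare, utility, ends, Finset.sum_div]

theorem ends_comm (C D : Finset V) : ends G C D = ends G D C := by
  simp only [ends, card_filter]
  rw [sum_comm]
  simp [G.adj_comm]

theorem ends_union_left {C D : Finset V} (h : Disjoint C D) (E : Finset V) :
    ends G (C ∪ D) E = ends G C E + ends G D E := by
  simp [ends, sum_union h]

theorem ends_union_right {D E : Finset V} (C : Finset V) (h : Disjoint D E) :
    ends G C (D ∪ E) = ends G C D + ends G C E := by
  rw [ends_comm, ends_union_left G h, ends_comm, ends_comm G E]

theorem ends_union_self {C D : Finset V} (h : Disjoint C D) :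
    ends G (C ∪ D) (C ∪ D) = ends G C C + ends G D D + 2 * ends G C D := by
  rw [ends_union_left G h, ends_union_right G _ h, ends_union_right G _ h, ends_comm G D C]
  ring

theorem ends_split {X C : Finset V} (h : X ⊆ C) :
    ends G C C = ends G X X + ends G (C \ X) (C \ X) + 2 * ends G X (C \ X) := by
  rw [← ends_union_self G disjoint_sdiff, union_sdiff_of_subset h]

theorem ends_of_clique {C : Finset V} (h : ∀ u ∈ C, ∀ v ∈ C, u ≠ v → G.Adj u v) :
    ends G C C = #C * (#C - 1) := by
  rw [ends, sum_const_nat]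
  intro v hv
  have : C.filter (fun u => G.Adj v u) = C.erase v := by
    ext u
    simp only [mem_filter, mem_erase]
    exact ⟨fun ⟨a, b⟩ => ⟨b.ne', a⟩, fun ⟨a, b⟩ => ⟨b, h v hv u b a.symm⟩⟩
  rw [this, card_erase_of_mem hv]

theorem one_le_ends {C D : Finset V} {x y : V} (hx : x ∈ C) (hy : y ∈ D) (h : G.Adj x y) :
    1 ≤ ends G C D := by
  rw [ends]
  refine le_trans ?_ (single_le_sum (f := fun v => #(D.filter (fun u => G.Adj v u)))
    (fun _ _ => Nat.zero_le _) hx)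
  exact card_pos.2 ⟨y, by simp [hy, h]⟩

theorem ends_eq_zero {C D : Finset V} (h : ∀ x ∈ C, ∀ y ∈ D, ¬ G.Adj x y) : ends G C D = 0 := by
  rw [ends, sum_eq_zero]
  intro v hv
  rw [card_eq_zero, filter_eq_empty_iff]
  exact fun u hu => h v hv u hu

theorem ends_singleton_left (x : V) (D : Finset V) :
    ends G {x} D = #(D.filter (fun u => G.Adj x u)) := by simp [ends]

theorem coalitionWelfare_of_clique {C : Finset V} (h0 : C.Nonempty)
    (h : ∀ u ∈ C, ∀ v ∈ C, u ≠ v → G.Adj u v) : coalitionWelfare G C = (#C : ℚ) - 1 := by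
  have hc : 1 ≤ #C := h0.card_pos
  have hc' : (#C : ℚ) ≠ 0 := by positivity
  rw [coalitionWelfare_eq, ends_of_clique G h]
  push_cast [Nat.cast_sub hc]
  field_simp

theorem coalitionWelfare_empty : coalitionWelfare G ∅ = 0 := by simp [coalitionWelfare]

/-- The welfare `2k/(k+1)` of a star with `k` leaves. -/
def starVal (k : ℕ) : ℚ := 2 * k / (k + 1)

theorem starVal_succ_sub (k : ℕ) : starVal (k + 1) - starVal k = 2 / ((k + 1) * (k + 2)) := by
  simp only [starVal]; push_cast; field_simp; ring

theorem star_ends_le {C : Finset V} {z : V} (hz : z ∈ C) (h : ∀ w ∈ C, w ≠ z → G.Adj z w) :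
    2 * (#C - 1) ≤ ends G C C := by
  rw [ends_split G (singleton_subset_iff.2 hz)]
  have : ends G {z} (C \ {z}) = #C - 1 := by
    rw [ends_singleton_left, filter_true_of_mem, card_sdiff_of_subset (singleton_subset_iff.2 hz),
      card_singleton]
    intro w hw
    simp only [mem_sdiff, mem_singleton] at hw
    exact h w hw.1 hw.2
  omega

theorem starVal_le_coalitionWelfare {C : Finset V} {z : V} {k : ℕ} (hz : z ∈ C)
    (hk : #C = k + 1) (h : ∀ w ∈ C, w ≠ z → G.Adj z w) : starVal k ≤ coalitionWelfare G C := by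
  have := star_ends_le G hz h
  rw [coalitionWelfare_eq, starVal, hk]
  rw [hk] at this
  push_cast
  gcongr
  exact_mod_cast this

theorem coalitionWelfare_of_star {C : Finset V} {z : V} {k : ℕ} (hz : z ∈ C)
    (hk : #C = k + 1) (h : ∀ w ∈ C, w ≠ z → G.Adj z w)
    (h' : ∀ u ∈ C, ∀ w ∈ C, u ≠ z → w ≠ z → ¬ G.Adj u w) :
    coalitionWelfare G C = starVal k := by
  have h1 : ends G {z} (C \ {z}) = k := by
    rw [ends_singleton_left, filter_true_of_mem, card_sdiff_of_subset (singleton_subset_iff.2 hz),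
      card_singleton, hk, Nat.add_sub_cancel]
    intro w hw
    simp only [mem_sdiff, mem_singleton] at hw
    exact h w hw.1 hw.2
  have h2 : ends G (C \ {z}) (C \ {z}) = 0 := by
    refine ends_eq_zero G fun x hx y hy => ?_
    simp only [mem_sdiff, mem_singleton] at hx hy
    exact h' x hx.1 y hy.1 hx.2 hy.2
  have h3 : ends G {z} {z} = 0 := ends_eq_zero G fun x hx y hy => by
    simp only [mem_singleton] at hx hy; subst hx hy; exact G.irrefl
  rw [coalitionWelfare_eq, ends_split G (singleton_subset_iff.2 hz), h1, h2, h3, hk, starVal]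
  push_cast
  ring

/-- `C` cannot be split into two non-empty parts without an edge between them: a form of
connectedness of `G[C]` that is convenient for counting. -/
def Linked (C : Finset V) : Prop :=
  ∀ X ⊆ C, X.Nonempty → X ≠ C → ∃ x ∈ X, ∃ y ∈ C \ X, G.Adj x y

variable {G}

/-- A set grows inside a linked set by one vertex and at least one edge at a time. -/
theorem Linked.ends_add_le {C : Finset V} (hC : Linked G C) {X : Finset V} (hX : X ⊆ C)
    (h0 : X.Nonempty) : ends G X X + 2 * #C ≤ ends G C C + 2 * #X := by
  induction hn : #C - #X generalizing X with
  | zero =>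
    have := eq_of_subset_of_card_le hX (by omega)
    subst this; exact le_rfl
  | succ m ih =>
    have hne : X ≠ C := by rintro rfl; omega
    obtain ⟨x, hx, y, hy, hxy⟩ := hC X hX h0 hne
    simp only [mem_sdiff] at hy
    have hd : Disjoint X {y} := by simpa using hy.2
    have hcard : #(X ∪ {y}) = #X + 1 := by rw [card_union_of_disjoint hd, card_singleton]
    have := ih (X := X ∪ {y}) (union_subset hX (by simpa using hy.1))
      (h0.mono subset_union_left) (by rw [hcard]; omega)
    rw [ends_union_self G hd, hcard] at this
    have h1 := one_le_ends G hx (mem_singleton_self y) hxy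
    omega

variable (G)

theorem coalitionWelfare_le_of_no_edges {X C : Finset V} (hX : X ⊆ C) (h : ends G X (C \ X) = 0) :
    coalitionWelfare G C ≤ coalitionWelfare G X + coalitionWelfare G (C \ X) := by
  rw [coalitionWelfare_eq, coalitionWelfare_eq, coalitionWelfare_eq, ends_split G hX, h]
  rcases X.eq_empty_or_nonempty with rfl | h1
  · simp [ends]
  rcases (C \ X).eq_empty_or_nonempty with h2 | h2
  · rw [h2]
    have : C = X := Subset.antisymm (sdiff_eq_empty_iff_subset.1 h2) hX
    rw [this]; simp [ends]
  have hc : #C = #X + #(C \ X) := by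
    rw [add_comm]; exact (card_sdiff_add_card_eq_card hX).symm
  have a1 : (0 : ℚ) < #X := by exact_mod_cast h1.card_pos
  have a2 : (0 : ℚ) < #(C \ X) := by exact_mod_cast h2.card_pos
  rw [hc]
  push_cast
  rw [add_zero, add_div]
  gcongr <;> linarith

/-- In a linked set with fewer edges than vertices, an edge whose two ends both have another
neighbour is a bridge with at least two vertices on each side; cutting it loses no welfare. -/
theorem exists_split_of_inner_edge {C : Finset V} (hC : Linked G C) (hm : ends G C C < 2 * #C)
    {x y x' y' : V} (hx : x ∈ C) (hy : y ∈ C) (hx' : x' ∈ C) (hy' : y' ∈ C)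
    (hxy : G.Adj x y) (hxx : G.Adj x x') (hyy : G.Adj y y') (hne : x' ≠ y) (hne' : y' ≠ x) :
    ∃ X ⊆ C, X.Nonempty ∧ X ≠ C ∧
      coalitionWelfare G C ≤ coalitionWelfare G X + coalitionWelfare G (C \ X) := by
  classical
  -- a largest "tree-like" set that contains `x` and avoids `y`
  obtain ⟨X, hX, hmax⟩ := exists_max_image
    ((C.erase y).powerset.filter fun X => x ∈ X ∧ 2 * #X ≤ ends G X X + 2) card
    ⟨{x}, by simp [hx, hxy.ne]⟩
  simp only [mem_filter, mem_powerset] at hX hmax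
  obtain ⟨hXC, hxX, hXe⟩ := hX
  have hXC' : X ⊆ C := hXC.trans (erase_subset _ _)
  have hyX : y ∉ X := fun h => by simpa using hXC h
  have hout : ∀ u ∈ X, ∀ w ∈ C \ X, G.Adj u w → w = y := by
    intro u hu w hw huw
    by_contra hwy
    simp only [mem_sdiff] at hw
    have hd : Disjoint X {w} := by simpa using hw.2
    have hcard : #(X ∪ {w}) = #X + 1 := by rw [card_union_of_disjoint hd, card_singleton]
    have h1 := one_le_ends G hu (mem_singleton_self w) huw
    have := hmax (X ∪ {w}) ⟨union_subset hXC (by simp [hwy, hw.1]), by simp [hxX], by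
      rw [hcard, ends_union_self G hd]; omega⟩
    omega
  have hone : ∀ u ∈ X, G.Adj u y → u = x := by
    intro u hu huy
    by_contra hux
    have hd : Disjoint X {y} := by simpa using hyX
    have hcard : #(X ∪ {y}) = #X + 1 := by rw [card_union_of_disjoint hd, card_singleton]
    have h2 : 2 ≤ ends G X {y} := by
      rw [ends_comm, ends_singleton_left, ← card_pair hux]
      refine card_le_card ?_
      intro t ht
      simp only [mem_insert, mem_singleton] at ht
      rcases ht with rfl | rfl
      · simp [hu, huy.symm]
      · simp [hxX, hxy.symm]
    have := hC.ends_add_le (X := X ∪ {y}) (union_subset hXC' (by simpa using hy))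
      ⟨y, by simp⟩
    rw [ends_union_self G hd, hcard] at this
    omega
  have hcross : ends G X (C \ X) = 1 := by
    have : X = {x} ∪ X.erase x := by rw [← insert_eq, insert_erase hxX]
    rw [this, ends_union_left G (by simp), ← this, ends_singleton_left, ends_eq_zero G (C := X.erase x)]
    · rw [add_zero, card_eq_one]
      refine ⟨y, ?_⟩
      ext t
      simp only [mem_filter, mem_singleton]
      exact ⟨fun h => hout x hxX t h.1 h.2, fun h => h ▸ ⟨mem_sdiff.2 ⟨hy, hyX⟩, hxy⟩⟩
    · intro u hu w hw huw
      have h1 := hout u (mem_of_mem_erase hu) w hw huw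
      rw [h1] at huw
      exact (ne_of_mem_erase hu) (hone u (mem_of_mem_erase hu) huw)
  have hsplit := ends_split G hXC'
  have hcard : #C = #X + #(C \ X) := by
    rw [add_comm]; exact (card_sdiff_add_card_eq_card hXC').symm
  have hYe : 2 * #(C \ X) ≤ ends G (C \ X) (C \ X) + 2 := by
    have := hC.ends_add_le hXC' ⟨x, hxX⟩
    omega
  have hX2 : 2 ≤ #X := by
    rw [← card_pair hxx.ne]
    refine card_le_card ?_
    intro t ht
    simp only [mem_insert, mem_singleton] at ht
    rcases ht with rfl | rfl
    · exact hxX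
    · by_contra h
      exact hne (hout x hxX _ (mem_sdiff.2 ⟨hx', h⟩) hxx)
  have hY2 : 2 ≤ #(C \ X) := by
    rw [← card_pair hyy.ne]
    refine card_le_card ?_
    intro t ht
    simp only [mem_insert, mem_singleton] at ht
    rcases ht with rfl | rfl
    · exact mem_sdiff.2 ⟨hy, hyX⟩
    · refine mem_sdiff.2 ⟨hy', fun h => hne' (hone _ h hyy.symm)⟩
  refine ⟨X, hXC', ⟨x, hxX⟩, fun h => hyX (h ▸ hy), ?_⟩
  have key : ∀ D : Finset V, 2 ≤ #D → 2 * #D ≤ ends G D D + 2 → 1 ≤ coalitionWelfare G D := by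
    intro D h1 h2
    rw [coalitionWelfare_eq, le_div_iff₀ (by positivity)]
    exact_mod_cast (by omega : 1 * #D ≤ ends G D D)
  have h1 := key X hX2 hXe
  have h2 := key (C \ X) hY2 hYe
  have h3 : coalitionWelfare G C ≤ 2 := by
    rw [coalitionWelfare_eq]
    apply div_le_of_le_mul₀ (by positivity) (by norm_num)
    exact_mod_cast hm.le
  linarith

end Welfare

/-! ### Block orders -/

section BlockOrder
variable {V : Type*} [DecidableEq V] (G : SimpleGraph V) [DecidableRel G.Adj]

/-- The structure of a block graph seen along a search order. Every vertex `v` has a position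
`pos v`. It is either a root or belongs to exactly one block that contains an earlier vertex; in
that block `tp v` is the position of the first vertex and `rp v` the position of the second one,
which serves as the name of the block. For a root, `rp v = pos v` and `tp v = 0`. Two vertices are
adjacent if and only if they bear the same block name or one of them is the first vertex of the
block named by the other. -/
structure IsBlockOrder (pos tp rp : V → ℕ) : Prop where
  inj : Function.Injective pos
  tp_lt : ∀ v, tp v < rp v
  rp_le : ∀ v, rp v ≤ pos v
  tp_eq : ∀ u v, rp u = rp v → tp u = tp v
  rp_eq : ∀ u v, pos u = rp v → rp u = rp v
  adj_iff : ∀ u v, G.Adj u v ↔ u ≠ v ∧ (rp u = rp v ∨ tp u = pos v ∨ tp v = pos u)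

variable {G} {pos tp rp : V → ℕ}

namespace IsBlockOrder

theorem adj_of_rp_eq (h : IsBlockOrder G pos tp rp) {u v : V} (hne : u ≠ v) (he : rp u = rp v) :
    G.Adj u v := (h.adj_iff u v).2 ⟨hne, Or.inl he⟩

theorem tp_lt_pos (h : IsBlockOrder G pos tp rp) (v : V) : tp v < pos v :=
  (h.tp_lt v).trans_le (h.rp_le v)

theorem adj_of_tp_eq (h : IsBlockOrder G pos tp rp) {u v : V} (he : tp u = pos v) :
    G.Adj u v := (h.adj_iff u v).2 ⟨by rintro rfl; have := h.tp_lt_pos u; omega, Or.inr (Or.inl he)⟩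

/-- If every split of `C` into two non-empty parts loses welfare, then `C` is a clique or an induced
star. Take a block that meets `C` and has the largest name; it meets the rest of `C` in at most its
first vertex `p`. If it has at least two further vertices in `C`, or if `G[C]` contains a cycle,
then these further vertices can be split off. Otherwise `G[C]` is a tree; an edge between two
inner vertices could be cut, so there is none, and the tree is a star around `p`. -/
theorem clique_or_star (h : IsBlockOrder G pos tp rp) {C : Finset V} (h0 : C.Nonempty)
    (hsplit : ∀ X ⊆ C, X.Nonempty → X ≠ C →
      coalitionWelfare G X + coalitionWelfare G (C \ X) < coalitionWelfare G C) :
    (∀ u ∈ C, ∀ v ∈ C, u ≠ v → G.Adj u v) ∨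
      ∃ z ∈ C, (∀ w ∈ C, w ≠ z → G.Adj z w) ∧
        ∀ u ∈ C, ∀ w ∈ C, u ≠ z → w ≠ z → ¬ G.Adj u w := by
  have hlink : Linked G C := by
    intro X hX hX0 hXC
    by_contra hcon
    push Not at hcon
    have := coalitionWelfare_le_of_no_edges G hX (ends_eq_zero G hcon)
    linarith [hsplit X hX hX0 hXC]
  obtain ⟨v, hv, hmax⟩ := exists_max_image C rp h0
  set M := C.filter (fun u => rp u = rp v) with hM
  have hMC : M ⊆ C := filter_subset _ _
  have hvM : v ∈ M := by simp [hM, hv]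
  have hMclique : ∀ u ∈ M, ∀ w ∈ M, u ≠ w → G.Adj u w := by
    intro u hu w hw huw
    simp only [hM, mem_filter] at hu hw
    exact h.adj_of_rp_eq huw (hu.2.trans hw.2.symm)
  -- only the first vertex of the block can be adjacent to `M`
  have hout : ∀ u ∈ M, ∀ w ∈ C \ M, G.Adj u w → pos w = tp v := by
    intro u hu w hw huw
    simp only [hM, mem_filter, mem_sdiff, not_and] at hu hw
    rcases ((h.adj_iff u w).1 huw).2 with h1 | h1 | h1
    · exact absurd (h1.symm.trans hu.2) (hw.2 hw.1)
    · rw [← h1, h.tp_eq u v hu.2]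
    · have := hmax w hw.1
      have := h.tp_lt w
      have := h.rp_le u
      omega
  -- a coalition within one block, or within one block and its first vertex, is a clique
  by_cases hMC' : M = C
  · left; rw [← hMC']; exact hMclique
  obtain ⟨u, hu, p, hp, hup⟩ := hlink M hMC ⟨v, hvM⟩ hMC'
  have hpt := hout u hu p hp hup
  have hpC : p ∈ C := (mem_sdiff.1 hp).1
  have hpM : p ∉ M := (mem_sdiff.1 hp).2
  have hpadj : ∀ u ∈ M, G.Adj u p := by
    intro u hu
    simp only [hM, mem_filter] at hu
    exact h.adj_of_tp_eq (by rw [hpt, h.tp_eq u v hu.2])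
  have hout' : ∀ u ∈ M, ∀ w ∈ C \ M, G.Adj u w → w = p := fun u hu w hw huw =>
    h.inj ((hout u hu w hw huw).trans hpt.symm)
  by_cases hR : C \ M = {p}
  · left
    have hC : C = M ∪ {p} := by rw [← hR, union_sdiff_of_subset hMC]
    rw [hC]
    intro a ha b hb hab
    simp only [mem_union, mem_singleton] at ha hb
    rcases ha with ha | rfl <;> rcases hb with hb | rfl
    · exact hMclique a ha b hb hab
    · exact hpadj a ha
    · exact (hpadj b hb).symm
    · exact absurd rfl hab
  have hcross : ends G M (C \ M) = #M := by
    rw [ends, sum_const_nat (m := 1), mul_one]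
    intro a ha
    rw [card_eq_one]
    refine ⟨p, ?_⟩
    ext t
    simp only [mem_filter, mem_singleton]
    exact ⟨fun ht => hout' a ha t ht.1 ht.2, fun ht => ht ▸ ⟨hp, hpadj a ha⟩⟩
  have hRcard : 2 ≤ #(C \ M) := by
    by_contra hlt
    have h1 : 0 < #(C \ M) := card_pos.2 ⟨p, hp⟩
    obtain ⟨t, ht⟩ := card_eq_one.1 (by omega : #(C \ M) = 1)
    rw [ht, mem_singleton] at hp
    exact hR (by rw [ht, hp])
  have hdis : Disjoint M {p} := by simpa using hpM
  have hMp : ends G M {p} = #M := by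
    rw [ends_comm, ends_singleton_left, filter_true_of_mem fun a ha => (hpadj a ha).symm]
  have hgrow := hlink.ends_add_le (X := M ∪ {p}) (union_subset hMC (by simpa using hpC))
    ⟨p, by simp⟩
  rw [ends_union_self G hdis, hMp, card_union_of_disjoint hdis, card_singleton] at hgrow
  have hes := ends_split G hMC
  have heM := ends_of_clique G hMclique
  have hcard : #C = #M + #(C \ M) := by
    rw [add_comm]; exact (card_sdiff_add_card_eq_card hMC).symm
  have hMpos : 1 ≤ #M := card_pos.2 ⟨v, hvM⟩
  have hs := hsplit M hMC ⟨v, hvM⟩ hMC'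
  -- the number `r` of remaining vertices and the number `e` of their ordered adjacent pairs
  obtain ⟨r, hr⟩ : ∃ r, r = #(C \ M) := ⟨_, rfl⟩
  obtain ⟨e, he⟩ : ∃ e, e = ends G (C \ M) (C \ M) := ⟨_, rfl⟩
  obtain ⟨d, hd⟩ : ∃ d, #M = d + 1 := ⟨#M - 1, by omega⟩
  have hee : 2 * r ≤ e + 2 := by rw [hr, he]; omega
  rw [coalitionWelfare_of_clique G ⟨v, hvM⟩ hMclique, coalitionWelfare_eq, coalitionWelfare_eq, hes,
    heM, hcross, hcard, hd, ← hr, ← he, Nat.add_sub_cancel] at hs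
  rw [← hr] at hRcard
  have hr0 : (2 : ℚ) ≤ r := by exact_mod_cast hRcard
  have hee' : (2 : ℚ) * r ≤ e + 2 := by exact_mod_cast hee
  have hd0 : (0 : ℚ) ≤ d := by positivity
  push_cast at hs
  have hkey : (d : ℚ) * r * (d + 1 + r) + e * (d + 1 + r) < ((d + 1) * d + e + 2 * (d + 1)) * r := by
    have h1 : (d : ℚ) + 1 - 1 + e / r = (d * r + e) / r := by field_simp; ring
    rw [h1, div_lt_div_iff₀ (by linarith) (by linarith)] at hs
    linarith
  -- if `M` had two vertices, the split into `M` and the rest would lose nothing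
  have hd1 : d = 0 := by
    by_contra hd1
    have hd1 : (1 : ℚ) ≤ d := by exact_mod_cast Nat.one_le_iff_ne_zero.2 hd1
    nlinarith [mul_nonneg (sub_nonneg.2 hd1) (sub_nonneg.2 hr0), mul_nonneg hd0 (sub_nonneg.2 hee'),
      mul_nonneg (mul_nonneg (sub_nonneg.2 hd1) (sub_nonneg.2 hr0)) (sub_nonneg.2 hr0),
      mul_nonneg (sub_nonneg.2 hr0) (sub_nonneg.2 hr0)]
  subst hd1
  have hlt : e < 2 * r := by
    have : (e : ℚ) < 2 * r := by push_cast at hkey; linarith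
    exact_mod_cast this
  have hMv : M = {v} := by
    obtain ⟨t, ht⟩ := card_eq_one.1 hd
    rw [ht, mem_singleton] at hvM
    rw [ht, hvM]
  have hm : ends G C C < 2 * #C := by
    rw [hes, heM, hcross, hcard, hd, ← hr, ← he]; omega
  have hvp : G.Adj v p := hpadj v hvM
  have hvonly : ∀ w ∈ C, G.Adj v w → w = p := by
    intro w hw hvw
    refine hout' v hvM w (mem_sdiff.2 ⟨hw, ?_⟩) hvw
    rw [hMv, mem_singleton]; exact hvw.ne.symm
  have hpv : p ≠ v := hvp.ne.symm
  -- a second neighbour of `p`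
  obtain ⟨q, hq, hpq, hqv⟩ : ∃ q ∈ C, G.Adj p q ∧ q ≠ v := by
    obtain ⟨x, hx, y, hy, hxy⟩ := hlink {v, p} (by simp [insert_subset_iff, hv, hpC])
      (insert_nonempty _ _) (by
        intro hc
        rw [← hc, hMv] at hR
        apply hR
        ext t; simp only [mem_sdiff, mem_insert, mem_singleton]
        constructor
        · tauto
        · rintro rfl; exact ⟨Or.inr rfl, hpv⟩)
    simp only [mem_sdiff, mem_insert, mem_singleton, not_or] at hx hy
    rcases hx with rfl | rfl
    · exact absurd (hvonly y hy.1 hxy) hy.2.2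
    · exact ⟨y, hy.1, hxy, hy.2.1⟩
  -- if a neighbour of `p` had a further neighbour, the edge from it to `p` could be cut
  have hleaf : ∀ y ∈ C, G.Adj p y → ∀ w ∈ C, G.Adj y w → w = p := by
    intro y hy hpy w hw hyw
    by_contra hwp
    obtain ⟨t, ht, hpt', hty⟩ : ∃ t ∈ C, G.Adj p t ∧ t ≠ y := by
      by_cases hyq : q = y
      · exact ⟨v, hv, hvp.symm, fun hvy => hqv (hyq.trans hvy.symm)⟩
      · exact ⟨q, hq, hpq, hyq⟩
    obtain ⟨X, hX, hX0, hXC, hle⟩ := 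
      exists_split_of_inner_edge G hlink hm hpC hy ht hw hpy hpt' hyw hty hwp
    linarith [hsplit X hX hX0 hXC]
  have hall : C.filter (fun w => w = p ∨ G.Adj p w) = C := by
    by_contra hne
    obtain ⟨x, hx, y, hy, hxy⟩ := hlink _ (filter_subset _ _) ⟨p, by simp [hpC]⟩ hne
    simp only [mem_filter, mem_sdiff, not_and, not_or] at hx hy
    have h2 := hy.2 hy.1
    rcases hx.2 with rfl | h1
    · exact h2.2 hxy
    · exact h2.1 (hleaf x hx.1 h1 y hy.1 hxy)
  have hall' : ∀ w ∈ C, w ≠ p → G.Adj p w := by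
    intro w hw hwp
    rw [← hall, mem_filter] at hw
    exact hw.2.resolve_left hwp
  right
  exact ⟨p, hpC, hall', fun a ha b hb hap hbp hab => hbp (hleaf a ha (hall' a ha hap) b hb hab)⟩

end IsBlockOrder
end BlockOrder

/-! ### Labellings and optimal coalition structures -/

section Labelling
variable {V : Type*} [Fintype V] [DecidableEq V] (G : SimpleGraph V) [DecidableRel G.Adj]

/-- The set of vertices with label `a`. -/
def fiber {L : Type*} [DecidableEq L] (l : V → L) (a : L) : Finset V := univ.filter (fun u => l u = a)

theorem mem_fiber {L : Type*} [DecidableEq L] {l : V → L} {a : L} {u : V} :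
    u ∈ fiber l a ↔ l u = a := by simp [fiber]

/-- The welfare of the coalition structure formed by the classes of equally labelled vertices. -/
def labelWelfare {L : Type*} [DecidableEq L] (l : V → L) : ℚ := ∑ v, utility G v (fiber l (l v))

theorem labelWelfare_eq_sum {L : Type*} [DecidableEq L] (l : V → L) (T : Finset L)
    (hT : ∀ v, l v ∈ T) : labelWelfare G l = ∑ a ∈ T, coalitionWelfare G (fiber l a) := by
  rw [labelWelfare, ← sum_fiberwise_of_maps_to (s := univ) (t := T) (g := l) (fun v _ => hT v)]
  refine sum_congr rfl fun a _ => ?_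
  rw [coalitionWelfare]
  refine sum_congr rfl fun v hv => ?_
  rw [(mem_filter.1 hv).2]

theorem labelWelfare_congr {L L' : Type*} [DecidableEq L] [DecidableEq L'] {l : V → L} {l' : V → L'}
    (h : ∀ u v, l u = l v ↔ l' u = l' v) : labelWelfare G l = labelWelfare G l' := by
  refine sum_congr rfl fun v _ => ?_
  congr 1
  ext u
  simp [mem_fiber, h]

theorem labelWelfare_sub {L : Type*} [DecidableEq L] [Fintype L] (l l' : V → L) (T : Finset L)
    (h : ∀ a ∉ T, fiber l' a = fiber l a) :
    labelWelfare G l' - labelWelfare G l =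
      ∑ a ∈ T, (coalitionWelfare G (fiber l' a) - coalitionWelfare G (fiber l a)) := by
  rw [labelWelfare_eq_sum G l univ (by simp), labelWelfare_eq_sum G l' univ (by simp),
    ← sum_sub_distrib]
  symm
  refine sum_subset (subset_univ T) fun a _ ha => ?_
  rw [h a ha, sub_self]

theorem welfare_eq_sum_utility (P : Finpartition (univ : Finset V)) :
    welfare G P = ∑ v, utility G v (P.part v) := by
  have h := sum_biUnion (f := fun v => utility G v (P.part v)) P.disjoint
  rw [P.biUnion_parts] at h
  rw [h]
  refine sum_congr rfl fun C hC => sum_congr rfl fun v hv => ?_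
  rw [P.part_eq_of_mem hC hv]

theorem welfare_eq_labelWelfare {L : Type*} [DecidableEq L] (P : Finpartition (univ : Finset V))
    (l : V → L) (h : ∀ u v, l u = l v ↔ P.part u = P.part v) : welfare G P = labelWelfare G l := by
  rw [welfare_eq_sum_utility]
  refine sum_congr rfl fun v _ => ?_
  congr 1
  ext u
  rw [mem_fiber, h u v, P.mem_part_iff_part_eq_part (mem_univ _) (mem_univ _), eq_comm]

/-- Vertices suffice as labels. -/
theorem exists_vertex_labelling {L : Type*} [DecidableEq L] (l : V → L) :
    ∃ l' : V → V, labelWelfare G l' = labelWelfare G l := by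
  classical
  have hinv : ∀ v, l (@Function.invFun V L ⟨v⟩ l (l v)) = l v := fun v =>
    @Function.invFun_eq V L ⟨v⟩ l (l v) ⟨v, rfl⟩
  refine ⟨fun v => @Function.invFun V L ⟨v⟩ l (l v), labelWelfare_congr G fun u v => ?_⟩
  constructor
  · intro h
    have := congrArg l h
    rwa [hinv, hinv] at this
  · intro h; rw [h]

/-- `C` is a clique or an induced star. -/
def IsCliqueOrStar (C : Finset V) : Prop :=
  (∀ u ∈ C, ∀ v ∈ C, u ≠ v → G.Adj u v) ∨
    ∃ z ∈ C, (∀ w ∈ C, w ≠ z → G.Adj z w) ∧ ∀ u ∈ C, ∀ w ∈ C, u ≠ z → w ≠ z → ¬ G.Adj u w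

theorem exists_unused_label {l : V → V} {u v : V} (huv : u ≠ v) (h : l u = l v) :
    ∃ b, ∀ w, l w ≠ b := by
  by_contra hc
  push Not at hc
  exact huv (Finite.injective_iff_surjective.2 hc h)

variable {G} {pos tp rp : V → ℕ}

/-- Some optimal labelling has only cliques and stars as coalitions: take one with as many
coalitions as possible. -/
theorem IsBlockOrder.exists_optimal_labelling (h : IsBlockOrder G pos tp rp) :
    ∃ l : V → V, (∀ l' : V → V, labelWelfare G l' ≤ labelWelfare G l) ∧
      ∀ a, IsCliqueOrStar G (fiber l a) := by
  obtain ⟨l, -, hl⟩ := exists_max_image (univ : Finset (V → V))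
    (fun l => toLex (labelWelfare G l, #(univ.image l))) ⟨id, mem_univ _⟩
  have hl : ∀ l' : V → V, labelWelfare G l' < labelWelfare G l ∨
      labelWelfare G l' = labelWelfare G l ∧ #(univ.image l') ≤ #(univ.image l) := by
    intro l'
    have := hl l' (mem_univ _)
    rw [Prod.Lex.toLex_le_toLex] at this
    exact this
  refine ⟨l, fun l' => ?_, fun a => ?_⟩
  · rcases hl l' with h1 | h1
    · exact h1.le
    · exact h1.1.le
  rcases (fiber l a).eq_empty_or_nonempty with he | hne
  · left; simp [he]
  refine h.clique_or_star hne fun X hX hX0 hXC => ?_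
  obtain ⟨x, hx⟩ := hX0
  obtain ⟨y, hy, hyX⟩ : ∃ y ∈ fiber l a, y ∉ X := by
    by_contra hc
    push Not at hc
    exact hXC (Subset.antisymm hX hc)
  have hxa : l x = a := mem_fiber.1 (hX hx)
  have hya : l y = a := mem_fiber.1 hy
  obtain ⟨b, hb⟩ := exists_unused_label (l := l) (u := x) (v := y)
    (fun he => hyX (he ▸ hx)) (hxa.trans hya.symm)
  have hab : a ≠ b := hxa ▸ hb x
  let l' : V → V := fun u => if u ∈ X then b else l u
  have hXa : ∀ u ∈ X, l u = a := fun u hu => mem_fiber.1 (hX hu)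
  have hfb : fiber l' b = X := by
    ext u
    rw [mem_fiber]
    by_cases hu : u ∈ X <;> simp [l', hu, hb]
  have hfa : fiber l' a = fiber l a \ X := by
    ext u
    rw [mem_sdiff, mem_fiber, mem_fiber]
    by_cases hu : u ∈ X <;> simp [l', hu, hab.symm]
  have hfo : ∀ c ∉ ({a, b} : Finset V), fiber l' c = fiber l c := by
    intro c hc
    simp only [mem_insert, mem_singleton, not_or] at hc
    ext u
    rw [mem_fiber, mem_fiber]
    by_cases hu : u ∈ X
    · simp only [l', hu, if_true, hXa u hu]
      exact ⟨fun h => absurd h.symm hc.2, fun h => absurd h.symm hc.1⟩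
    · simp [l', hu]
  have hlb : fiber l b = ∅ := by
    ext u; simp [mem_fiber, hb u]
  have hsub := labelWelfare_sub G l l' {a, b} hfo
  rw [sum_pair hab, hfa, hfb, hlb, coalitionWelfare_empty] at hsub
  have hcard : #(univ.image l) < #(univ.image l') := by
    refine card_lt_card ⟨?_, ?_⟩
    · intro c hc
      simp only [mem_image, mem_univ, true_and] at hc ⊢
      obtain ⟨u, rfl⟩ := hc
      by_cases hu : u ∈ X
      · exact ⟨y, by simp [l', hyX, hya, hXa u hu]⟩
      · exact ⟨u, by simp [l', hu]⟩
    · intro hc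
      have : b ∈ univ.image l := hc (mem_image.2 ⟨x, mem_univ _, by simp [l', hx]⟩)
      simp only [mem_image, mem_univ, true_and] at this
      obtain ⟨u, hu⟩ := this
      exact hb u hu
  rcases hl l' with h1 | h1
  · linarith
  · omega

/-- The block named by `b`'s block contains `x`. -/
def SameBlock (pos tp rp : V → ℕ) (b x : V) : Prop := rp x = rp b ∨ pos x = tp b

theorem IsBlockOrder.adj_of_sameBlock (h : IsBlockOrder G pos tp rp) {b x y : V} (hxy : x ≠ y)
    (hx : SameBlock pos tp rp b x) (hy : SameBlock pos tp rp b y) : G.Adj x y := by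
  rcases hx with hx | hx <;> rcases hy with hy | hy
  · exact h.adj_of_rp_eq hxy (hx.trans hy.symm)
  · exact h.adj_of_tp_eq ((h.tp_eq x b hx).trans hy.symm)
  · exact (h.adj_of_tp_eq ((h.tp_eq y b hy).trans hx.symm)).symm
  · exact absurd (h.inj (hx.trans hy.symm)) hxy

theorem IsBlockOrder.sameBlock_of_adj (h : IsBlockOrder G pos tp rp) {a b x : V} (hlt : pos a < pos b)
    (hab : G.Adj a b) (hxa : G.Adj x a) (hxb : G.Adj x b) : SameBlock pos tp rp b x := by
  have h1 := h.tp_lt_pos a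
  have h2 := h.tp_lt_pos b
  have h3 := h.tp_lt x
  have h4 := h.rp_le x
  have h5 := h.rp_le a
  have h6 := h.rp_le b
  have hne : pos x ≠ pos a := fun he => hxa.ne (h.inj he)
  obtain ⟨-, ha⟩ := (h.adj_iff x a).1 hxa
  obtain ⟨-, hb⟩ := (h.adj_iff x b).1 hxb
  obtain ⟨-, hc⟩ := (h.adj_iff a b).1 hab
  unfold SameBlock
  rcases hb with hb | hb | hb
  · exact Or.inl hb
  · omega
  · exact Or.inr hb.symm

theorem IsBlockOrder.diamond (h : IsBlockOrder G pos tp rp) {a b x y : V} (hxy : x ≠ y)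
    (hab : G.Adj a b) (hxa : G.Adj x a) (hxb : G.Adj x b) (hya : G.Adj y a) (hyb : G.Adj y b) :
    G.Adj x y := by
  have hne : pos a ≠ pos b := fun he => hab.ne (h.inj he)
  rcases lt_or_gt_of_ne hne with hlt | hlt
  · exact h.adj_of_sameBlock hxy (h.sameBlock_of_adj hlt hab hxa hxb)
      (h.sameBlock_of_adj hlt hab hya hyb)
  · exact h.adj_of_sameBlock hxy (h.sameBlock_of_adj hlt hab.symm hxb hxa)
      (h.sameBlock_of_adj hlt hab.symm hyb hya)

/-- From a star with at least two leaves, one end of each edge can be removed at a loss of at most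
`1/3`. -/
theorem IsCliqueOrStar.clique_or_drop {C : Finset V} (hC : IsCliqueOrStar G C) {u v : V}
    (hu : u ∈ C) (hv : v ∈ C) (hadj : G.Adj u v) :
    (∀ u ∈ C, ∀ v ∈ C, u ≠ v → G.Adj u v) ∨ ∃ x, (x = u ∨ x = v) ∧
      coalitionWelfare G C ≤ coalitionWelfare G (C.erase x) + 1 / 3 := by
  rcases hC with hC | ⟨z, hz, h1, h2⟩
  · exact Or.inl hC
  have huv := hadj.ne
  -- the end that is not the centre
  obtain ⟨x, hx, hxC, hxz⟩ : ∃ x, (x = u ∨ x = v) ∧ x ∈ C ∧ x ≠ z := by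
    by_cases huz : u = z
    · exact ⟨v, Or.inr rfl, hv, fun h => huv (huz.trans h.symm)⟩
    · exact ⟨u, Or.inl rfl, hu, huz⟩
  obtain ⟨k, hk⟩ : ∃ k, #C = k + 2 := ⟨#C - 2, by
    have : 2 ≤ #C := by
      rw [← card_pair hxz]
      exact card_le_card (by simp [insert_subset_iff, hxC, hz])
    omega⟩
  rcases Nat.eq_zero_or_pos k with rfl | hk0
  · left
    have hCe : {z, x} = C := eq_of_subset_of_card_le (by simp [insert_subset_iff, hxC, hz])
      (by rw [card_pair hxz.symm, hk])
    intro a ha b hb hab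
    rw [← hCe, mem_insert, mem_singleton] at ha hb
    rcases ha with rfl | rfl <;> rcases hb with rfl | rfl
    · exact absurd rfl hab
    · exact h1 _ hxC hxz
    · exact (h1 _ hxC hxz).symm
    · exact absurd rfl hab
  right
  refine ⟨x, hx, ?_⟩
  rw [coalitionWelfare_of_star G hz (k := k + 1) hk h1 h2]
  have h3 : starVal k ≤ coalitionWelfare G (C.erase x) :=
    starVal_le_coalitionWelfare G (z := z) (mem_erase.2 ⟨hxz.symm, hz⟩)
      (by rw [card_erase_of_mem hxC, hk]; rfl) fun w hw hwz => h1 w (mem_of_mem_erase hw) hwz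
  have h4 := starVal_succ_sub k
  have h5 : (2 : ℚ) / ((k + 1) * (k + 2)) ≤ 1 / 3 := by
    have : (1 : ℚ) ≤ k := by exact_mod_cast hk0
    rw [div_le_div_iff₀ (by positivity) (by norm_num)]
    nlinarith
  linarith

/-- Moving one vertex to the coalition labelled `b`. -/
theorem labelWelfare_update (l : V → V) {x b : V} (hb : l x ≠ b) :
    labelWelfare G (Function.update l x b) - labelWelfare G l =
      (coalitionWelfare G ((fiber l (l x)).erase x) - coalitionWelfare G (fiber l (l x))) +
      (coalitionWelfare G (insert x (fiber l b)) - coalitionWelfare G (fiber l b)) := by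
  rw [labelWelfare_sub G l _ {l x, b}, sum_pair hb]
  · congr 3
    · ext u
      rw [mem_fiber, mem_erase, mem_fiber]
      by_cases hu : u = x
      · subst hu; simp [hb.symm]
      · simp [hu]
    · ext u
      rw [mem_fiber, mem_insert, mem_fiber]
      by_cases hu : u = x
      · subst hu; simp
      · simp [hu]
  · intro c hc
    simp only [mem_insert, mem_singleton, not_or] at hc
    ext u
    rw [mem_fiber, mem_fiber]
    by_cases hu : u = x
    · subst hu
      simp only [Function.update_self]
      exact ⟨fun h => absurd h.symm hc.2, fun h => absurd h.symm hc.1⟩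
    · simp [hu]

/-- Uniting two coalitions. -/
theorem labelWelfare_union (l : V → V) {a b : V} (hab : a ≠ b) :
    labelWelfare G (fun w => if l w = a then b else l w) - labelWelfare G l =
      coalitionWelfare G (fiber l a ∪ fiber l b) - coalitionWelfare G (fiber l a) -
        coalitionWelfare G (fiber l b) := by
  rw [labelWelfare_sub G l _ {a, b}, sum_pair hab]
  · have h1 : fiber (fun w => if l w = a then b else l w) a = ∅ := by
      ext u
      rw [mem_fiber]
      by_cases hu : l u = a <;> simp [hu, hab.symm]
    have h2 : fiber (fun w => if l w = a then b else l w) b = fiber l a ∪ fiber l b := by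
      ext u
      rw [mem_fiber, mem_union, mem_fiber, mem_fiber]
      by_cases hu : l u = a <;> simp [hu]
    rw [h1, h2, coalitionWelfare_empty]
    ring
  · intro c hc
    simp only [mem_insert, mem_singleton, not_or] at hc
    ext u
    rw [mem_fiber, mem_fiber]
    by_cases hu : l u = a
    · simp only [hu, if_true]
      exact ⟨fun h => absurd h.symm hc.2, fun h => absurd h.symm hc.1⟩
    · simp [hu]

/-- A vertex that can be dropped from its coalition at a loss of at most `1/3` is, in an optimal
labelling, not adjacent to the whole of a clique coalition. -/
theorem not_adj_clique_of_drop {l : V → V} (hl : ∀ l' : V → V, labelWelfare G l' ≤ labelWelfare G l)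
    {x b : V} (hb : l x ≠ b)
    (hx : coalitionWelfare G (fiber l (l x)) ≤
      coalitionWelfare G ((fiber l (l x)).erase x) + 1 / 3)
    (hne : (fiber l b).Nonempty) (hcl : ∀ u ∈ fiber l b, ∀ v ∈ fiber l b, u ≠ v → G.Adj u v) :
    ¬ ∀ u ∈ fiber l b, G.Adj u x := by
  intro hall
  have h1 := labelWelfare_update (G := G) l hb
  have hxb : x ∉ fiber l b := fun h => hb (mem_fiber.1 h)
  rw [coalitionWelfare_of_clique G hne hcl, coalitionWelfare_of_clique G (insert_nonempty _ _),
    card_insert_of_notMem hxb] at h1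
  · push_cast at h1
    linarith [hl (Function.update l x b)]
  · intro u hu v hv huv
    rw [mem_insert] at hu hv
    rcases hu with rfl | hu <;> rcases hv with rfl | hv
    · exact absurd rfl huv
    · exact (hall v hv).symm
    · exact hall u hu
    · exact hcl u hu v hv huv

/-- In an optimal labelling with cliques and stars only, at most one coalition has an edge in a
given clique of the graph: two such coalitions could be united, or exchange a vertex, or give away
one vertex each to form a pair, with a gain of at least `1/3`. -/
theorem IsBlockOrder.label_eq_of_clique (h : IsBlockOrder G pos tp rp) {l : V → V}
    (hl : ∀ l' : V → V, labelWelfare G l' ≤ labelWelfare G l)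
    (hs : ∀ a, IsCliqueOrStar G (fiber l a)) {u v u' v' : V} (huv : G.Adj u v) (huv' : G.Adj u' v')
    (he : l u = l v) (he' : l u' = l v')
    (hadj : ∀ x y, x = u ∨ x = v → y = u' ∨ y = v' → x ≠ y → G.Adj x y) : l u = l u' := by
  by_contra hne
  have hlab : ∀ x y, x = u ∨ x = v → y = u' ∨ y = v' → l x = l u ∧ l y = l u' ∧ G.Adj x y := by
    intro x y hx hy
    have h1 : l x = l u := by rcases hx with rfl | rfl <;> simp [he]
    have h2 : l y = l u' := by rcases hy with rfl | rfl <;> simp [he']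
    exact ⟨h1, h2, hadj x y hx hy fun h => hne (by rw [← h1, ← h2, h])⟩
  have hA : ∀ x y, x = u ∨ x = v → y = u' ∨ y = v' → G.Adj x y := fun x y hx hy =>
    (hlab x y hx hy).2.2
  -- a vertex adjacent to both ends of an edge of a clique coalition is adjacent to all of it
  have hext : ∀ {a b x : V}, G.Adj a b → l a = l b → l x ≠ l a →
      (∀ u ∈ fiber l (l a), ∀ v ∈ fiber l (l a), u ≠ v → G.Adj u v) →
      G.Adj x a → G.Adj x b → ∀ y ∈ fiber l (l a), G.Adj y x := by
    intro a b x hab hlab hlx hcl hxa hxb y hy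
    have hyx : y ≠ x := by rintro rfl; exact hlx (mem_fiber.1 hy)
    have hfa : a ∈ fiber l (l a) := mem_fiber.2 rfl
    have hfb : b ∈ fiber l (l a) := mem_fiber.2 hlab.symm
    by_cases hya : y = a
    · rw [hya]; exact hxa.symm
    by_cases hyb : y = b
    · rw [hyb]; exact hxb.symm
    exact h.diamond hyx hab (hcl y hy a hfa hya) (hcl y hy b hfb hyb) hxa hxb
  have hfu : u ∈ fiber l (l u) := mem_fiber.2 rfl
  have hfv : v ∈ fiber l (l u) := mem_fiber.2 he.symm
  have hfu' : u' ∈ fiber l (l u') := mem_fiber.2 rfl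
  have hfv' : v' ∈ fiber l (l u') := mem_fiber.2 he'.symm
  rcases (hs (l u)).clique_or_drop hfu hfv huv with h1 | ⟨x, hx, hx'⟩ <;>
    rcases (hs (l u')).clique_or_drop hfu' hfv' huv' with h2 | ⟨y, hy, hy'⟩
  · -- two cliques: unite them
    have hgain := labelWelfare_union (G := G) l hne
    have hdis : Disjoint (fiber l (l u)) (fiber l (l u')) := by
      rw [disjoint_left]
      intro w hw hw'
      exact hne ((mem_fiber.1 hw).symm.trans (mem_fiber.1 hw'))
    have hall : ∀ a ∈ fiber l (l u), ∀ b ∈ fiber l (l u'), G.Adj a b := by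
      intro a ha b hb
      have hb' : ∀ x, x = u ∨ x = v → G.Adj b x := fun x hx =>
        hext huv' he' (fun h => hne ((hlab x u' hx (Or.inl rfl)).1.symm.trans h)) h2
          (hA x _ hx (Or.inl rfl)) (hA x _ hx (Or.inr rfl)) b hb
      exact hext huv he (fun h => hne (h.symm.trans (mem_fiber.1 hb))) h1 (hb' u (Or.inl rfl))
        (hb' v (Or.inr rfl)) a ha
    rw [coalitionWelfare_of_clique G ⟨u, hfu⟩ h1, coalitionWelfare_of_clique G ⟨u', hfu'⟩ h2,
      coalitionWelfare_of_clique G ⟨u, mem_union_left _ hfu⟩, card_union_of_disjoint hdis] at hgain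
    · push_cast at hgain
      linarith [hl (fun w => if l w = l u then l u' else l w)]
    · intro a ha b hb hab
      rw [mem_union] at ha hb
      rcases ha with ha | ha <;> rcases hb with hb | hb
      · exact h1 a ha b hb hab
      · exact hall a ha b hb
      · exact (hall b hb a ha).symm
      · exact h2 a ha b hb hab
  · -- a clique and a star: move a leaf of the star to the clique
    have hly := (hlab u y (Or.inl rfl) hy).2.1
    refine not_adj_clique_of_drop hl (x := y) (b := l u) (by rw [hly]; exact Ne.symm hne)
      (by rw [hly]; exact hy') ⟨u, hfu⟩ h1 ?_
    exact hext huv he (by rw [hly]; exact Ne.symm hne) h1 (hA u y (Or.inl rfl) hy).symm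
      (hA v y (Or.inr rfl) hy).symm
  · -- a star and a clique
    have hlx := (hlab x u' hx (Or.inl rfl)).1
    refine not_adj_clique_of_drop hl (x := x) (b := l u') (by rw [hlx]; exact hne)
      (by rw [hlx]; exact hx') ⟨u', hfu'⟩ h2 ?_
    exact hext huv' he' (by rw [hlx]; exact hne) h2 (hA x u' hx (Or.inl rfl))
      (hA x v' hx (Or.inr rfl))
  · -- two stars: each gives away a leaf, and the two leaves form a pair
    obtain ⟨hlx, hly, hxy⟩ := hlab x y hx hy
    obtain ⟨b, hb⟩ := exists_unused_label huv.ne he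
    have e1 := labelWelfare_update (G := G) l (x := x) (b := b) (hb x)
    have hyx : y ≠ x := hxy.ne.symm
    have hly' : Function.update l x b y = l u' := by simp [hyx, hly]
    have e2 := labelWelfare_update (G := G) (Function.update l x b) (x := y) (b := b)
      (by rw [hly', ← hly]; exact hb y)
    have f1 : fiber l b = ∅ := by ext w; simp [mem_fiber, hb w]
    have f2 : fiber (Function.update l x b) b = {x} := by
      ext w
      rw [mem_fiber, mem_singleton]
      by_cases hw : w = x
      · simp [hw]
      · simp [hw, hb w]
    have f3 : fiber (Function.update l x b) (l u') = fiber l (l u') := by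
      ext w
      rw [mem_fiber, mem_fiber]
      by_cases hw : w = x
      · subst hw
        simp only [Function.update_self, hlx]
        exact ⟨fun h => absurd h.symm (hb u'), fun h => absurd h hne⟩
      · simp [hw]
    have s1 : ∀ w : V, coalitionWelfare G {w} = 0 := fun w => by
      rw [coalitionWelfare_of_clique G (singleton_nonempty w) (by simp)]; simp
    have s2 : coalitionWelfare G (insert y {x}) = 1 := by
      rw [coalitionWelfare_of_clique G (insert_nonempty _ _), card_pair hyx]
      · norm_num
      · intro a ha c hc hac
        simp only [mem_insert, mem_singleton] at ha hc
        rcases ha with rfl | rfl <;> rcases hc with rfl | rfl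
        · exact absurd rfl hac
        · exact hxy.symm
        · exact hxy
        · exact absurd rfl hac
    rw [f1, insert_empty_eq, coalitionWelfare_empty, s1, hlx] at e1
    rw [hly', f2, f3, s1, s2] at e2
    linarith [hl (Function.update (Function.update l x b) y b)]

end Labelling

/-! ### Merging along the tree of vertices and blocks -/

/-- A merge rule: a parent node in state `x` and a child node in state `y` may be merged; the parent
gets the state `z`, the welfare grows by `w`, and `j` tells what becomes of the coalition held by
the child: it is closed (`0`), it is united with the coalition held by the parent (`1`), or it is
united with it and closed (`2`). -/
structure Rule where
  /-- state of the parent before the merge -/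
  x : ℕ
  /-- state of the child before the merge -/
  y : ℕ
  /-- state of the parent after the merge -/
  z : ℕ
  /-- gain -/
  w : ℕ
  /-- kind -/
  j : ℕ

/-- The merge rules. A block is in state `0` if it holds a star centred in it that still waits for
one more leaf, `1` if it holds nothing, `2` if it holds a single vertex, `3` if it holds a clique. A
vertex is in state `5 + k` if it is the centre of a star with `k` leaves found so far (in
particular `5` if it is single) and `4` if its coalition is complete. The number `dl k` is the gain
of adding a leaf to a star with `k` leaves; adding a vertex to a clique gains `dl 0`. -/
inductive IsRule (T : ℕ) (dl : ℕ → ℕ) : Rule → Prop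
  | skipVertex (m b : ℕ) : m < T + 2 → b < 4 → IsRule T dl ⟨b, 4 + m, b, 0, 0⟩
  | skipBlock (m b : ℕ) : m < T + 2 → b < 3 → IsRule T dl ⟨4 + m, b + 1, 4 + m, 0, 0⟩
  | promise (k : ℕ) : k < T → IsRule T dl ⟨1, 5 + k, 0, dl k, 1⟩
  | absorb (k : ℕ) : k < T → IsRule T dl ⟨2, 5 + k, 1, dl k, 2⟩
  | leafBelow (k : ℕ) : k < T → IsRule T dl ⟨5 + k, 2, 6 + k, dl k, 1⟩
  | start : IsRule T dl ⟨1, 5, 2, 0, 1⟩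
  | second : IsRule T dl ⟨2, 5, 3, dl 0, 1⟩
  | further : IsRule T dl ⟨3, 5, 3, dl 0, 1⟩
  | fulfil : IsRule T dl ⟨0, 5, 1, 0, 2⟩
  | topPair : IsRule T dl ⟨5, 2, 4, dl 0, 1⟩
  | topClique : IsRule T dl ⟨5, 3, 4, dl 0, 1⟩
  | topLeaf : IsRule T dl ⟨5, 0, 4, 0, 1⟩

/-- The initial state of a node. The node `1` stands for no vertex; being complete, it joins no
coalition. -/
def initState (d : ℕ) : ℕ := if d = 1 then 4 else if d % 2 = 0 then 1 else 5

/-- A run merges the nodes `m - 1, …, 2` one after the other into their parents; `st c d` is the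
state of the node `d < c` once all nodes from `c` on have been merged, and `q c` is the rule by
which `c` is merged. -/
structure IsRun (R : Rule → Prop) (par : ℕ → ℕ) (m : ℕ) (st : ℕ → ℕ → ℕ) (q : ℕ → Rule) : Prop where
  init : ∀ d, 1 ≤ d → d < m → st m d = initState d
  rule : ∀ c, 2 ≤ c → c < m → R (q c)
  old : ∀ c, 2 ≤ c → c < m → (q c).x = st (c + 1) (par c)
  child : ∀ c, 2 ≤ c → c < m → (q c).y = st (c + 1) c
  new : ∀ c, 2 ≤ c → c < m → (q c).z = st c (par c)
  frame : ∀ c, 2 ≤ c → c < m → ∀ d, d < c → d ≠ par c → st c d = st (c + 1) d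

/-- The effect of the merge of `c` on the coalition of a vertex, where `inl d` is the coalition held
by the node `d`, and `inr d` is the one closed when `d` was merged. -/
def glue (par : ℕ → ℕ) (q : ℕ → Rule) (c : ℕ) : ℕ ⊕ ℕ → ℕ ⊕ ℕ
  | .inl d => if (q c).j = 0 then (if d = c then .inr c else .inl d)
      else if (q c).j = 1 then (if d = c then .inl (par c) else .inl d)
      else (if d = c ∨ d = par c then .inr c else .inl d)
  | .inr d => .inr d

section Tree
variable {V : Type*} [Fintype V] [DecidableEq V] {G : SimpleGraph V} [DecidableRel G.Adj]
  {pos tp rp : V → ℕ} {n : ℕ} {vx : ℕ → V} {par : ℕ → ℕ}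

variable (G pos tp rp n vx par) in
/-- The tree along which coalitions are merged: the node `2i + 1` is the vertex at position `i`, the
node `2i` is the block named `i`. A vertex hangs from the block that names it, a block from its
first vertex. If `i` is not the name of a block, then the node `2i` is an empty block. -/
structure IsBlockTree : Prop extends IsBlockOrder G pos tp rp where
  one_le_pos : ∀ v, 1 ≤ pos v
  pos_le : ∀ v, pos v ≤ n
  pos_vx : ∀ i, 1 ≤ i → i ≤ n → pos (vx i) = i
  par_vertex : ∀ v, par (2 * pos v + 1) = 2 * rp v
  par_block : ∀ v, par (2 * pos v) = 2 * tp v + 1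

variable (G pos rp) in
/-- What the state `s` of the node `d` says about the coalition `F` held by `d` and about the
welfare `ν` accounted to it. A star waiting for one more leaf is accounted in advance. -/
inductive Holds (d s : ℕ) (F : Finset V) (ν : ℚ) : Prop
  | waiting (i k : ℕ) (u : V) : d = 2 * i → s = 0 → rp u = i → u ∈ F → #F = k + 1 →
      (∀ w ∈ F, w ≠ u → G.Adj u w) → ν = starVal (k + 1) → Holds d s F ν
  | nothing (i : ℕ) : d = 2 * i → s = 1 → F = ∅ → ν = 0 → Holds d s F ν
  | clique (i : ℕ) : d = 2 * i → (s = 2 ∧ #F = 1 ∨ s = 3) → F.Nonempty → (∀ w ∈ F, rp w = i) →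
      ν = #F - 1 → Holds d s F ν
  | complete (i : ℕ) : d = 2 * i + 1 → s = 4 → ν ≤ coalitionWelfare G F → Holds d s F ν
  | star (i k : ℕ) (v : V) : d = 2 * i + 1 → s = 5 + k → pos v = i → v ∈ F → #F = k + 1 →
      (∀ w ∈ F, w ≠ v → G.Adj v w) → ν = starVal k → Holds d s F ν

theorem IsBlockTree.vx_pos (h : IsBlockTree G pos tp rp n vx par) (v : V) : vx (pos v) = v :=
  h.inj (h.pos_vx _ (h.one_le_pos v) (h.pos_le v))

theorem IsBlockTree.one_le_rp (h : IsBlockTree G pos tp rp n vx par) (v : V) : 1 ≤ rp v := by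
  have := h.tp_lt v; omega

theorem IsBlockTree.par_lt (h : IsBlockTree G pos tp rp n vx par) {c : ℕ} (h2 : 2 ≤ c)
    (hc : c < 2 * n + 2) : 1 ≤ par c ∧ par c < c := by
  have hp := h.pos_vx (c / 2) (by omega) (by omega)
  have h1 := h.rp_le (vx (c / 2))
  have h3 := h.tp_lt (vx (c / 2))
  rcases Nat.mod_two_eq_zero_or_one c with he | he
  · have := h.par_block (vx (c / 2))
    rw [hp, show 2 * (c / 2) = c by omega] at this
    omega
  · have := h.par_vertex (vx (c / 2))
    rw [hp, show 2 * (c / 2) + 1 = c by omega] at this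
    omega

theorem Holds.le {d s : ℕ} {F : Finset V} {ν : ℚ} (h : IsBlockTree G pos tp rp n vx par)
    (hh : Holds G pos rp d s F ν) (hs : s ≠ 0) : ν ≤ coalitionWelfare G F := by
  cases hh with
  | waiting i k u _ h2 => exact absurd h2 hs
  | nothing i _ _ h1 h2 => rw [h1, h2, coalitionWelfare_empty]
  | clique i _ _ h0 h1 h2 =>
    rw [h2, coalitionWelfare_of_clique G h0]
    exact fun u hu v hv huv => h.adj_of_rp_eq huv ((h1 u hu).trans (h1 v hv).symm)
  | complete i _ _ h1 => exact h1
  | star i k v _ _ _ h1 h2 h3 h4 =>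
    rw [h4]; exact starVal_le_coalitionWelfare G h1 h2 h3

theorem Holds.of_zero {d : ℕ} {F : Finset V} {ν : ℚ} (hh : Holds G pos rp d 0 F ν) :
    ∃ k u, d = 2 * rp u ∧ u ∈ F ∧ #F = k + 1 ∧ (∀ w ∈ F, w ≠ u → G.Adj u w) ∧
      ν = starVal (k + 1) := by
  cases hh with
  | waiting i k u h1 _ h2 h3 h4 h5 h6 => exact ⟨k, u, h2 ▸ h1, h3, h4, h5, h6⟩
  | nothing _ _ hs | complete _ _ hs | star _ _ _ _ hs | clique _ _ hs => omega

theorem Holds.of_one {d : ℕ} {F : Finset V} {ν : ℚ} (hh : Holds G pos rp d 1 F ν) :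
    d % 2 = 0 ∧ F = ∅ ∧ ν = 0 := by
  cases hh with
  | nothing i h1 _ h2 h3 => exact ⟨by omega, h2, h3⟩
  | waiting _ _ _ _ hs | complete _ _ hs | star _ _ _ _ hs | clique _ _ hs => omega

theorem Holds.of_clique {d s : ℕ} {F : Finset V} {ν : ℚ} (hh : Holds G pos rp d s F ν)
    (hs : s = 2 ∨ s = 3) :
    ∃ i, d = 2 * i ∧ (s = 2 → #F = 1) ∧ F.Nonempty ∧ (∀ w ∈ F, rp w = i) ∧ ν = #F - 1 := by
  cases hh with
  | clique i h1 h2 h3 h4 h5 => exact ⟨i, h1, by omega, h3, h4, h5⟩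
  | waiting _ _ _ _ hs | complete _ _ hs | star _ _ _ _ hs | nothing _ _ hs => omega

theorem Holds.of_star {d k : ℕ} {F : Finset V} {ν : ℚ} (hh : Holds G pos rp d (5 + k) F ν) :
    ∃ v, d = 2 * pos v + 1 ∧ v ∈ F ∧ #F = k + 1 ∧ (∀ w ∈ F, w ≠ v → G.Adj v w) ∧
      ν = starVal k := by
  cases hh with
  | star i k' v h1 h2 h3 h4 h5 h6 h7 =>
    obtain rfl : k' = k := by omega
    exact ⟨v, h3 ▸ h1, h4, h5, h6, h7⟩
  | waiting _ _ _ _ hs | complete _ _ hs | clique _ _ hs | nothing _ _ hs => omega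

theorem Holds.of_single {d : ℕ} {F : Finset V} {ν : ℚ} (hh : Holds G pos rp d 5 F ν) :
    ∃ v, d = 2 * pos v + 1 ∧ F = {v} ∧ ν = 0 := by
  obtain ⟨v, h1, h2, h3, -, h5⟩ := Holds.of_star (k := 0) hh
  refine ⟨v, h1, ?_, by simp [h5, starVal]⟩
  obtain ⟨t, ht⟩ := card_eq_one.1 h3
  rw [ht, mem_singleton] at h2; rw [ht, h2]

theorem star_union {A B : Finset V} {u : V} (hd : Disjoint A B)
    (hA : ∀ w ∈ A, w ≠ u → G.Adj u w) (hB : ∀ w ∈ B, w ≠ u → G.Adj u w) {k : ℕ}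
    (hk : #A + #B = k + 1) : #(A ∪ B) = k + 1 ∧ ∀ w ∈ A ∪ B, w ≠ u → G.Adj u w := by
  refine ⟨by rw [card_union_of_disjoint hd, hk], fun w hw hwu => ?_⟩
  rcases mem_union.1 hw with h | h
  · exact hA w h hwu
  · exact hB w h hwu

/-- Each rule preserves the meaning of the states: the united coalition is what the new state of the
parent says if the rule is of kind `1`, and it has at least the accounted welfare if the rule is of
kind `2`. -/
theorem Holds.merge (h : IsBlockTree G pos tp rp n vx par) {T : ℕ} {dl : ℕ → ℕ} {D : ℚ}
    (hD : 0 < D) (hT : 0 < T) (hdl : ∀ k < T, (dl k : ℚ) = D * (starVal (k + 1) - starVal k))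
    {c : ℕ} (h2 : 2 ≤ c) (hc : c < 2 * n + 2) {r : Rule} (hr : IsRule T dl r)
    {A B : Finset V} {a b : ℚ} (hd : Disjoint A B)
    (hA : Holds G pos rp (par c) r.x A a) (hB : Holds G pos rp c r.y B b) :
    (r.j = 0 ∧ r.w = 0 ∧ r.x = r.z ∧ r.y ≠ 0) ∨
    (r.j = 1 ∧ Holds G pos rp (par c) r.z (A ∪ B) (a + b + r.w / D)) ∨
    (r.j = 2 ∧ r.z = 1 ∧ par c % 2 = 0 ∧ a + b + r.w / D ≤ coalitionWelfare G (A ∪ B)) := by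
  have hdlD : ∀ k < T, (dl k : ℚ) / D = starVal (k + 1) - starVal k := fun k hk => by
    rw [hdl k hk]; field_simp
  have hs0 : starVal 0 = 0 := by simp [starVal]
  have hs1 : starVal 1 = 1 := by norm_num [starVal]
  have hdl0 : (dl 0 : ℚ) / D = 1 := by rw [hdlD 0 hT, hs0, hs1]; norm_num
  -- a vertex node hangs from its block, a block node from its first vertex
  have hvert : ∀ v, c = 2 * pos v + 1 → par c = 2 * rp v := fun v hv => by
    rw [hv, h.par_vertex]
  have hblock : ∀ w, c = 2 * rp w → par c = 2 * tp w + 1 := fun w hw => by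
    have hp := h.pos_vx (rp w) (by omega) (by omega)
    have := h.par_block (vx (rp w))
    rw [hp, ← hw] at this
    rw [this, h.tp_eq (vx (rp w)) w (h.rp_eq _ _ hp)]
  have hne : ∀ {u w : V}, u ∈ A → w ∈ B → u ≠ w := fun hu hw huw =>
    disjoint_left.1 hd hu (huw ▸ hw)
  have hcardU : #(A ∪ B) = #A + #B := card_union_of_disjoint hd
  have hclique : ∀ v, par c = 2 * pos v + 1 → ∀ {i}, c = 2 * i → (∀ w ∈ B, rp w = i) →
      ∀ u ∈ {v} ∪ B, ∀ w ∈ {v} ∪ B, u ≠ w → G.Adj u w := by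
    intro v hv i hi hB' u hu w hw huw
    have hvw : ∀ w ∈ B, G.Adj w v := fun w hw => h.adj_of_tp_eq (by
      have := hblock w (by rw [hB' w hw, hi]); omega)
    rcases mem_union.1 hu with hu | hu <;> rcases mem_union.1 hw with hw | hw
    · rw [mem_singleton] at hu hw; exact absurd (hu.trans hw.symm) huw
    · rw [mem_singleton.1 hu]; exact (hvw w hw).symm
    · rw [mem_singleton.1 hw]; exact hvw u hu
    · exact h.adj_of_rp_eq huw ((hB' u hu).trans (hB' w hw).symm)
  cases hr with
  | skipVertex m b hm hb => exact Or.inl ⟨rfl, rfl, rfl, by simp⟩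
  | skipBlock m b hm hb => exact Or.inl ⟨rfl, rfl, rfl, by simp⟩
  | promise k hk =>
    obtain ⟨-, rfl, rfl⟩ := hA.of_one
    obtain ⟨v, hv, hvB, hkB, hB', rfl⟩ := hB.of_star
    refine Or.inr (Or.inl ⟨rfl, .waiting (rp v) k v (hvert v hv) rfl rfl (by simp [hvB])
      (by simp [hkB]) (by simpa using hB') ?_⟩)
    simp only [hdlD k hk]; ring
  | absorb k hk =>
    obtain ⟨i, hi, hA1, -, hA', rfl⟩ := hA.of_clique (Or.inl rfl)
    obtain ⟨v, hv, hvB, hkB, hB', rfl⟩ := hB.of_star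
    have hpar := hvert v hv
    have hA1 := hA1 rfl
    refine Or.inr (Or.inr ⟨rfl, rfl, by omega, ?_⟩)
    obtain ⟨h1, h2⟩ := star_union (u := v) (k := k + 1) hd
      (fun w hw hwv => h.adj_of_rp_eq hwv.symm (by rw [hA' w hw]; omega)) hB' (by omega)
    refine le_trans (le_of_eq ?_) (starVal_le_coalitionWelfare G (mem_union_right _ hvB) h1 h2)
    simp only [hdlD k hk, hA1]; push_cast; ring
  | leafBelow k hk =>
    obtain ⟨v, hv, hvA, hkA, hA', rfl⟩ := hA.of_star
    obtain ⟨i, hi, hB1, -, hB', rfl⟩ := hB.of_clique (Or.inl rfl)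
    have hB1 := hB1 rfl
    obtain ⟨h1, h2⟩ := star_union (u := v) (k := k + 1) hd hA' (fun w hw hwv => by
      have := hblock w (by rw [hB' w hw, hi])
      exact (h.adj_of_tp_eq (by omega)).symm) (by omega)
    refine Or.inr (Or.inl ⟨rfl, .star (pos v) (k + 1) v hv (by simp only; omega) rfl
      (mem_union_left _ hvA) h1 h2 ?_⟩)
    simp only [hdlD k hk, hB1]; push_cast; ring
  | start =>
    obtain ⟨-, rfl, rfl⟩ := hA.of_one
    obtain ⟨v, hv, rfl, rfl⟩ := hB.of_single
    refine Or.inr (Or.inl ⟨rfl, .clique (rp v) (hvert v hv) (Or.inl ⟨rfl, by simp⟩) (by simp)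
      (by simp) (by simp)⟩)
  | second =>
    obtain ⟨i, hi, -, hA0, hA', rfl⟩ := hA.of_clique (Or.inl rfl)
    obtain ⟨v, hv, rfl, rfl⟩ := hB.of_single
    have hpar := hvert v hv
    refine Or.inr (Or.inl ⟨rfl, .clique i hi (Or.inr rfl) ⟨v, by simp⟩ ?_ ?_⟩)
    · intro w hw
      rcases mem_union.1 hw with hw | hw
      · exact hA' w hw
      · rw [mem_singleton.1 hw]; omega
    · rw [hcardU]; simp only [hdl0]; push_cast [card_singleton]; ring
  | further =>
    obtain ⟨i, hi, -, hA0, hA', rfl⟩ := hA.of_clique (Or.inr rfl)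
    obtain ⟨v, hv, rfl, rfl⟩ := hB.of_single
    have hpar := hvert v hv
    refine Or.inr (Or.inl ⟨rfl, .clique i hi (Or.inr rfl) ⟨v, by simp⟩ ?_ ?_⟩)
    · intro w hw
      rcases mem_union.1 hw with hw | hw
      · exact hA' w hw
      · rw [mem_singleton.1 hw]; omega
    · rw [hcardU]; simp only [hdl0]; push_cast [card_singleton]; ring
  | fulfil =>
    obtain ⟨k, u, hu, huA, hkA, hA', rfl⟩ := hA.of_zero
    obtain ⟨v, hv, rfl, rfl⟩ := hB.of_single
    have hpar := hvert v hv
    refine Or.inr (Or.inr ⟨rfl, rfl, by omega, ?_⟩)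
    obtain ⟨h1, h2⟩ := star_union (u := u) (k := k + 1) hd hA' (fun w hw hwu => by
      rw [mem_singleton.1 hw] at hwu ⊢
      exact h.adj_of_rp_eq hwu.symm (by omega)) (by rw [card_singleton]; omega)
    refine le_trans (le_of_eq ?_) (starVal_le_coalitionWelfare G (mem_union_left _ huA) h1 h2)
    simp
  | topPair =>
    obtain ⟨v, hv, rfl, rfl⟩ := hA.of_single
    obtain ⟨i, hi, -, hB0, hB', rfl⟩ := hB.of_clique (Or.inl rfl)
    refine Or.inr (Or.inl ⟨rfl, .complete (pos v) hv rfl ?_⟩)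
    rw [coalitionWelfare_of_clique G ⟨v, by simp⟩, hcardU]
    · simp only [hdl0]; push_cast [card_singleton]; linarith
    · exact hclique v hv hi hB'
  | topClique =>
    obtain ⟨v, hv, rfl, rfl⟩ := hA.of_single
    obtain ⟨i, hi, -, hB0, hB', rfl⟩ := hB.of_clique (Or.inr rfl)
    refine Or.inr (Or.inl ⟨rfl, .complete (pos v) hv rfl ?_⟩)
    rw [coalitionWelfare_of_clique G ⟨v, by simp⟩, hcardU]
    · simp only [hdl0]; push_cast [card_singleton]; linarith
    · exact hclique v hv hi hB'
  | topLeaf =>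
    obtain ⟨v, hv, rfl, rfl⟩ := hA.of_single
    obtain ⟨k, u, hu, huB, hkB, hB', rfl⟩ := hB.of_zero
    have hpar := hblock u hu
    refine Or.inr (Or.inl ⟨rfl, .complete (pos v) hv rfl ?_⟩)
    obtain ⟨h1, h2⟩ := star_union (u := u) (k := k + 1) hd (fun w hw _ => by
      rw [mem_singleton.1 hw]
      exact h.adj_of_tp_eq (by omega)) hB' (by rw [card_singleton]; omega)
    refine le_trans (le_of_eq ?_) (starVal_le_coalitionWelfare G (mem_union_right _ huB) h1 h2)
    simp

/-- The coalition in which `v` is once the nodes from `c` on have been merged. -/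
def heldBy (par : ℕ → ℕ) (q : ℕ → Rule) (pos : V → ℕ) (m c : ℕ) (v : V) : ℕ ⊕ ℕ :=
  Nat.rec (.inl (2 * pos v + 1)) (fun k x => glue par q (m - 1 - k) x) (m - c)

theorem heldBy_self (q : ℕ → Rule) (m : ℕ) (v : V) :
    heldBy par q pos m m v = .inl (2 * pos v + 1) := by simp [heldBy]

theorem heldBy_of_lt (q : ℕ → Rule) {m c : ℕ} (hc : c < m) (v : V) :
    heldBy par q pos m c v = glue par q c (heldBy par q pos m (c + 1) v) := by
  simp only [heldBy]
  have h1 : m - c = (m - (c + 1)) + 1 := by omega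
  have h2 : m - 1 - (m - (c + 1)) = c := by omega
  rw [h1]
  simp only [h2]

theorem sum_update_Ico {c p : ℕ} (f : ℕ → ℚ) (x : ℚ) (hp : 1 ≤ p) (hc : p < c) :
    ∑ d ∈ Ico 1 c, Function.update f p x d = ∑ d ∈ Ico 1 c, f d - f p + x := by
  have hmem : p ∈ Ico 1 c := by simp [hp, hc]
  rw [sum_update_of_mem hmem, ← sum_erase_add _ f hmem, ← sdiff_singleton_eq_erase]
  ring

/-- The accounting behind `IsRun.le_labelWelfare`: the accounted welfare of the coalitions held by
the nodes and of the closed ones sums up to the total gain so far. -/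
theorem IsRun.exists_account (h : IsBlockTree G pos tp rp n vx par) {T : ℕ} {dl : ℕ → ℕ} {D : ℚ}
    (hD : 0 < D) (hT : 0 < T) (hdl : ∀ k < T, (dl k : ℚ) = D * (starVal (k + 1) - starVal k))
    {st : ℕ → ℕ → ℕ} {q : ℕ → Rule} (hq : IsRun (IsRule T dl) par (2 * n + 2) st q)
    (k c : ℕ) (hk : c + k = 2 * n + 2) (h2 : 2 ≤ c) :
    ∃ ν μ : ℕ → ℚ,
      (∀ v d, heldBy par q pos (2 * n + 2) c v = .inl d → 1 ≤ d ∧ d < c) ∧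
      (∀ v d, heldBy par q pos (2 * n + 2) c v = .inr d → c ≤ d ∧ d < 2 * n + 2) ∧
      (∀ d, 1 ≤ d → d < c →
        Holds G pos rp d (st c d) (fiber (heldBy par q pos (2 * n + 2) c) (.inl d)) (ν d)) ∧
      (∀ d, c ≤ d → d < 2 * n + 2 →
        μ d ≤ coalitionWelfare G (fiber (heldBy par q pos (2 * n + 2) c) (.inr d))) ∧
      ∑ d ∈ Ico 1 c, ν d + ∑ d ∈ Ico c (2 * n + 2), μ d =
        ∑ d ∈ Ico c (2 * n + 2), ((q d).w : ℚ) / D := by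
  induction k generalizing c with
  | zero =>
    obtain rfl : c = 2 * n + 2 := hk
    refine ⟨fun _ => 0, fun _ => 0, ?_, ?_, ?_, ?_, by simp⟩
    · intro v d hd
      rw [heldBy_self, Sum.inl.injEq] at hd
      have := h.one_le_pos v
      have := h.pos_le v
      omega
    · intro v d hd
      rw [heldBy_self] at hd
      exact absurd hd (by simp)
    · intro d h1 hd
      rw [hq.init d h1 hd, initState]
      have hf : ∀ v, v ∈ fiber (heldBy par q pos (2 * n + 2) (2 * n + 2)) (.inl d) ↔
          2 * pos v + 1 = d := fun v => by rw [mem_fiber, heldBy_self, Sum.inl.injEq]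
      split_ifs with e1 e2
      · refine .complete 0 (by omega) rfl ?_
        rw [show fiber (heldBy par q pos (2 * n + 2) (2 * n + 2)) (.inl d) = ∅ by
          ext v
          have := h.one_le_pos v
          rw [hf]; simp; omega, coalitionWelfare_empty]
      · refine .nothing (d / 2) (by omega) rfl ?_ rfl
        ext v
        rw [hf]; simp; omega
      · have hp := h.pos_vx (d / 2) (by omega) (by omega)
        have he : fiber (heldBy par q pos (2 * n + 2) (2 * n + 2)) (.inl d) = {vx (d / 2)} := by
          ext v
          rw [hf, mem_singleton]
          constructor
          · intro hv; rw [← h.vx_pos v]; congr 1; omega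
          · rintro rfl; omega
        refine .star (d / 2) 0 (vx (d / 2)) (by omega) rfl hp ?_ ?_ ?_ ?_
        · rw [he]; exact mem_singleton_self _
        · rw [he]; simp
        · rw [he]; intro w hw hw'; exact absurd (mem_singleton.1 hw) hw'
        · simp [starVal]
    · intro d h1 hd; omega
  | succ k ih =>
    obtain ⟨ν, μ, h1, h3, h4, h5, h6⟩ := ih (c + 1) (by omega) (by omega)
    have hc : c < 2 * n + 2 := by omega
    obtain ⟨hp1, hpc⟩ := h.par_lt h2 hc
    have hdis : Disjoint (fiber (heldBy par q pos (2 * n + 2) (c + 1)) (.inl (par c)))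
        (fiber (heldBy par q pos (2 * n + 2) (c + 1)) (.inl c)) := by
      rw [disjoint_left]
      intro w hw hw'
      rw [mem_fiber] at hw hw'
      rw [hw, Sum.inl.injEq] at hw'
      omega
    have hA := h4 (par c) hp1 (by omega)
    have hB := h4 c (by omega) (by omega)
    rw [← hq.old c h2 hc] at hA
    rw [← hq.child c h2 hc] at hB
    have hstep : ∀ v, heldBy par q pos (2 * n + 2) c v =
      glue par q c (heldBy par q pos (2 * n + 2) (c + 1) v) := heldBy_of_lt q hc
    have hnew := hq.new c h2 hc
    have hfr := hq.frame c h2 hc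
    have hne : ∀ v, heldBy par q pos (2 * n + 2) (c + 1) v ≠ .inr c := fun v hv => by
      have := h3 v c hv; omega
    rw [sum_Ico_succ_top (by omega)] at h6
    have hmg := Holds.merge h hD hT hdl h2 hc (hq.rule c h2 hc) hdis hA hB
    generalize hgA : fiber (heldBy par q pos (2 * n + 2) (c + 1)) (.inl (par c)) = A at *
    generalize hgB : fiber (heldBy par q pos (2 * n + 2) (c + 1)) (.inl c) = B at *
    have hmA : ∀ v, v ∈ A ↔ heldBy par q pos (2 * n + 2) (c + 1) v = .inl (par c) := fun v => by
      rw [← hgA, mem_fiber]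
    have hmB : ∀ v, v ∈ B ↔ heldBy par q pos (2 * n + 2) (c + 1) v = .inl c := fun v => by
      rw [← hgB, mem_fiber]
    -- the coalitions that the merge does not touch
    have hfar : ∀ d, d < c → d ≠ par c → fiber (heldBy par q pos (2 * n + 2) c) (.inl d) =
        fiber (heldBy par q pos (2 * n + 2) (c + 1)) (.inl d) := by
      intro d hd hdp
      ext v
      rw [mem_fiber, mem_fiber, hstep]
      rcases hv : heldBy par q pos (2 * n + 2) (c + 1) v with e | e
      · simp only [glue]
        split_ifs with i1 i2 i3 i4 i5
        all_goals simp
        all_goals omega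
      · simp [glue]
    have hfar' : ∀ d, c < d → fiber (heldBy par q pos (2 * n + 2) c) (.inr d) =
        fiber (heldBy par q pos (2 * n + 2) (c + 1)) (.inr d) := by
      intro d hd
      ext v
      rw [mem_fiber, mem_fiber, hstep]
      rcases hv : heldBy par q pos (2 * n + 2) (c + 1) v with e | e
      · simp only [glue]
        split_ifs with i1 i2 i3 i4 i5
        all_goals simp
        all_goals omega
      · simp [glue]
    have hb1 : ∀ v d, heldBy par q pos (2 * n + 2) c v = .inl d → 1 ≤ d ∧ d < c := by
      intro v d
      rw [hstep]
      rcases hv : heldBy par q pos (2 * n + 2) (c + 1) v with e | e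
      · have := h1 v e hv
        simp only [glue]
        split_ifs with i1 i2 i3 i4 i5
        all_goals simp
        all_goals omega
      · simp [glue]
    have hb2 : ∀ v d, heldBy par q pos (2 * n + 2) c v = .inr d → c ≤ d ∧ d < 2 * n + 2 := by
      intro v d
      rw [hstep]
      rcases hv : heldBy par q pos (2 * n + 2) (c + 1) v with e | e
      · simp only [glue]
        split_ifs with i1 i2 i3 i4 i5
        all_goals simp
        all_goals omega
      · have := h3 v e hv
        simp [glue]; omega
    have hsum : ∀ g : ℕ → ℚ, ∑ d ∈ Ico c (2 * n + 2), g d =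
        g c + ∑ d ∈ Ico (c + 1) (2 * n + 2), g d := fun g => sum_eq_sum_Ico_succ_bot hc g
    have hupd : ∀ x : ℚ, ∑ d ∈ Ico (c + 1) (2 * n + 2), Function.update μ c x d =
        ∑ d ∈ Ico (c + 1) (2 * n + 2), μ d := fun x => by
      refine sum_congr rfl fun d hd => ?_
      rw [Function.update_of_ne]
      rw [mem_Ico] at hd; omega
    rcases hmg with ⟨hj, hw, hxz, hy⟩ | ⟨hj, hH⟩ | ⟨hj, hz, hpe, hle⟩
    · refine ⟨ν, Function.update μ c (ν c), hb1, hb2, ?_, ?_, ?_⟩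
      · intro d hd1 hdc
        by_cases hdp : d = par c
        · subst hdp
          have : fiber (heldBy par q pos (2 * n + 2) c) (.inl (par c)) = A := by
            ext v
            rw [mem_fiber, hmA, hstep]
            rcases hv : heldBy par q pos (2 * n + 2) (c + 1) v with e | e
            · simp only [glue, hj]
              split_ifs
              all_goals simp
              all_goals omega
            · simp [glue]
          rw [this, ← hnew, ← hxz]; exact hA
        · rw [hfar d hdc hdp, hfr d hdc hdp]; exact h4 d hd1 (by omega)
      · intro d hcd hd
        by_cases hdc : d = c
        · subst hdc
          have : fiber (heldBy par q pos (2 * n + 2) d) (.inr d) = B := by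
            ext v
            rw [mem_fiber, hmB, hstep]
            rcases hv : heldBy par q pos (2 * n + 2) (d + 1) v with e | e
            · simp only [glue, hj]
              split_ifs
              all_goals simp
              all_goals omega
            · have : e ≠ d := fun he => hne v (he ▸ hv)
              simp [glue, this]
          rw [this, Function.update_self]; exact hB.le h hy
        · rw [hfar' d (by omega), Function.update_of_ne hdc]; exact h5 d (by omega) hd
      · rw [hsum, hsum, hupd, Function.update_self, hw, ← h6]; push_cast; ring
    · refine ⟨Function.update ν (par c) (ν (par c) + ν c + (q c).w / D), Function.update μ c 0,
        hb1, hb2, ?_, ?_, ?_⟩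
      · intro d hd1 hdc
        by_cases hdp : d = par c
        · subst hdp
          have : fiber (heldBy par q pos (2 * n + 2) c) (.inl (par c)) = A ∪ B := by
            ext v
            rw [mem_fiber, mem_union, hmA, hmB, hstep]
            rcases hv : heldBy par q pos (2 * n + 2) (c + 1) v with e | e
            · simp only [glue, hj]
              by_cases e1 : e = c <;> simp [e1]
            · simp [glue]
          rw [this, Function.update_self, ← hnew]; exact hH
        · rw [hfar d hdc hdp, hfr d hdc hdp, Function.update_of_ne hdp]
          exact h4 d hd1 (by omega)
      · intro d hcd hd
        by_cases hdc : d = c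
        · subst hdc
          have : fiber (heldBy par q pos (2 * n + 2) d) (.inr d) = ∅ := by
            ext v
            rw [mem_fiber, hstep]
            rcases hv : heldBy par q pos (2 * n + 2) (d + 1) v with e | e
            · simp only [glue, hj]
              by_cases e1 : e = d <;> simp [e1]
            · have : e ≠ d := fun he => hne v (he ▸ hv)
              simp [glue, this]
          rw [this, Function.update_self, coalitionWelfare_empty]
        · rw [hfar' d (by omega), Function.update_of_ne hdc]; exact h5 d (by omega) hd
      · rw [hsum, hsum, hupd, Function.update_self, sum_update_Ico _ _ hp1 hpc, ← h6]; ring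
    · refine ⟨Function.update ν (par c) 0,
        Function.update μ c (ν (par c) + ν c + (q c).w / D), hb1, hb2, ?_, ?_, ?_⟩
      · intro d hd1 hdc
        by_cases hdp : d = par c
        · subst hdp
          have : fiber (heldBy par q pos (2 * n + 2) c) (.inl (par c)) = ∅ := by
            ext v
            rw [mem_fiber, hstep]
            rcases hv : heldBy par q pos (2 * n + 2) (c + 1) v with e | e
            · simp only [glue, hj]
              by_cases e1 : e = c ∨ e = par c
              · simp [e1]
              · simp [e1]; exact fun h => e1 (Or.inr h)
            · simp [glue]
          rw [this, Function.update_self, ← hnew, hz]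
          exact .nothing (par c / 2) (by omega) rfl rfl rfl
        · rw [hfar d hdc hdp, hfr d hdc hdp, Function.update_of_ne hdp]
          exact h4 d hd1 (by omega)
      · intro d hcd hd
        by_cases hdc : d = c
        · subst hdc
          have : fiber (heldBy par q pos (2 * n + 2) d) (.inr d) = A ∪ B := by
            ext v
            rw [mem_fiber, mem_union, hmA, hmB, hstep]
            rcases hv : heldBy par q pos (2 * n + 2) (d + 1) v with e | e
            · simp only [glue, hj]
              by_cases e1 : e = d ∨ e = par d
              · simpa [e1] using e1.symm
              · rw [not_or] at e1; simp [e1]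
            · have : e ≠ d := fun he => hne v (he ▸ hv)
              simp [glue, this]
          rw [this, Function.update_self]; exact hle
        · rw [hfar' d (by omega), Function.update_of_ne hdc]; exact h5 d (by omega) hd
      · rw [hsum, hsum, hupd, Function.update_self, sum_update_Ico _ _ hp1 hpc, ← h6]; ring

/-- The coalition structure produced by a run has at least the total gain of the run as welfare. -/
theorem IsRun.le_labelWelfare (h : IsBlockTree G pos tp rp n vx par) {T : ℕ} {dl : ℕ → ℕ} {D : ℚ}
    (hD : 0 < D) (hT : 0 < T) (hdl : ∀ k < T, (dl k : ℚ) = D * (starVal (k + 1) - starVal k))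
    {st : ℕ → ℕ → ℕ} {q : ℕ → Rule} (hq : IsRun (IsRule T dl) par (2 * n + 2) st q)
    (hend : st 2 1 = 4) :
    ∑ d ∈ Ico 2 (2 * n + 2), ((q d).w : ℚ) / D ≤
      labelWelfare G (heldBy par q pos (2 * n + 2) 2) := by
  obtain ⟨ν, μ, h1, h3, h4, h5, h6⟩ := hq.exists_account h hD hT hdl (2 * n) 2 (by ring) le_rfl
  rw [labelWelfare_eq_sum G _ ((Ico 1 2).disjSum (Ico 2 (2 * n + 2))), sum_disjSum, ← h6]
  · refine add_le_add (sum_le_sum fun d hd => ?_) (sum_le_sum fun d hd => ?_)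
    · rw [mem_Ico] at hd
      obtain rfl : d = 1 := by omega
      exact (h4 1 le_rfl (by omega)).le h (by rw [hend]; norm_num)
    · rw [mem_Ico] at hd
      exact h5 d hd.1 hd.2
  · intro v
    rcases hv : heldBy par q pos (2 * n + 2) 2 v with d | d
    · have := h1 v d hv
      simp; omega
    · have := h3 v d hv
      simp [this]

end Tree

/-! ### An optimal coalition structure as a run -/

section Optimal
variable {V : Type*} [Fintype V] [DecidableEq V] {G : SimpleGraph V} [DecidableRel G.Adj]
  {pos tp rp : V → ℕ} {n : ℕ} {vx : ℕ → V} {par : ℕ → ℕ} {l : V → V}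

variable (G l) in
/-- `z` is the centre of a star with at least two leaves. -/
def IsCentre (z : V) : Prop :=
  3 ≤ #(fiber l (l z)) ∧ (∀ w, l w = l z → w ≠ z → G.Adj z w) ∧
    ∀ u w, l u = l z → l w = l z → u ≠ z → w ≠ z → ¬ G.Adj u w

variable (G l) in
/-- The coalition of `v` is a clique. -/
def InClique (v : V) : Prop := ∀ u w, l u = l v → l w = l v → u ≠ w → G.Adj u w

variable (G pos tp rp l) in
/-- The properties of an optimal labelling that make it a run: the coalitions are cliques and stars,
and at most one coalition has two vertices in a given block. -/
structure IsTidy : Prop where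
  clique_or_star : ∀ v, InClique G l v ∨ ∃ z, l z = l v ∧ IsCentre G l z
  unique : ∀ b u w u' w', u ≠ w → l u = l w → u' ≠ w' → l u' = l w' → SameBlock pos tp rp b u →
    SameBlock pos tp rp b w → SameBlock pos tp rp b u' → SameBlock pos tp rp b w' → l u = l u'

/-- Here a pair counts as a clique, not as a star. -/
theorem IsBlockOrder.isTidy (h : IsBlockOrder G pos tp rp)
    (hl : ∀ l' : V → V, labelWelfare G l' ≤ labelWelfare G l)
    (hs : ∀ a, IsCliqueOrStar G (fiber l a)) : IsTidy G pos tp rp l where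
  clique_or_star v := by
    rcases hs (l v) with h1 | ⟨z, hz, h1, h2⟩
    · exact Or.inl fun u w hu hw => h1 u (mem_fiber.2 hu) w (mem_fiber.2 hw)
    · have hzv := mem_fiber.1 hz
      by_cases hc : 3 ≤ #(fiber l (l z))
      · exact Or.inr ⟨z, hzv, hc, fun w hw => h1 w (mem_fiber.2 (hw.trans hzv)),
          fun u w hu hw => h2 u (mem_fiber.2 (hu.trans hzv)) w (mem_fiber.2 (hw.trans hzv))⟩
      · left
        intro u w hu hw huw
        by_cases huz : u = z
        · subst huz; exact h1 w (mem_fiber.2 hw) huw.symm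
        by_cases hwz : w = z
        · subst hwz; exact (h1 u (mem_fiber.2 hu) huw).symm
        exfalso
        apply hc
        have h3 : #({u, w, z} : Finset V) = 3 := by
          rw [card_insert_of_notMem (by simp [huw, huz]), card_pair hwz]
        rw [← h3]
        refine card_le_card fun t ht => ?_
        simp only [mem_insert, mem_singleton] at ht
        rw [mem_fiber, hzv]
        rcases ht with rfl | rfl | rfl
        · exact hu
        · exact hw
        · exact hzv
  unique b u w u' w' huw he huw' he' h1 h2 h3 h4 := by
    refine h.label_eq_of_clique hl hs (h.adj_of_sameBlock huw h1 h2) (h.adj_of_sameBlock huw' h3 h4)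
      he he' fun x y hx hy hxy => h.adj_of_sameBlock (b := b) hxy ?_ ?_
    · rcases hx with rfl | rfl <;> assumption
    · rcases hy with rfl | rfl <;> assumption

theorem IsCentre.eq_of_adj {z v w : V} (hz : IsCentre G l z) (hv : l v = l z) (hvz : v ≠ z)
    (hw : l w = l z) (hvw : G.Adj v w) : w = z := by
  by_contra hwz
  exact hz.2.2 v w hv hw hvz hwz hvw

theorem IsCentre.not_inClique {z v : V} (hz : IsCentre G l z) (hv : l v = l z) :
    ¬ InClique G l v := by
  intro hc
  obtain ⟨u, hu, w, hw, huw⟩ := one_lt_card.1 (show 1 < #((fiber l (l z)).erase z) by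
    rw [card_erase_of_mem (mem_fiber.2 rfl)]; have := hz.1; omega)
  rw [mem_erase, mem_fiber] at hu hw
  exact hz.2.2 u w hu.2 hw.2 hu.1 hw.1 (hc u w (hu.2.trans hv.symm) (hw.2.trans hv.symm) huw)

theorem IsCentre.eq {z v : V} (hz : IsCentre G l z) (hv : IsCentre G l v) (he : l v = l z) :
    v = z := by
  by_contra hvz
  obtain ⟨u, hu, w, hw, huw⟩ := one_lt_card.1 (show 1 < #((fiber l (l z)).erase z) by
    rw [card_erase_of_mem (mem_fiber.2 rfl)]; have := hz.1; omega)
  rw [mem_erase, mem_fiber] at hu hw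
  obtain ⟨t, ht, htz, htv⟩ : ∃ t, l t = l z ∧ t ≠ z ∧ t ≠ v := by
    by_cases huv : u = v
    · exact ⟨w, hw.2, hw.1, fun h => huw (huv.trans h.symm)⟩
    · exact ⟨u, hu.2, hu.1, huv⟩
  exact htz (hz.eq_of_adj he hvz ht (hv.2.1 t (ht.trans he.symm) htv))

variable (pos tp rp l) in
/-- In its own block, `v` is together with another vertex. -/
def Joins (v : V) : Prop := ∃ w, w ≠ v ∧ l w = l v ∧ SameBlock pos tp rp v w

variable (pos tp rp l) in
/-- The vertices of the coalition of `v` in the blocks below `v` merged so far. -/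
def joinedBelow (c : ℕ) (v : V) : Finset V :=
  univ.filter fun w => l w = l v ∧ tp w = pos v ∧ c ≤ 2 * rp w

open Classical in
variable (pos tp rp l) in
/-- The vertices merged so far into the block named `i` that are together with another vertex of
that block. -/
noncomputable def joinedMembers (c i : ℕ) : Finset V :=
  univ.filter fun v => rp v = i ∧ c ≤ 2 * pos v + 1 ∧ Joins pos tp rp l v

open Classical in
variable (G pos tp rp l) in
/-- The state of the vertex `v` after the nodes from `c` on have been merged. -/
noncomputable def vertexState (c : ℕ) (v : V) : ℕ :=
  if IsCentre G l v then 5 + #(joinedBelow pos tp rp l c v)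
  else if joinedBelow pos tp rp l c v = ∅ then 5 else 4

open Classical in
variable (G pos tp rp l) in
/-- The state of the block named `i` after the nodes from `c` on have been merged. -/
noncomputable def blockState (c i : ℕ) : ℕ :=
  if joinedMembers pos tp rp l c i = ∅ then 1
  else if ∃ z ∈ joinedMembers pos tp rp l c i, IsCentre G l z then
    (if #(joinedMembers pos tp rp l c i) = 1 then 0 else 1)
  else (if #(joinedMembers pos tp rp l c i) = 1 then 2 else 3)

open Classical in
variable (G pos tp rp l) in
/-- The gain accounted to `v`: a centre accounts for its whole star; each vertex of a clique except
the last one accounts for `1` as soon as it is united with another vertex. -/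
noncomputable def accounted (c : ℕ) (v : V) : ℚ :=
  if IsCentre G l v then
    starVal (#(joinedBelow pos tp rp l c v) + if c ≤ 2 * pos v + 1 ∧ Joins pos tp rp l v then 1 else 0)
  else if InClique G l v ∧ (∃ u, l u = l v ∧ pos v < pos u) ∧
      ((c ≤ 2 * pos v + 1 ∧ Joins pos tp rp l v) ∨ joinedBelow pos tp rp l c v ≠ ∅) then 1
  else 0

theorem mem_joinedBelow {c : ℕ} {v w : V} : w ∈ joinedBelow pos tp rp l c v ↔
    l w = l v ∧ tp w = pos v ∧ c ≤ 2 * rp w := by simp [joinedBelow]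

theorem mem_joinedMembers {c i : ℕ} {v : V} : v ∈ joinedMembers pos tp rp l c i ↔
    rp v = i ∧ c ≤ 2 * pos v + 1 ∧ Joins pos tp rp l v := by simp [joinedMembers]

theorem joinedBelow_odd (i : ℕ) (u : V) :
    joinedBelow pos tp rp l (2 * i + 1) u = joinedBelow pos tp rp l (2 * i + 2) u := by
  ext w; rw [mem_joinedBelow, mem_joinedBelow]; constructor <;> rintro ⟨a, b, c⟩ <;>
    exact ⟨a, b, by omega⟩

theorem joinedMembers_even (i j : ℕ) :
    joinedMembers pos tp rp l (2 * i) j = joinedMembers pos tp rp l (2 * i + 1) j := by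
  ext w; rw [mem_joinedMembers, mem_joinedMembers]; constructor <;> rintro ⟨a, b, c⟩ <;>
    exact ⟨a, by omega, c⟩

theorem notMem_joinedMembers (i : ℕ) (v : V) : v ∉ joinedMembers pos tp rp l (2 * pos v + 2) i := by
  rw [mem_joinedMembers]; omega

theorem joinedMembers_step (h : IsBlockOrder G pos tp rp) {v : V} (hv : Joins pos tp rp l v) :
    joinedMembers pos tp rp l (2 * pos v + 1) (rp v) =
      insert v (joinedMembers pos tp rp l (2 * pos v + 2) (rp v)) := by
  ext w
  rw [mem_insert, mem_joinedMembers, mem_joinedMembers]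
  constructor
  · rintro ⟨a, b, c⟩
    by_cases hw : w = v
    · exact Or.inl hw
    · have : pos w ≠ pos v := fun e => hw (h.inj e)
      exact Or.inr ⟨a, by omega, c⟩
  · rintro (rfl | ⟨a, b, c⟩)
    · exact ⟨rfl, le_rfl, hv⟩
    · exact ⟨a, by omega, c⟩

theorem joinedMembers_of_ne (h : IsBlockOrder G pos tp rp) {v : V} {i : ℕ}
    (hv : rp v ≠ i ∨ ¬ Joins pos tp rp l v) :
    joinedMembers pos tp rp l (2 * pos v + 1) i = joinedMembers pos tp rp l (2 * pos v + 2) i := by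
  ext w
  rw [mem_joinedMembers, mem_joinedMembers]
  constructor
  · rintro ⟨a, b, c⟩
    by_cases hw : w = v
    · subst hw; exact absurd c (by tauto)
    · have : pos w ≠ pos v := fun e => hw (h.inj e)
      exact ⟨a, by omega, c⟩
  · rintro ⟨a, b, c⟩
    exact ⟨a, by omega, c⟩

theorem blockState_congr {c c' i : ℕ}
    (he : joinedMembers pos tp rp l c i = joinedMembers pos tp rp l c' i) :
    blockState G pos tp rp l c i = blockState G pos tp rp l c' i := by
  unfold blockState; rw [he]

theorem vertexState_congr {c c' : ℕ} {v : V}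
    (he : joinedBelow pos tp rp l c v = joinedBelow pos tp rp l c' v) :
    vertexState G pos tp rp l c v = vertexState G pos tp rp l c' v := by
  unfold vertexState; rw [he]

theorem accounted_congr {c c' : ℕ} {v : V}
    (he : joinedBelow pos tp rp l c v = joinedBelow pos tp rp l c' v)
    (hc : (c ≤ 2 * pos v + 1 ∧ Joins pos tp rp l v) ↔ (c' ≤ 2 * pos v + 1 ∧ Joins pos tp rp l v)) :
    accounted G pos tp rp l c v = accounted G pos tp rp l c' v := by
  classical
  unfold accounted
  simp only [he, hc]

theorem blockState_lt (c i : ℕ) : blockState G pos tp rp l c i < 4 := by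
  unfold blockState; split_ifs <;> norm_num

theorem joinedBelow_card_lt (h : IsBlockOrder G pos tp rp) {T : ℕ}
    (hT : ∀ v, #(univ.filter (fun w => G.Adj v w)) < T) (c : ℕ) (v : V) :
    #(joinedBelow pos tp rp l c v) < T := by
  refine lt_of_le_of_lt (card_le_card fun w hw => ?_) (hT v)
  rw [mem_joinedBelow] at hw
  simp only [mem_filter, mem_univ, true_and]
  exact (h.adj_of_tp_eq hw.2.1).symm

theorem sameBlock_self (v : V) : SameBlock pos tp rp v v := Or.inl rfl

theorem sameBlock_congr (h : IsBlockOrder G pos tp rp) {u v w : V} (he : rp u = rp v) :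
    SameBlock pos tp rp u w ↔ SameBlock pos tp rp v w := by
  unfold SameBlock; rw [he, h.tp_eq u v he]

/-- A vertex of a block other than its first one lies after the first one. -/
theorem not_tp_eq_of_sameBlock (h : IsBlockOrder G pos tp rp) {v w : V}
    (hw : SameBlock pos tp rp v w) : tp w ≠ pos v := by
  have := h.tp_lt_pos v
  have := h.tp_lt_pos w
  rcases hw with hw | hw
  · rw [h.tp_eq w v hw]; omega
  · omega

theorem label_eq_of_joined (ht : IsTidy G pos tp rp l) {v u w : V}
    {c : ℕ} (hwv : w ≠ v) (hlw : l w = l v) (hsv : SameBlock pos tp rp u v)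
    (hsw : SameBlock pos tp rp u w) (hu : u ∈ joinedMembers pos tp rp l c (rp u)) : l u = l v := by
  obtain ⟨-, -, u', hu', hlu', hsu'⟩ := mem_joinedMembers.1 hu
  exact ht.unique u u u' v w hu'.symm hlu'.symm hwv.symm hlw.symm (sameBlock_self u) hsu' hsv hsw

/-- Merging the vertex `v` into its block is an instance of a rule. -/
theorem exists_rule_vertex (h : IsBlockOrder G pos tp rp) (ht : IsTidy G pos tp rp l) {T : ℕ}
    {dl : ℕ → ℕ} {D : ℚ} (hdl : ∀ k < T, (dl k : ℚ) = D * (starVal (k + 1) - starVal k))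
    (hT : ∀ v, #(univ.filter (fun w => G.Adj v w)) < T) (v : V) :
    ∃ r, IsRule T dl r ∧ r.x = blockState G pos tp rp l (2 * pos v + 2) (rp v) ∧
      r.y = vertexState G pos tp rp l (2 * pos v + 2) v ∧
      r.z = blockState G pos tp rp l (2 * pos v + 1) (rp v) ∧
      (r.w : ℚ) = D * (accounted G pos tp rp l (2 * pos v + 1) v -
        accounted G pos tp rp l (2 * pos v + 2) v) := by
  classical
  have hT0 : 0 < T := lt_of_le_of_lt (Nat.zero_le _) (hT v)
  have hdl0 : (dl 0 : ℚ) = D := by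
    rw [hdl 0 hT0]; norm_num [starVal]
  have hcard := joinedBelow_card_lt (l := l) h hT (2 * pos v + 2) v
  have hnv : ¬ (2 * pos v + 2 ≤ 2 * pos v + 1 ∧ Joins pos tp rp l v) := by omega
  by_cases hj : Joins pos tp rp l v
  swap
  · -- `v` is not united with its block
    obtain ⟨m, hm, hmT⟩ : ∃ m, vertexState G pos tp rp l (2 * pos v + 2) v = 4 + m ∧ m < T + 2 := by
      unfold vertexState
      split_ifs
      · exact ⟨#(joinedBelow pos tp rp l (2 * pos v + 2) v) + 1, by omega, by omega⟩
      · exact ⟨1, rfl, by omega⟩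
      · exact ⟨0, rfl, by omega⟩
    refine ⟨_, .skipVertex m (blockState G pos tp rp l (2 * pos v + 2) (rp v)) hmT
      (blockState_lt _ _), rfl, hm.symm, ?_, ?_⟩
    · exact blockState_congr (joinedMembers_of_ne h (Or.inr hj)).symm
    · rw [accounted_congr (joinedBelow_odd (pos v) v) (by simp [hj])]; simp
  obtain ⟨w, hwv, hlw, hsw⟩ := hj
  have hj : Joins pos tp rp l v := ⟨w, hwv, hlw, hsw⟩
  have hvw : G.Adj v w := h.adj_of_sameBlock hwv.symm (sameBlock_self v) hsw
  have hlab : ∀ u ∈ joinedMembers pos tp rp l (2 * pos v + 2) (rp v),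
      l u = l v ∧ rp u = rp v ∧ pos v < pos u := by
    intro u hu
    have hm := mem_joinedMembers.1 hu
    refine ⟨?_, hm.1, by omega⟩
    refine label_eq_of_joined ht (c := 2 * pos v + 2) hwv hlw ?_ ?_ (by rw [hm.1]; exact hu)
    · exact (sameBlock_congr h hm.1).2 (sameBlock_self v)
    · exact (sameBlock_congr h hm.1).2 hsw
  have hstep := joinedMembers_step (l := l) h hj
  have hnot := notMem_joinedMembers (pos := pos) (tp := tp) (rp := rp) (l := l) (rp v) v
  set A := joinedMembers pos tp rp l (2 * pos v + 2) (rp v) with hA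
  have hAne : ∀ u ∈ A, u ≠ v := fun u hu he => hnot (he ▸ hu)
  have hAadj : ∀ u ∈ A, G.Adj u v := fun u hu =>
    h.adj_of_rp_eq (hAne u hu) (hlab u hu).2.1
  have hAadj' : ∀ u ∈ A, ∀ u' ∈ A, u ≠ u' → G.Adj u u' := fun u hu u' hu' hne =>
    h.adj_of_rp_eq hne ((hlab u hu).2.1.trans (hlab u' hu').2.1.symm)
  have hbs1 : blockState G pos tp rp l (2 * pos v + 1) (rp v) =
      if ∃ z ∈ insert v A, IsCentre G l z then (if A = ∅ then 0 else 1)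
      else (if A = ∅ then 2 else 3) := by
    have : #(insert v A) = 1 ↔ A = ∅ := by
      rw [card_insert_of_notMem hnot]; simp
    unfold blockState
    rw [hstep, if_neg (insert_ne_empty _ _)]
    simp only [this]
  have hbs2 : blockState G pos tp rp l (2 * pos v + 2) (rp v) =
      if A = ∅ then 1 else if ∃ z ∈ A, IsCentre G l z then (if #A = 1 then 0 else 1)
      else (if #A = 1 then 2 else 3) := rfl
  have hE0 : ∀ x ∈ joinedBelow pos tp rp l (2 * pos v + 2) v, G.Adj v x ∧ x ≠ v ∧ x ≠ w ∧
      l x = l v := by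
    intro x hx
    rw [mem_joinedBelow] at hx
    have := h.adj_of_tp_eq hx.2.1
    refine ⟨this.symm, this.ne, ?_, hx.1⟩
    rintro rfl
    exact not_tp_eq_of_sameBlock h hsw hx.2.1
  by_cases hc : IsCentre G l v
  · -- `v` is a centre; its leaf in the block may already be there
    have hacc : D * (accounted G pos tp rp l (2 * pos v + 1) v -
        accounted G pos tp rp l (2 * pos v + 2) v) =
        dl #(joinedBelow pos tp rp l (2 * pos v + 2) v) := by
      rw [hdl _ hcard]
      simp only [accounted, hc, joinedBelow_odd, if_true, hj, le_refl, and_true]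
      simp
    have hvs : vertexState G pos tp rp l (2 * pos v + 2) v =
        5 + #(joinedBelow pos tp rp l (2 * pos v + 2) v) := by simp [vertexState, hc]
    have hcen : ∃ z ∈ insert v A, IsCentre G l z := ⟨v, mem_insert_self _ _, hc⟩
    by_cases hA0 : A = ∅
    · refine ⟨_, .promise _ hcard, ?_, hvs.symm, ?_, hacc.symm⟩
      · simp [hbs2, hA0]
      · rw [hbs1, if_pos hcen, if_pos hA0]
    · refine ⟨_, .absorb _ hcard, ?_, hvs.symm, ?_, hacc.symm⟩
      · have h1 : ¬ ∃ z ∈ A, IsCentre G l z := by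
          rintro ⟨z, hz, hz'⟩
          exact hAne z hz (hc.eq hz' (hlab z hz).1)
        have h2 : #A = 1 := by
          refine le_antisymm (card_le_one.2 fun a ha b hb => ?_)
            (card_pos.2 (nonempty_iff_ne_empty.2 hA0))
          by_contra hab
          exact hc.2.2 a b (hlab a ha).1 (hlab b hb).1 (hAne a ha) (hAne b hb) (hAadj' a ha b hb hab)
        rw [hbs2, if_neg hA0, if_neg h1, if_pos h2]
      · rw [hbs1, if_pos hcen, if_neg hA0]
  rcases ht.clique_or_star v with hcl | ⟨z, hlz, hz⟩
  · -- `v` belongs to a clique in its block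
    have hE : joinedBelow pos tp rp l (2 * pos v + 2) v = ∅ := by
      rw [eq_empty_iff_forall_notMem]
      intro x hx
      obtain ⟨-, hxv, hxw, hlx⟩ := hE0 x hx
      rw [mem_joinedBelow] at hx
      have hadj := ((h.adj_iff x w).1 (hcl x w hlx hlw hxw)).2
      have hw' := h.tp_lt w
      have hw'' := h.rp_le w
      have hx' := h.tp_lt x
      have hx'' := h.rp_le x
      have hv' := h.tp_lt v
      have hv'' := h.rp_le v
      have hne : pos w ≠ pos v := fun e => hwv (h.inj e)
      rcases hsw with e | e
      · have := h.tp_eq w v e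
        omega
      · omega
    have hvs : vertexState G pos tp rp l (2 * pos v + 2) v = 5 := by simp [vertexState, hc, hE]
    have hnc : ¬ ∃ z ∈ insert v A, IsCentre G l z := by
      rintro ⟨z, hz, hz'⟩
      rcases mem_insert.1 hz with rfl | hz
      · exact hc hz'
      · exact hz'.not_inClique (hlab z hz).1.symm hcl
    have hnc' : ¬ ∃ z ∈ A, IsCentre G l z := fun ⟨z, hz, hz'⟩ => hnc ⟨z, mem_insert_of_mem hz, hz'⟩
    have ha2 : accounted G pos tp rp l (2 * pos v + 2) v = 0 := by
      simp [accounted, hc, hE]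
    by_cases hA0 : A = ∅
    · have ha1 : accounted G pos tp rp l (2 * pos v + 1) v = 0 := by
        rw [accounted, if_neg hc, if_neg]
        rintro ⟨-, ⟨u, hlu, hvu⟩, -⟩
        have huv : u ≠ v := by rintro rfl; omega
        have hu1 := h.tp_lt u
        have hv1 := h.tp_lt_pos v
        rcases ((h.adj_iff u v).1 (hcl u v hlu rfl huv)).2 with e | e | e
        · have : u ∈ A := mem_joinedMembers.2 ⟨e, by omega, v, huv.symm, hlu.symm, Or.inl e.symm⟩
          simp [hA0] at this
        · have : u ∈ joinedBelow pos tp rp l (2 * pos v + 2) v :=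
            mem_joinedBelow.2 ⟨hlu, e, by omega⟩
          simp [hE] at this
        · omega
      refine ⟨_, .start, ?_, hvs.symm, ?_, ?_⟩
      · simp [hbs2, hA0]
      · rw [hbs1, if_neg hnc, if_pos hA0]
      · rw [ha1, ha2]; simp
    · obtain ⟨u, hu⟩ := nonempty_iff_ne_empty.2 hA0
      have ha1 : accounted G pos tp rp l (2 * pos v + 1) v = 1 := by
        rw [accounted, if_neg hc, if_pos]
        exact ⟨hcl, ⟨u, (hlab u hu).1, (hlab u hu).2.2⟩, Or.inl ⟨le_rfl, hj⟩⟩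
      by_cases hA1 : #A = 1
      · refine ⟨_, .second, ?_, hvs.symm, ?_, ?_⟩
        · rw [hbs2, if_neg hA0, if_neg hnc', if_pos hA1]
        · rw [hbs1, if_neg hnc, if_neg hA0]
        · rw [ha1, ha2]; simp [hdl0]
      · refine ⟨_, .further, ?_, hvs.symm, ?_, ?_⟩
        · rw [hbs2, if_neg hA0, if_neg hnc', if_neg hA1]
        · rw [hbs1, if_neg hnc, if_neg hA0]
        · rw [ha1, ha2]; simp [hdl0]
  · -- `v` is a leaf of a star whose centre lies in the block of `v`
    have hvz : v ≠ z := by rintro rfl; exact hc hz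
    have hwz : w = z := hz.eq_of_adj hlz.symm hvz (hlw.trans hlz.symm) hvw
    have hncl : ¬ InClique G l v := hz.not_inClique hlz.symm
    have hE : joinedBelow pos tp rp l (2 * pos v + 2) v = ∅ := by
      rw [eq_empty_iff_forall_notMem]
      intro x hx
      obtain ⟨hvx, hxv, hxw, hlx⟩ := hE0 x hx
      exact hxw ((hz.eq_of_adj hlz.symm hvz (hlx.trans hlz.symm) hvx).trans hwz.symm)
    have hvs : vertexState G pos tp rp l (2 * pos v + 2) v = 5 := by simp [vertexState, hc, hE]
    have hAz : ∀ u ∈ A, u = z := fun u hu =>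
      hz.eq_of_adj hlz.symm hvz ((hlab u hu).1.trans hlz.symm) (hAadj u hu).symm
    have hacc : ∀ c, accounted G pos tp rp l c v = 0 := fun c => by
      simp [accounted, hc, hncl]
    by_cases hA0 : A = ∅
    · refine ⟨_, .start, ?_, hvs.symm, ?_, ?_⟩
      · simp [hbs2, hA0]
      · rw [hbs1, if_neg, if_pos hA0]
        rintro ⟨z', hz', hz''⟩
        simp only [hA0, insert_empty_eq, mem_singleton] at hz'
        exact hc (hz' ▸ hz'')
      · rw [hacc, hacc]; simp
    · have hAz' : A = {z} := by
        rw [eq_singleton_iff_nonempty_unique_mem]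
        exact ⟨nonempty_iff_ne_empty.2 hA0, hAz⟩
      refine ⟨_, .fulfil, ?_, hvs.symm, ?_, ?_⟩
      · rw [hbs2, if_neg hA0, if_pos ⟨z, by simp [hAz'], hz⟩, if_pos (by simp [hAz'])]
      · rw [hbs1, if_pos ⟨z, by simp [hAz'], hz⟩, if_neg hA0]
      · rw [hacc, hacc]; simp

end Optimal

/-! ### Blocks and the total gain of an optimal coalition structure -/

section Optimal
variable {V : Type*} [Fintype V] [DecidableEq V] {G : SimpleGraph V} [DecidableRel G.Adj]
  {pos tp rp : V → ℕ} {n : ℕ} {vx : ℕ → V} {par : ℕ → ℕ} {l : V → V}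

variable (G pos tp rp vx l) in
/-- The state of the node `d` after the nodes from `c` on have been merged. -/
noncomputable def nodeState (c d : ℕ) : ℕ :=
  if d = 1 then 4 else if d % 2 = 0 then blockState G pos tp rp l c (d / 2)
    else vertexState G pos tp rp l c (vx (d / 2))

theorem nodeState_block (c i : ℕ) :
    nodeState G pos tp rp vx l c (2 * i) = blockState G pos tp rp l c i := by
  have h1 : 2 * i ≠ 1 := by omega
  have h2 : 2 * i % 2 = 0 := by omega
  have h3 : 2 * i / 2 = i := by omega
  simp only [nodeState, h1, h2, h3, if_true, if_false]

theorem nodeState_vertex (h : IsBlockTree G pos tp rp n vx par) (c : ℕ) (v : V) :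
    nodeState G pos tp rp vx l c (2 * pos v + 1) = vertexState G pos tp rp l c v := by
  have h0 := h.one_le_pos v
  have h1 : 2 * pos v + 1 ≠ 1 := by omega
  have h2 : (2 * pos v + 1) % 2 ≠ 0 := by omega
  have h3 : (2 * pos v + 1) / 2 = pos v := by omega
  simp only [nodeState, h1, h2, h3, if_false, h.vx_pos]

/-- Merging the block at an even node changes only the vertex from which it hangs. -/
theorem joinedBelow_even_of_ne (h : IsBlockTree G pos tp rp n vx par) {i : ℕ} {v u : V}
    (hv : pos v = i) (hne : ∀ w, l w = l u → rp w = i → tp v ≠ pos u) :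
    joinedBelow pos tp rp l (2 * i) u = joinedBelow pos tp rp l (2 * i + 1) u := by
  ext w
  rw [mem_joinedBelow, mem_joinedBelow]
  constructor
  · rintro ⟨a, b, c⟩
    refine ⟨a, b, ?_⟩
    by_contra hlt
    have hw : rp w = i := by omega
    exact hne w a hw ((h.tp_eq v w (h.rp_eq v w (hv.trans hw.symm))).trans b)
  · rintro ⟨a, b, c⟩
    exact ⟨a, b, by omega⟩

/-- Merging a block into its first vertex is an instance of a rule. -/
theorem exists_rule_block (h : IsBlockTree G pos tp rp n vx par) (ht : IsTidy G pos tp rp l) {T : ℕ}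
    {dl : ℕ → ℕ} {D : ℚ} (hdl : ∀ k < T, (dl k : ℚ) = D * (starVal (k + 1) - starVal k))
    (hT : ∀ v, #(univ.filter (fun w => G.Adj v w)) < T) {i : ℕ} (h1 : 1 ≤ i) (hn : i ≤ n) :
    ∃ r, IsRule T dl r ∧ r.x = nodeState G pos tp rp vx l (2 * i + 1) (par (2 * i)) ∧
      r.y = nodeState G pos tp rp vx l (2 * i + 1) (2 * i) ∧
      r.z = nodeState G pos tp rp vx l (2 * i) (par (2 * i)) ∧
      (r.w : ℚ) = D * (∑ v, accounted G pos tp rp l (2 * i) v -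
        ∑ v, accounted G pos tp rp l (2 * i + 1) v) := by
  classical
  obtain ⟨v, hv⟩ : ∃ v, pos v = i := ⟨vx i, h.pos_vx i h1 hn⟩
  have hT0 : 0 < T := lt_of_le_of_lt (Nat.zero_le _) (hT v)
  have hdl0 : (dl 0 : ℚ) = D := by
    rw [hdl 0 hT0]; norm_num [starVal]
  have hpar : par (2 * i) = 2 * tp v + 1 := by rw [← hv, h.par_block]
  have htpi : ∀ w, rp w = i → tp w = tp v := fun w hw =>
    (h.tp_eq v w (h.rp_eq v w (hv.trans hw.symm))).symm
  have hacc : ∀ u, joinedBelow pos tp rp l (2 * i) u = joinedBelow pos tp rp l (2 * i + 1) u →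
      accounted G pos tp rp l (2 * i) u = accounted G pos tp rp l (2 * i + 1) u := fun u hu =>
    accounted_congr hu ⟨fun e => ⟨by omega, e.2⟩, fun e => ⟨by omega, e.2⟩⟩
  have hrpA : ∀ w, rp w = i → ∀ w', w' ≠ w → l w' = l w → SameBlock pos tp rp w w' →
      w ∈ joinedMembers pos tp rp l (2 * i + 1) i := fun w hw w' hne hl hs =>
    mem_joinedMembers.2 ⟨hw, by have := h.rp_le w; omega, w', hne, hl, hs⟩
  rw [hpar, nodeState_block]
  by_cases hcase : ∃ t j, pos t = tp v ∧ rp j = i ∧ l j = l t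
  swap
  · -- the block is not united with its first vertex
    push Not at hcase
    have hsame : ∀ u, joinedBelow pos tp rp l (2 * i) u = joinedBelow pos tp rp l (2 * i + 1) u :=
      fun u => joinedBelow_even_of_ne h hv fun w hlw hw hu => hcase u w hu.symm hw hlw
    have hstate : nodeState G pos tp rp vx l (2 * i + 1) (2 * tp v + 1) =
        nodeState G pos tp rp vx l (2 * i) (2 * tp v + 1) := by
      by_cases h0 : tp v = 0
      · simp [nodeState, h0]
      · have hp := h.pos_vx (tp v) (by omega) (by have := h.tp_lt_pos v; omega)
        rw [← hp, nodeState_vertex h, nodeState_vertex h]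
        exact (vertexState_congr (hsame _)).symm
    obtain ⟨m, hm, hmT⟩ : ∃ m, nodeState G pos tp rp vx l (2 * i + 1) (2 * tp v + 1) = 4 + m ∧
        m < T + 2 := by
      by_cases h0 : tp v = 0
      · exact ⟨0, by simp [nodeState, h0], by omega⟩
      · have hp := h.pos_vx (tp v) (by omega) (by have := h.tp_lt_pos v; omega)
        rw [← hp, nodeState_vertex h]
        have hcard := joinedBelow_card_lt (l := l) h.toIsBlockOrder hT (2 * i + 1) (vx (tp v))
        unfold vertexState
        split_ifs
        · exact ⟨#(joinedBelow pos tp rp l (2 * i + 1) (vx (tp v))) + 1, by omega, by omega⟩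
        · exact ⟨1, rfl, by omega⟩
        · exact ⟨0, rfl, by omega⟩
    obtain ⟨b, hb⟩ : ∃ b, blockState G pos tp rp l (2 * i + 1) i = b + 1 := by
      refine ⟨_, (Nat.succ_pred_eq_of_ne_zero ?_).symm⟩
      unfold blockState
      split_ifs with e1 e2 e3
      · norm_num
      · exfalso
        obtain ⟨z, hz, -⟩ := e2
        obtain ⟨hzi, -, w, hwz, hlw, hsw⟩ := mem_joinedMembers.1 hz
        rcases hsw with e | e
        · have hw := hrpA w (e.trans hzi) z hwz.symm hlw.symm (Or.inl e.symm)
          exact hwz (card_le_one.1 e3.le w hw z hz)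
        · exact hcase w z (e.trans (htpi z hzi)) hzi hlw.symm
      all_goals norm_num
    have hb4 := blockState_lt (G := G) (pos := pos) (tp := tp) (rp := rp) (l := l) (2 * i + 1) i
    refine ⟨_, .skipBlock m b hmT (by omega), hm.symm, hb.symm, ?_, ?_⟩
    · rw [← hstate, hm]
    · rw [sum_congr rfl fun u _ => hacc u (hsame u)]; simp
  obtain ⟨t, j, hpt, hji, hlj⟩ := hcase
  have hjt : j ≠ t := (h.adj_of_tp_eq ((htpi j hji).trans hpt.symm)).ne
  have hti : pos t < i := by have := h.tp_lt_pos v; omega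
  have hsum : ∑ u, accounted G pos tp rp l (2 * i) u - ∑ u, accounted G pos tp rp l (2 * i + 1) u =
      accounted G pos tp rp l (2 * i) t - accounted G pos tp rp l (2 * i + 1) t := by
    rw [← sum_sub_distrib]
    refine sum_eq_single t (fun u _ hu => ?_) (by simp)
    rw [hacc u, sub_self]
    exact joinedBelow_even_of_ne h hv fun w _ _ hw => hu (h.inj (by omega))
  rw [hsum, ← hpt, nodeState_vertex h, nodeState_vertex h]
  set A := joinedMembers pos tp rp l (2 * i + 1) i with hA
  have hlab : ∀ u ∈ A, l u = l t ∧ rp u = i ∧ G.Adj u t := by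
    intro u hu
    have hui := (mem_joinedMembers.1 hu).1
    have hpu : tp u = pos t := (htpi u hui).trans hpt.symm
    refine ⟨?_, hui, h.adj_of_tp_eq hpu⟩
    refine label_eq_of_joined ht (c := 2 * i + 1) (w := j) hjt hlj (Or.inr hpu.symm)
      (Or.inl (hji.trans hui.symm)) (by rw [hui]; exact hu)
  have hjA : j ∈ A := hrpA j hji t hjt.symm hlj.symm (Or.inr (hpt.trans (htpi j hji).symm))
  have hA0 : A ≠ ∅ := ne_empty_of_mem hjA
  have hAadj : ∀ u ∈ A, ∀ u' ∈ A, u ≠ u' → G.Adj u u' := fun u hu u' hu' hne =>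
    h.adj_of_rp_eq hne ((hlab u hu).2.1.trans (hlab u' hu').2.1.symm)
  have hbs : blockState G pos tp rp l (2 * i + 1) i = if ∃ z ∈ A, IsCentre G l z then
      (if #A = 1 then 0 else 1) else (if #A = 1 then 2 else 3) := by
    unfold blockState; rw [if_neg hA0]
  have hjb : joinedBelow pos tp rp l (2 * i) t = joinedBelow pos tp rp l (2 * i + 1) t ∪ A := by
    ext w
    rw [mem_union, mem_joinedBelow, mem_joinedBelow]
    constructor
    · rintro ⟨a, b, c⟩
      by_cases hw : rp w = i
      · exact Or.inr (hrpA w hw t (h.adj_of_tp_eq b).ne.symm a.symm (Or.inr b.symm))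
      · exact Or.inl ⟨a, b, by omega⟩
    · rintro (⟨a, b, c⟩ | hw)
      · exact ⟨a, b, by omega⟩
      · have := hlab w hw
        exact ⟨this.1, (htpi w this.2.1).trans hpt.symm, by omega⟩
  have hdis : Disjoint (joinedBelow pos tp rp l (2 * i + 1) t) A := by
    rw [disjoint_left]
    intro w hw hw'
    rw [mem_joinedBelow] at hw
    have := (hlab w hw').2.1
    omega
  have hne' : joinedBelow pos tp rp l (2 * i) t ≠ ∅ := by
    rw [hjb]; exact ne_empty_of_mem (mem_union_right _ hjA)
  have hE : ∀ x ∈ joinedBelow pos tp rp l (2 * i + 1) t, l x = l t ∧ G.Adj t x ∧ tp x = pos t ∧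
      i < rp x := by
    intro x hx
    rw [mem_joinedBelow] at hx
    exact ⟨hx.1, (h.adj_of_tp_eq hx.2.1).symm, hx.2.1, by omega⟩
  by_cases hc : IsCentre G l t
  · -- the first vertex of the block is a centre and gets one more leaf
    have hA1 : #A = 1 := by
      refine le_antisymm (card_le_one.2 fun a ha b hb => ?_) (card_pos.2 ⟨j, hjA⟩)
      by_contra hab
      exact hc.2.2 a b (hlab a ha).1 (hlab b hb).1 (hlab a ha).2.2.ne (hlab b hb).2.2.ne
        (hAadj a ha b hb hab)
    have hnc : ¬ ∃ z ∈ A, IsCentre G l z := by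
      rintro ⟨z, hz, hz'⟩
      exact (hlab z hz).2.2.ne (hc.eq hz' (hlab z hz).1)
    have hcd : #(joinedBelow pos tp rp l (2 * i) t) =
        #(joinedBelow pos tp rp l (2 * i + 1) t) + 1 := by
      rw [hjb, card_union_of_disjoint hdis, hA1]
    refine ⟨_, .leafBelow #(joinedBelow pos tp rp l (2 * i + 1) t)
      (joinedBelow_card_lt h.toIsBlockOrder hT _ _), ?_, ?_, ?_, ?_⟩
    · simp [vertexState, hc]
    · rw [hbs, if_neg hnc, if_pos hA1]
    · rw [vertexState, if_pos hc, hcd]; ring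
    · have e1 : ¬ (2 * i ≤ 2 * pos t + 1 ∧ Joins pos tp rp l t) := by omega
      have e2 : ¬ (2 * i + 1 ≤ 2 * pos t + 1 ∧ Joins pos tp rp l t) := by omega
      rw [accounted, accounted, if_pos hc, if_pos hc, if_neg e1, if_neg e2, hcd,
        hdl _ (joinedBelow_card_lt h.toIsBlockOrder hT _ _)]
      simp
  have hvs' : vertexState G pos tp rp l (2 * i) t = 4 := by
    rw [vertexState, if_neg hc, if_neg hne']
  rcases ht.clique_or_star t with hcl | ⟨z, hlz, hz⟩
  · -- the first vertex completes a clique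
    have hE0 : joinedBelow pos tp rp l (2 * i + 1) t = ∅ := by
      rw [eq_empty_iff_forall_notMem]
      intro x hx
      obtain ⟨hlx, htx, hpx, hix⟩ := hE x hx
      have hxj : x ≠ j := by rintro rfl; omega
      have hadj := ((h.adj_iff x j).1 (hcl x j hlx hlj hxj)).2
      have hj1 := h.rp_le j
      have hj2 := htpi j hji
      have hx1 := h.rp_le x
      rcases hadj with e | e | e <;> omega
    have hvs : vertexState G pos tp rp l (2 * i + 1) t = 5 := by
      rw [vertexState, if_neg hc, if_pos hE0]
    have hnc : ¬ ∃ z ∈ A, IsCentre G l z := by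
      rintro ⟨z, hz, hz'⟩
      exact hz'.not_inClique (hlab z hz).1.symm hcl
    have ha2 : accounted G pos tp rp l (2 * i + 1) t = 0 := by
      rw [accounted, if_neg hc, if_neg]
      rintro ⟨-, -, e | e⟩
      · omega
      · exact e hE0
    have ha1 : accounted G pos tp rp l (2 * i) t = 1 := by
      rw [accounted, if_neg hc, if_pos]
      exact ⟨hcl, ⟨j, hlj, by have := h.rp_le j; omega⟩, Or.inr hne'⟩
    by_cases hA1 : #A = 1
    · refine ⟨_, .topPair, hvs.symm, ?_, hvs'.symm, ?_⟩
      · rw [hbs, if_neg hnc, if_pos hA1]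
      · rw [ha1, ha2]; simp [hdl0]
    · refine ⟨_, .topClique, hvs.symm, ?_, hvs'.symm, ?_⟩
      · rw [hbs, if_neg hnc, if_neg hA1]
      · rw [ha1, ha2]; simp [hdl0]
  · -- the first vertex is a leaf of a star whose centre lies in the block
    have htz : t ≠ z := by rintro rfl; exact hc hz
    have hncl : ¬ InClique G l t := hz.not_inClique hlz.symm
    have hAz : A = {z} := by
      rw [eq_singleton_iff_nonempty_unique_mem]
      exact ⟨⟨j, hjA⟩, fun u hu => hz.eq_of_adj hlz.symm htz ((hlab u hu).1.trans hlz.symm)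
        (hlab u hu).2.2.symm⟩
    have hzi : rp z = i := (hlab z (by rw [hAz]; exact mem_singleton_self z)).2.1
    have hE0 : joinedBelow pos tp rp l (2 * i + 1) t = ∅ := by
      rw [eq_empty_iff_forall_notMem]
      intro x hx
      obtain ⟨hlx, htx, hpx, hix⟩ := hE x hx
      have := hz.eq_of_adj hlz.symm htz (hlx.trans hlz.symm) htx
      subst this
      omega
    have hvs : vertexState G pos tp rp l (2 * i + 1) t = 5 := by
      rw [vertexState, if_neg hc, if_pos hE0]
    have hacc : ∀ c, accounted G pos tp rp l c t = 0 := fun c => by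
      simp [accounted, hc, hncl]
    refine ⟨_, .topLeaf, hvs.symm, ?_, hvs'.symm, ?_⟩
    · rw [hbs, if_pos ⟨z, by simp [hAz], hz⟩, if_pos (by simp [hAz])]
    · rw [hacc, hacc]; simp

theorem starVal_mono {a b : ℕ} (h : a ≤ b) : starVal a ≤ starVal b := by
  induction b, h using Nat.le_induction with
  | base => exact le_rfl
  | succ b _ ih =>
    have := starVal_succ_sub b
    have : (0 : ℚ) < 2 / ((b + 1) * (b + 2)) := by positivity
    linarith

/-- Once all nodes have been merged, the whole welfare is accounted: in a clique with `k` vertices all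
but the last one account for `1`, in a star the centre accounts for all leaves. -/
theorem labelWelfare_le_accounted (h : IsBlockTree G pos tp rp n vx par)
    (ht : IsTidy G pos tp rp l) : labelWelfare G l ≤ ∑ v, accounted G pos tp rp l 2 v := by
  classical
  rw [labelWelfare_eq_sum G l univ (by simp),
    ← sum_fiberwise_of_maps_to (s := univ) (t := univ) (g := l) (fun v _ => mem_univ _)
      (fun v => accounted G pos tp rp l 2 v)]
  refine sum_le_sum fun a _ => ?_
  have hE : ∀ {v w : V}, l w = l v → tp w = pos v → w ∈ joinedBelow pos tp rp l 2 v :=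
    fun {v w} h1 h2 => mem_joinedBelow.2 ⟨h1, h2, by have := h.one_le_rp w; omega⟩
  have h2v : ∀ v, 2 ≤ 2 * pos v + 1 := fun v => by have := h.one_le_pos v; omega
  have hnn : ∀ v, 0 ≤ accounted G pos tp rp l 2 v := fun v => by
    unfold accounted
    split_ifs
    all_goals first | exact zero_le_one | exact le_rfl | (unfold starVal; positivity)
  change coalitionWelfare G (fiber l a) ≤ ∑ v ∈ fiber l a, accounted G pos tp rp l 2 v
  rcases (fiber l a).eq_empty_or_nonempty with he | ⟨v, hv⟩
  · simp [he, coalitionWelfare_empty]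
  have hva := mem_fiber.1 hv
  rcases ht.clique_or_star v with hcl | ⟨z, hlz, hz⟩
  · -- a clique, with the last vertex `m`
    obtain ⟨m, hm, hmax⟩ := exists_max_image (fiber l a) pos ⟨v, hv⟩
    rw [coalitionWelfare_of_clique G ⟨v, hv⟩ fun u hu w hw => hcl u w
      ((mem_fiber.1 hu).trans hva.symm) ((mem_fiber.1 hw).trans hva.symm)]
    have hone : ∀ u ∈ (fiber l a).erase m, accounted G pos tp rp l 2 u = 1 := by
      intro u hu
      rw [mem_erase] at hu
      have hlu := mem_fiber.1 hu.2
      have hlm := mem_fiber.1 hm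
      have hlt : pos u < pos m := lt_of_le_of_ne (hmax u hu.2) fun e => hu.1 (h.inj e)
      have hnc : ¬ IsCentre G l u := fun hc => hc.not_inClique (hva.trans hlu.symm) hcl
      have hcu : InClique G l u := fun x y hx hy => hcl x y (hx.trans (hlu.trans hva.symm))
        (hy.trans (hlu.trans hva.symm))
      rw [accounted, if_neg hnc, if_pos]
      refine ⟨hcu, ⟨m, hlm.trans hlu.symm, hlt⟩, ?_⟩
      have h1 := h.tp_lt_pos u
      rcases ((h.adj_iff m u).1 (hcl m u (hlm.trans hva.symm) (hlu.trans hva.symm) hu.1.symm)).2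
        with e | e | e
      · exact Or.inl ⟨h2v u, m, hu.1.symm, hlm.trans hlu.symm, Or.inl e⟩
      · exact Or.inr (ne_empty_of_mem (hE (hlm.trans hlu.symm) e))
      · omega
    rw [← sum_erase_add _ _ hm, sum_congr rfl hone, sum_const, card_erase_of_mem hm, nsmul_eq_mul,
      mul_one, Nat.cast_sub (card_pos.2 ⟨v, hv⟩)]
    push_cast
    linarith [hnn m]
  · -- a star with the centre `z`, of whose leaves at most one lies in the block of `z`
    have hza : l z = a := hlz.trans hva
    have hzf : z ∈ fiber l a := mem_fiber.2 hza
    obtain ⟨k, hk⟩ : ∃ k, #(fiber l a) = k + 1 :=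
      ⟨#(fiber l a) - 1, (Nat.sub_add_cancel (card_pos.2 ⟨v, hv⟩)).symm⟩
    rw [coalitionWelfare_of_star G hzf hk
      (fun w hw => hz.2.1 w ((mem_fiber.1 hw).trans hza.symm))
      (fun u hu w hw => hz.2.2 u w ((mem_fiber.1 hu).trans hza.symm)
        ((mem_fiber.1 hw).trans hza.symm))]
    refine le_trans ?_ (single_le_sum (fun v _ => hnn v) hzf)
    rw [accounted, if_pos hz]
    refine starVal_mono ?_
    set S := univ.filter fun w => w ≠ z ∧ l w = l z ∧ SameBlock pos tp rp z w with hS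
    have hSmem : ∀ w, w ∈ S ↔ w ≠ z ∧ l w = l z ∧ SameBlock pos tp rp z w := by simp [hS]
    have hS1 : #S ≤ if 2 ≤ 2 * pos z + 1 ∧ Joins pos tp rp l z then 1 else 0 := by
      split_ifs with hj
      · refine card_le_one.2 fun x hx y hy => ?_
        by_contra hxy
        rw [hSmem] at hx hy
        exact hz.2.2 x y hx.2.1 hy.2.1 hx.1 hy.1 (h.adj_of_sameBlock hxy hx.2.2 hy.2.2)
      · rw [Nat.le_zero, card_eq_zero, eq_empty_iff_forall_notMem]
        intro x hx
        exact hj ⟨h2v z, x, (hSmem x).1 hx⟩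
    have hsub : (fiber l a).erase z ⊆ joinedBelow pos tp rp l 2 z ∪ S := by
      intro w hw
      rw [mem_erase, mem_fiber] at hw
      have hlw := hw.2.trans hza.symm
      rw [mem_union, hSmem]
      rcases ((h.adj_iff w z).1 (hz.2.1 w hlw hw.1).symm).2 with e | e | e
      · exact Or.inr ⟨hw.1, hlw, Or.inl e⟩
      · exact Or.inl (hE hlw e)
      · exact Or.inr ⟨hw.1, hlw, Or.inr e.symm⟩
    have := (card_le_card hsub).trans (card_union_le _ _)
    rw [card_erase_of_mem hzf, hk] at this
    omega

/-- A tidy labelling is realised by a run whose gain is at least its welfare. The factor `D` clears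
the denominators of the gains. -/
theorem exists_run (h : IsBlockTree G pos tp rp n vx par) (ht : IsTidy G pos tp rp l) {T : ℕ}
    {dl : ℕ → ℕ} {D : ℚ} (hD : 0 < D)
    (hdl : ∀ k < T, (dl k : ℚ) = D * (starVal (k + 1) - starVal k))
    (hT : ∀ v, #(univ.filter (fun w => G.Adj v w)) < T) :
    ∃ st q, IsRun (IsRule T dl) par (2 * n + 2) st q ∧ st 2 1 = 4 ∧
      D * labelWelfare G l ≤ ∑ c ∈ Ico 2 (2 * n + 2), ((q c).w : ℚ) := by
  classical
  have hrule : ∀ c, ∃ r : Rule, 2 ≤ c → c < 2 * n + 2 → IsRule T dl r ∧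
      r.x = nodeState G pos tp rp vx l (c + 1) (par c) ∧
      r.y = nodeState G pos tp rp vx l (c + 1) c ∧ r.z = nodeState G pos tp rp vx l c (par c) ∧
      (r.w : ℚ) = D * (∑ v, accounted G pos tp rp l c v -
        ∑ v, accounted G pos tp rp l (c + 1) v) := by
    intro c
    by_cases hc : 2 ≤ c ∧ c < 2 * n + 2
    swap
    · exact ⟨⟨0, 0, 0, 0, 0⟩, fun h1 h2 => absurd ⟨h1, h2⟩ hc⟩
    rcases Nat.even_or_odd' c with ⟨i, rfl | rfl⟩
    · obtain ⟨r, hr⟩ := exists_rule_block (l := l) h ht hdl hT (i := i) (by omega) (by omega)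
      exact ⟨r, fun _ _ => hr⟩
    · obtain ⟨v, hv⟩ : ∃ v, pos v = i := ⟨vx i, h.pos_vx i (by omega) (by omega)⟩
      obtain ⟨r, h1, h2, h3, h4, h5⟩ := exists_rule_vertex h.toIsBlockOrder ht hdl hT v
      subst hv
      refine ⟨r, fun _ _ => ⟨h1, ?_, ?_, ?_, ?_⟩⟩
      · rw [h.par_vertex, nodeState_block]; exact h2
      · rw [nodeState_vertex h]; exact h3
      · rw [h.par_vertex, nodeState_block]; exact h4
      · rw [h5, ← sum_sub_distrib]
        congr 1
        symm
        refine sum_eq_single v (fun u _ hu => ?_) (by simp)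
        have hne : pos u ≠ pos v := fun e => hu (h.inj e)
        rw [accounted_congr (joinedBelow_odd (pos v) u), sub_self]
        constructor <;> rintro ⟨a, b⟩ <;> exact ⟨by omega, b⟩
  choose q hq using hrule
  have hJM : ∀ i, joinedMembers pos tp rp l (2 * n + 2) i = ∅ := fun i => by
    rw [eq_empty_iff_forall_notMem]
    intro v hv
    have := (mem_joinedMembers.1 hv).2.1
    have := h.pos_le v
    omega
  have hJB : ∀ v, joinedBelow pos tp rp l (2 * n + 2) v = ∅ := fun v => by
    rw [eq_empty_iff_forall_notMem]
    intro w hw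
    have := (mem_joinedBelow.1 hw).2.2
    have := h.pos_le w
    have := h.rp_le w
    omega
  refine ⟨nodeState G pos tp rp vx l, q, ?_, by simp [nodeState], ?_⟩
  · refine ⟨?_, fun c h2 hc => (hq c h2 hc).1, fun c h2 hc => (hq c h2 hc).2.1,
      fun c h2 hc => (hq c h2 hc).2.2.1, fun c h2 hc => (hq c h2 hc).2.2.2.1, ?_⟩
    · intro d _ _
      simp only [nodeState, initState, blockState, vertexState, hJM, hJB]
      simp
    · intro c h2 hc d hd hne
      rcases Nat.even_or_odd' c with ⟨i, rfl | rfl⟩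
      · have hp := h.pos_vx i (by omega) (by omega)
        rcases Nat.even_or_odd' d with ⟨k, rfl | rfl⟩
        · rw [nodeState_block, nodeState_block]
          exact blockState_congr (joinedMembers_even _ _)
        · rcases Nat.eq_zero_or_pos k with rfl | hk
          · simp [nodeState]
          · have hpk := h.pos_vx k (by omega) (by omega)
            rw [← hpk, nodeState_vertex h, nodeState_vertex h]
            refine vertexState_congr (joinedBelow_even_of_ne h hp fun w _ _ e => hne ?_)
            have := h.par_block (vx i)
            rw [hp, e, hpk] at this
            exact this.symm
      · have hp := h.pos_vx i (by omega) (by omega)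
        rcases Nat.even_or_odd' d with ⟨k, rfl | rfl⟩
        · rw [nodeState_block, nodeState_block, ← hp]
          refine blockState_congr (joinedMembers_of_ne h.toIsBlockOrder (Or.inl fun e => hne ?_))
          have := h.par_vertex (vx i)
          rw [hp, e] at this
          exact this.symm
        · rcases Nat.eq_zero_or_pos k with rfl | hk
          · simp [nodeState]
          · have hpk := h.pos_vx k (by omega) (by omega)
            rw [← hpk, nodeState_vertex h, nodeState_vertex h]
            exact vertexState_congr (joinedBelow_odd _ _)
  · have htel : ∀ k c, c + k = 2 * n + 2 → 2 ≤ c → ∑ d ∈ Ico c (2 * n + 2), ((q d).w : ℚ) =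
        D * (∑ v, accounted G pos tp rp l c v - ∑ v, accounted G pos tp rp l (2 * n + 2) v) := by
      intro k
      induction k with
      | zero => rintro c rfl _; simp
      | succ k ih =>
        intro c hc h2
        rw [sum_eq_sum_Ico_succ_bot (by omega), ih (c + 1) (by omega) (by omega),
          (hq c h2 (by omega)).2.2.2.2]
        ring
    have hzero : ∑ v, accounted G pos tp rp l (2 * n + 2) v = 0 := by
      refine sum_eq_zero fun v _ => ?_
      have h1 : ¬ (2 * n + 2 ≤ 2 * pos v + 1 ∧ Joins pos tp rp l v) := by
        have := h.pos_le v
        omega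
      simp only [accounted, hJB, h1]
      simp [starVal]
    rw [htel (2 * n) 2 (by ring) le_rfl, hzero, sub_zero]
    exact mul_le_mul_of_nonneg_left (labelWelfare_le_accounted h ht) hD.le

end Optimal

/-! ### Search orders of block graphs -/

section Search
variable {V : Type*} [Fintype V] [DecidableEq V] {G : SimpleGraph V} [DecidableRel G.Adj]

theorem Linked.preconnected {C : Finset V} (hC : Linked G C) :
    (G.induce (C : Set V)).Preconnected := by
  classical
  rintro ⟨u, hu⟩ ⟨v, hv⟩
  set X := C.filter fun w => ∃ hw : w ∈ (C : Set V), (G.induce (C : Set V)).Reachable ⟨u, hu⟩ ⟨w, hw⟩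
    with hX
  by_cases hXC : X = C
  · have : v ∈ X := hXC ▸ hv
    rw [hX, mem_filter] at this
    exact this.2.2
  · exfalso
    obtain ⟨x, hx, y, hy, hxy⟩ := hC X (filter_subset _ _)
      ⟨u, mem_filter.2 ⟨hu, hu, SimpleGraph.Reachable.refl _⟩⟩ hXC
    rw [mem_sdiff] at hy
    rw [hX, mem_filter] at hx
    obtain ⟨_, hx1, hx2⟩ := hx
    exact hy.2 (mem_filter.2 ⟨hy.1, hy.1, hx2.trans (SimpleGraph.Adj.reachable (by
      simpa using hxy))⟩)

theorem linked_of_base {C : Finset V} {b : V}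
    (h : ∀ Q ⊆ C, Q.Nonempty → b ∉ Q → ∃ x ∈ Q, ∃ y ∈ C \ Q, G.Adj x y) : Linked G C := by
  intro X hX hX0 hXC
  by_cases hbX : b ∈ X
  · obtain ⟨x, hx, y, hy, hxy⟩ := h (C \ X) sdiff_subset
      (by
        rw [nonempty_iff_ne_empty, Ne, sdiff_eq_empty_iff_subset]
        exact fun h => hXC (Subset.antisymm hX h))
      (fun hb => (mem_sdiff.1 hb).2 hbX)
    refine ⟨y, ?_, x, hx, hxy.symm⟩
    simp only [mem_sdiff, not_and, not_not] at hy
    exact hy.2 hy.1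
  · exact h X hX hX0 hbX

theorem IsBlockGraph.isClique_of_isNonseparable (hG : IsBlockGraph G) {B : Set V}
    (hB : IsNonseparable G B) : G.IsClique B := by
  obtain ⟨M, hBM, hM⟩ := Set.toFinite {B | IsNonseparable G B} |>.exists_le_maximal hB
  exact (hG M hM).subset hBM

/-- In a block graph, two neighbours of `a` that are joined by a path avoiding `a` are adjacent:
together with a shortest such path, `a` forms a cycle, which is not separated by any vertex. -/
theorem IsBlockGraph.adj_of_linked (hG : IsBlockGraph G) {Z : Finset V} (hZ : Linked G Z)
    {a x y : V} (ha : a ∉ Z) (hx : x ∈ Z) (hy : y ∈ Z) (hax : G.Adj a x) (hay : G.Adj a y)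
    (hxy : x ≠ y) : G.Adj x y := by
  classical
  obtain ⟨C, hC, hmin⟩ := exists_min_image
    (Z.powerset.filter fun C => x ∈ C ∧ y ∈ C ∧ Linked G C) card ⟨Z, by simp [hx, hy, hZ]⟩
  simp only [mem_filter, mem_powerset] at hC hmin
  obtain ⟨hCZ, hxC, hyC, hlink⟩ := hC
  have haC : a ∉ C := fun h => ha (hCZ h)
  have hdel : ∀ z ∈ C, Linked G (insert a (C.erase z)) := by
    intro z hz
    refine linked_of_base (b := a) fun Y hY hY0 haY => ?_
    by_contra hno
    push Not at hno
    have hYC : ∀ u ∈ Y, u ∈ C ∧ u ≠ z := fun u hu => by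
      have := hY hu
      rw [mem_insert, mem_erase] at this
      rcases this with rfl | h
      · exact absurd hu haY
      · exact ⟨h.2, h.1⟩
    have haD : a ∈ insert a (C.erase z) \ Y := mem_sdiff.2 ⟨mem_insert_self _ _, haY⟩
    have hxY : x ∉ Y := fun h => hno x h a haD hax.symm
    have hyY : y ∉ Y := fun h => hno y h a haD hay.symm
    have hsm : Linked G (C \ Y) := by
      refine linked_of_base (b := z) fun Q hQ hQ0 hzQ => ?_
      have hQ' : ∀ u ∈ Q, u ∈ C ∧ u ∉ Y := fun u hu => mem_sdiff.1 (hQ hu)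
      obtain ⟨q, hq, w, hw, hqw⟩ := hlink Q (fun u hu => (hQ' u hu).1) hQ0
        (fun h => hzQ (h ▸ hz))
      rw [mem_sdiff] at hw
      refine ⟨q, hq, w, ?_, hqw⟩
      rw [mem_sdiff, mem_sdiff]
      refine ⟨⟨hw.1, fun hwY => hno w hwY q ?_ hqw.symm⟩, hw.2⟩
      rw [mem_sdiff, mem_insert, mem_erase]
      exact ⟨Or.inr ⟨fun h => hzQ (h ▸ hq), (hQ' q hq).1⟩, (hQ' q hq).2⟩
    have h1 := hmin (C \ Y) ⟨sdiff_subset.trans hCZ, mem_sdiff.2 ⟨hxC, hxY⟩,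
      mem_sdiff.2 ⟨hyC, hyY⟩, hsm⟩
    obtain ⟨u, hu⟩ := hY0
    have h2 : C \ Y ⊂ C := ⟨sdiff_subset, fun h => (mem_sdiff.1 (h (hYC u hu).1)).2 hu⟩
    exact absurd (card_lt_card h2) (by omega)
  have hwhole : Linked G (insert a C) := by
    refine linked_of_base (b := a) fun Q hQ hQ0 haQ => ?_
    have hQC : Q ⊆ C := fun u hu => by
      rcases mem_insert.1 (hQ hu) with rfl | h
      · exact absurd hu haQ
      · exact h
    by_cases hQe : Q = C
    · exact ⟨x, hQe ▸ hxC, a, mem_sdiff.2 ⟨mem_insert_self _ _, haQ⟩, hax.symm⟩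
    · obtain ⟨q, hq, w, hw, hqw⟩ := hlink Q hQC hQ0 hQe
      rw [mem_sdiff] at hw
      exact ⟨q, hq, w, mem_sdiff.2 ⟨mem_insert_of_mem hw.1, hw.2⟩, hqw⟩
  have hns : IsNonseparable G ((insert a C : Finset V) : Set V) := by
    refine ⟨?_, ?_⟩
    · have : Nonempty ((insert a C : Finset V) : Set V) := ⟨⟨a, by simp⟩⟩
      exact ⟨hwhole.preconnected⟩
    · intro v hv
      have hset : ((insert a C : Finset V) : Set V) \ {v} = ((insert a C).erase v : Finset V) := by
        ext u; simp [and_comm]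
      rw [hset]
      refine Linked.preconnected ?_
      rcases mem_insert.1 (mem_coe.1 hv) with rfl | hvC
      · rw [erase_insert haC]; exact hlink
      · have hav : a ≠ v := fun e => haC (by rw [e]; exact hvC)
        rw [erase_insert_of_ne hav]
        exact hdel v hvC
  exact hG.isClique_of_isNonseparable hns (by simp [hxC]) (by simp [hyC]) hxy

/-- In a block graph, the diagonals of a cycle of length four are edges. -/
theorem IsBlockGraph.adj_of_square (hG : IsBlockGraph G) {v p y x : V} (hvp : G.Adj v p)
    (hpy : G.Adj p y) (hyx : G.Adj y x) (hxv : G.Adj x v) (hvy : v ≠ y) (hpx : p ≠ x) :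
    G.Adj v y := by
  refine hG.adj_of_linked (Z := {v, x, y}) (a := p) ?_ ?_ (by simp) (by simp) hvp.symm hpy hvy
  · refine linked_of_base (b := x) fun Q hQ hQ0 hxQ => ?_
    obtain ⟨q, hq⟩ := hQ0
    refine ⟨q, hq, x, by simp [hxQ], ?_⟩
    have := hQ hq
    simp only [mem_insert, mem_singleton] at this
    rcases this with rfl | rfl | rfl
    · exact hxv.symm
    · exact absurd hq hxQ
    · exact hyx
  · simp [hvp.ne.symm, hpx, hpy.ne]

variable (G) in
/-- An order in which each vertex has an earlier neighbour, unless no edge at all leads from the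
earlier vertices to it and the later ones. -/
structure IsSearchOrder (pos : V → ℕ) : Prop where
  inj : Function.Injective pos
  one_le_pos : ∀ v, 1 ≤ pos v
  step : ∀ v, (∃ u, G.Adj u v ∧ pos u < pos v) ∨
    ∀ u w, pos u < pos v → pos v ≤ pos w → ¬ G.Adj u w

variable {pos tp rp : V → ℕ}

/-- The earlier neighbours of a vertex are pairwise adjacent: they all lie in the same component,
which is connected without the vertex and the later ones. -/
theorem IsSearchOrder.adj_of_lt (hs : IsSearchOrder G pos) (hG : IsBlockGraph G) {v x y : V}
    (hx : G.Adj v x) (hy : G.Adj v y) (hxv : pos x < pos v) (hyv : pos y < pos v) (hxy : x ≠ y) :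
    G.Adj x y := by
  classical
  -- the last vertex not after `v` where a new component begins
  obtain ⟨r, hr, hmax⟩ := exists_max_image
    (univ.filter fun r => pos r ≤ pos v ∧ ∀ u w, pos u < pos r → pos r ≤ pos w → ¬ G.Adj u w) pos (by
      obtain ⟨m, -, hm⟩ := exists_min_image univ pos ⟨v, mem_univ v⟩
      refine ⟨m, ?_⟩
      simp only [mem_filter, mem_univ, true_and]
      exact ⟨hm v (mem_univ v), fun u w hu => absurd (hm u (mem_univ u)) (by omega)⟩)
  simp only [mem_filter, mem_univ, true_and] at hr hmax
  obtain ⟨hrv, hr⟩ := hr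
  have hge : ∀ u, G.Adj v u → pos r ≤ pos u := fun u hu => by
    by_contra hlt
    exact hr u v (by omega) hrv hu.symm
  refine hG.adj_of_linked (Z := univ.filter fun u => pos r ≤ pos u ∧ pos u < pos v) (a := v)
    (linked_of_base (b := r) fun Q hQ hQ0 hrQ => ?_) (by simp) (by simp [hge x hx, hxv])
    (by simp [hge y hy, hyv]) hx hy hxy
  obtain ⟨q, hq, hqm⟩ := exists_min_image Q pos hQ0
  have hqZ := hQ hq
  simp only [mem_filter, mem_univ, true_and] at hqZ
  have hrq : pos r < pos q := lt_of_le_of_ne hqZ.1 fun e => hrQ (hs.inj e ▸ hq)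
  rcases hs.step q with ⟨u, huq, hlt⟩ | hstart
  · refine ⟨q, hq, u, ?_, huq.symm⟩
    simp only [mem_sdiff, mem_filter, mem_univ, true_and]
    refine ⟨⟨?_, by omega⟩, fun huQ => absurd (hqm u huQ) (by omega)⟩
    by_contra hur
    exact hr u q (by omega) hqZ.1 huq
  · exact absurd (hmax q ⟨by omega, hstart⟩) (by omega)

/-- The positions of the two earliest vertices of the block that joins `v` to the earlier vertices,
computed as minima over adjacency lists. -/
theorem IsSearchOrder.isBlockOrder (hs : IsSearchOrder G pos) (hG : IsBlockGraph G)
    (htp : ∀ v, (tp v = 0 ∧ ∀ u, G.Adj v u → pos v < pos u) ∨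
      ∃ a, G.Adj v a ∧ pos a = tp v ∧ pos a < pos v ∧ ∀ u, G.Adj v u → tp v ≤ pos u)
    (hrp : ∀ v, rp v ≤ pos v ∧ tp v < rp v ∧ (rp v = pos v ∨ ∃ a, G.Adj v a ∧ pos a = rp v) ∧
      ∀ u, G.Adj v u → tp v < pos u → rp v ≤ pos u) : IsBlockOrder G pos tp rp := by
  have hpne : ∀ {u v}, G.Adj u v → pos u ≠ pos v := fun huv e => huv.ne (hs.inj e)
  -- an earlier neighbour that is not the first one lies in the same block
  have hA : ∀ v u, G.Adj v u → pos u < pos v → pos u ≠ tp v → rp u = rp v ∧ tp u = tp v := by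
    intro v u hvu huv hut
    rcases htp v with ⟨-, h0⟩ | ⟨a, hva, hat, hav, hmin⟩
    · have := h0 u hvu; omega
    have hau : pos a < pos u := by have := hmin u hvu; omega
    have hne : a ≠ u := fun e => by subst e; omega
    have hua : G.Adj u a := (hs.adj_of_lt hG hva hvu hav huv hne).symm
    -- `u` and `v` have the same neighbours before `u`
    have h1 : ∀ y, G.Adj v y → pos y < pos u → G.Adj u y := fun y hvy hyu =>
      hs.adj_of_lt hG hvu hvy huv (by omega) (fun e => by subst e; omega)
    have h2 : ∀ y, G.Adj u y → pos y < pos u → G.Adj v y := by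
      intro y huy hyu
      by_cases hya : y = a
      · rw [hya]; exact hva
      have hay : G.Adj a y := hs.adj_of_lt hG hua huy hau hyu (Ne.symm hya)
      exact hG.adj_of_square hvu huy hay.symm hva.symm (fun e => by subst e; omega) hne.symm
    have htu : tp u = tp v := by
      rcases htp u with ⟨-, h0⟩ | ⟨b, hub, hbt, hbu, hmin'⟩
      · have := h0 a hua; omega
      · have e1 := hmin' a hua
        have e2 := hmin b (h2 b hub hbu)
        omega
    refine ⟨?_, htu⟩
    obtain ⟨r1, r2, r3, r4⟩ := hrp u
    obtain ⟨s1, s2, s3, s4⟩ := hrp v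
    have hvle : rp v ≤ pos u := s4 u hvu (by have := hmin u hvu; omega)
    refine le_antisymm ?_ ?_
    · rcases s3 with e | ⟨b, hvb, hb⟩
      · omega
      · rcases lt_or_eq_of_le hvle with hlt | heq
        · have := r4 b (h1 b hvb (by omega)) (by omega)
          omega
        · omega
    · rcases r3 with e | ⟨b, hub, hb⟩
      · omega
      · rcases lt_or_eq_of_le r1 with hlt | heq
        · have := s4 b (h2 b hub (by omega)) (by omega)
          omega
        · omega
  have htlt : ∀ v, tp v < rp v := fun v => (hrp v).2.1
  have hrle : ∀ v, rp v ≤ pos v := fun v => (hrp v).1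
  have hB : ∀ u v, rp u = rp v → u ≠ v → G.Adj u v := by
    intro u v he huv
    have hone : ∀ u v, rp u = rp v → u ≠ v → rp v = pos v → G.Adj u v := by
      intro u v he huv hv
      rcases (hrp u).2.2.1 with e | ⟨b, hub, hb⟩
      · exact absurd (hs.inj (by omega)) huv
      · have : b = v := hs.inj (by omega)
        exact this ▸ hub
    rcases (hrp u).2.2.1 with eu | ⟨b, hub, hb⟩
    · exact (hone v u he.symm huv.symm eu).symm
    rcases (hrp v).2.2.1 with ev | ⟨b', hvb, hb'⟩
    · exact hone u v he huv ev
    obtain rfl : b = b' := hs.inj (by omega)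
    by_cases hbu : pos b = pos u
    · exact absurd (hs.inj hbu) hub.ne.symm
    by_cases hbv : pos b = pos v
    · exact absurd (hs.inj hbv) hvb.ne.symm
    have l1 := hrle u
    have l2 := hrle v
    have l3 := htlt u
    have l4 := htlt v
    have t1 := (hA u b hub (by omega) (by omega)).2
    have t2 := (hA v b hvb (by omega) (by omega)).2
    rcases htp u with ⟨-, h0⟩ | ⟨a, hua, hat, hau, -⟩
    · have := h0 b hub; omega
    rcases htp v with ⟨-, h0⟩ | ⟨a', hva, hat', hav, -⟩
    · have := h0 b hvb; omega
    obtain rfl : a = a' := hs.inj (by omega)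
    exact hG.adj_of_square hub hvb.symm hva hua.symm huv (fun e => by subst e; omega)
  have hT : ∀ u v, rp u = rp v → tp u = tp v := by
    intro u v he
    by_cases huv : u = v
    · rw [huv]
    have hadj := hB u v he huv
    have l1 := hrle u
    have l2 := hrle v
    have l3 := htlt u
    have l4 := htlt v
    rcases lt_or_gt_of_ne (hpne hadj) with h | h
    · exact (hA v u hadj.symm h (by omega)).2
    · exact ((hA u v hadj h (by omega)).2).symm
  refine ⟨hs.inj, htlt, hrle, hT, ?_, ?_⟩
  · intro u v he
    by_cases huv : u = v
    · rw [huv]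
    rcases (hrp v).2.2.1 with e | ⟨b, hvb, hb⟩
    · exact absurd (hs.inj (he.trans e)) huv
    obtain rfl : b = u := hs.inj (by omega)
    have l2 := hrle v
    have l4 := htlt v
    have := hpne hvb
    exact (hA v b hvb (by omega) (by omega)).1
  · intro u v
    constructor
    · intro hadj
      refine ⟨hadj.ne, ?_⟩
      rcases lt_or_gt_of_ne (hpne hadj) with h | h
      · by_cases ht : pos u = tp v
        · exact Or.inr (Or.inr ht.symm)
        · exact Or.inl (hA v u hadj.symm h ht).1
      · by_cases ht : pos v = tp u
        · exact Or.inr (Or.inl ht.symm)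
        · exact Or.inl ((hA u v hadj h ht).1).symm
    · have hC : ∀ u v, tp u = pos v → G.Adj u v := by
        intro u v e
        have := hs.one_le_pos v
        rcases htp u with ⟨h0, -⟩ | ⟨a, hua, hat, -, -⟩
        · omega
        · have : a = v := hs.inj (by omega)
          exact this ▸ hua
      rintro ⟨hne, e | e | e⟩
      · exact hB u v e hne
      · exact hC u v e
      · exact (hC v u e).symm

end Search

/-! ### Dynamic programming over the merges -/

/-- The rows of a dynamic program: `A c d z` is the value of the node `d` in the state `z` once all
nodes from `c` on have been merged, and `0` if that state cannot be reached (values that can be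
reached are positive, since every node starts with the value `1`). The rule `rl (ch c z)` attains
the maximum in the merge of `c` with outcome `z`. Only the states below `S` matter. -/
structure IsTable (S nr : ℕ) (rl : ℕ → Rule) (par : ℕ → ℕ) (m : ℕ) (A : ℕ → ℕ → ℕ → ℕ)
    (ch : ℕ → ℕ → ℕ) : Prop where
  init : ∀ d, 1 ≤ d → d < m → ∀ z < S, A m d z = if z = initState d then 1 else 0
  le : ∀ c, 2 ≤ c → c < m → ∀ q < nr, A (c + 1) (par c) (rl q).x ≠ 0 → A (c + 1) c (rl q).y ≠ 0 →
    A (c + 1) (par c) (rl q).x + A (c + 1) c (rl q).y + (rl q).w ≤ A c (par c) (rl q).z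
  choice : ∀ c, 2 ≤ c → c < m → ∀ z < S, A c (par c) z ≠ 0 → ch c z < nr ∧ (rl (ch c z)).z = z ∧
    A (c + 1) (par c) (rl (ch c z)).x ≠ 0 ∧ A (c + 1) c (rl (ch c z)).y ≠ 0 ∧
    A c (par c) z =
      A (c + 1) (par c) (rl (ch c z)).x + A (c + 1) c (rl (ch c z)).y + (rl (ch c z)).w
  frame : ∀ c, 2 ≤ c → c < m → ∀ d, 1 ≤ d → d < c → d ≠ par c → ∀ z < S, A c d z = A (c + 1) d z

theorem sum_Ico_merge {p c : ℕ} (f g : ℕ → ℕ) (hp : 1 ≤ p) (hpc : p < c)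
    (h : ∀ d, 1 ≤ d → d < c → d ≠ p → f d = g d) :
    ∑ d ∈ Ico 1 (c + 1), f d + g p = ∑ d ∈ Ico 1 c, g d + f p + f c := by
  have hmem : p ∈ Ico 1 c := by simp [hp, hpc]
  rw [sum_Ico_succ_top (by omega), ← sum_erase_add _ f hmem, ← sum_erase_add _ g hmem]
  have : ∑ d ∈ (Ico 1 c).erase p, f d = ∑ d ∈ (Ico 1 c).erase p, g d :=
    sum_congr rfl fun d hd => by
      rw [mem_erase, mem_Ico] at hd
      exact h d hd.2.1 hd.2.2 hd.1
  omega

section Table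
variable {S nr m : ℕ} {rl : ℕ → Rule} {par : ℕ → ℕ} {A : ℕ → ℕ → ℕ → ℕ} {ch : ℕ → ℕ → ℕ}

/-- No run gains more than the table says. -/
theorem IsTable.le_of_isRun (hA : IsTable S nr rl par m A ch)
    (hpar : ∀ c, 2 ≤ c → c < m → 1 ≤ par c ∧ par c < c)
    (hrl : ∀ q < nr, (rl q).x < S ∧ (rl q).y < S ∧ (rl q).z < S) (hS : 5 < S)
    {st : ℕ → ℕ → ℕ} {q : ℕ → Rule} (hq : IsRun (fun r => ∃ i < nr, rl i = r) par m st q)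
    (k c : ℕ) (hk : c + k = m) (h2 : 2 ≤ c) :
    (∀ d, 1 ≤ d → d < c → st c d < S ∧ A c d (st c d) ≠ 0) ∧
      m - 1 + ∑ d ∈ Ico c m, (q d).w ≤ ∑ d ∈ Ico 1 c, A c d (st c d) := by
  induction k generalizing c with
  | zero =>
    obtain rfl : c = m := hk
    have hi : ∀ d, 1 ≤ d → d < c → st c d < S ∧ A c d (st c d) = 1 := fun d h1 hd => by
      have hlt : st c d < S := by rw [hq.init d h1 hd, initState]; split_ifs <;> omega
      refine ⟨hlt, ?_⟩
      rw [hA.init d h1 hd _ hlt, if_pos (hq.init d h1 hd)]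
    refine ⟨fun d h1 hd => ⟨(hi d h1 hd).1, by rw [(hi d h1 hd).2]; omega⟩, ?_⟩
    rw [sum_congr rfl (fun d hd => (hi d (mem_Ico.1 hd).1 (mem_Ico.1 hd).2).2)]
    simp
  | succ k ih =>
    obtain ⟨h3, h4⟩ := ih (c + 1) (by omega) (by omega)
    have hc : c < m := by omega
    obtain ⟨hp1, hpc⟩ := hpar c h2 hc
    obtain ⟨i, hi, hiq⟩ := hq.rule c h2 hc
    obtain ⟨hx, hy, hz⟩ := hrl i hi
    have e1 := hq.old c h2 hc
    have e2 := hq.child c h2 hc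
    have e3 := hq.new c h2 hc
    have hle := hA.le c h2 hc i hi
    rw [hiq] at hx hy hz hle
    rw [e1, e2, e3] at hle
    have hle := hle (h3 _ hp1 (by omega)).2 (h3 _ (by omega) (by omega)).2
    have hfr : ∀ d, 1 ≤ d → d < c → d ≠ par c →
        st c d = st (c + 1) d ∧ A c d (st c d) = A (c + 1) d (st (c + 1) d) := fun d h1 hd hdp => by
      have e := hq.frame c h2 hc d hd hdp
      refine ⟨e, ?_⟩
      rw [e]
      exact hA.frame c h2 hc d h1 hd hdp _ (h3 d h1 (by omega)).1
    refine ⟨fun d h1 hd => ?_, ?_⟩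
    · by_cases hdp : d = par c
      · subst hdp
        rw [← e3]
        refine ⟨hz, ?_⟩
        rw [e3]
        have := (h3 _ hp1 (by omega)).2
        omega
      · rw [(hfr d h1 hd hdp).2, (hfr d h1 hd hdp).1]
        exact h3 d h1 (by omega)
    · have hs := sum_Ico_merge (fun d => A (c + 1) d (st (c + 1) d)) (fun d => A c d (st c d))
        hp1 hpc (fun d h1 hd hdp => (hfr d h1 hd hdp).2.symm)
      rw [sum_eq_sum_Ico_succ_bot hc]
      omega

/-- The states found when the choices of the table are followed from the root downwards. -/
structure IsBacktrack (rl : ℕ → Rule) (par : ℕ → ℕ) (m : ℕ) (ch : ℕ → ℕ → ℕ) (cur : ℕ → ℕ → ℕ) :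
    Prop where
  root : cur 2 1 = 4
  step : ∀ c, 2 ≤ c → c < m → cur (c + 1) =
    Function.update (Function.update (cur c) c (rl (ch c (cur c (par c)))).y) (par c)
      (rl (ch c (cur c (par c)))).x

/-- Following the choices from the root in a reachable state yields a run that gains what the table
says. -/
theorem IsTable.isRun_of_isBacktrack (hA : IsTable S nr rl par m A ch) (hm : 2 ≤ m)
    (hpar : ∀ c, 2 ≤ c → c < m → 1 ≤ par c ∧ par c < c)
    (hrl : ∀ q < nr, (rl q).x < S ∧ (rl q).y < S ∧ (rl q).z < S) (hS : 5 < S)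
    {cur : ℕ → ℕ → ℕ} (hcur : IsBacktrack rl par m ch cur) (h0 : A 2 1 4 ≠ 0) :
    IsRun (fun r => ∃ i < nr, rl i = r) par m cur (fun c => rl (ch c (cur c (par c)))) ∧
      m - 1 + ∑ c ∈ Ico 2 m, (rl (ch c (cur c (par c)))).w = A 2 1 4 := by
  have key : ∀ k c, c = 2 + k → c ≤ m →
      (∀ d, 1 ≤ d → d < c → cur c d < S ∧ A c d (cur c d) ≠ 0) ∧
      ∑ d ∈ Ico 1 c, A c d (cur c d) + ∑ c ∈ Ico 2 c, (rl (ch c (cur c (par c)))).w = A 2 1 4 := by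
    intro k
    induction k with
    | zero =>
      rintro c rfl -
      refine ⟨fun d h1 h2 => ?_, ?_⟩
      · obtain rfl : d = 1 := by omega
        simp only [Nat.add_zero]
        rw [hcur.root]
        exact ⟨by omega, h0⟩
      · simp [hcur.root]
    | succ k ih =>
      rintro _ rfl hm
      obtain ⟨h1, h2⟩ := ih (2 + k) rfl (by omega)
      rw [show 2 + (k + 1) = 2 + k + 1 by ring] at hm ⊢
      generalize hcc : 2 + k = c at *
      have h2c : 2 ≤ c := by omega
      obtain ⟨hp1, hpc⟩ := hpar c h2c (by omega)
      obtain ⟨a1, a2⟩ := h1 _ hp1 hpc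
      obtain ⟨b1, b2, b3, b4, b5⟩ := hA.choice c h2c (by omega) _ a1 a2
      obtain ⟨r1, r2, r3⟩ := hrl _ b1
      have e1 : cur (c + 1) (par c) = (rl (ch c (cur c (par c)))).x := by
        rw [hcur.step c h2c (by omega)]; simp
      have e2 : cur (c + 1) c = (rl (ch c (cur c (par c)))).y := by
        rw [hcur.step c h2c (by omega), Function.update_of_ne (by omega)]; simp
      have e3 : ∀ d, d ≠ c → d ≠ par c → cur (c + 1) d = cur c d := fun d i1 i2 => by
        rw [hcur.step c h2c (by omega), Function.update_of_ne i2, Function.update_of_ne i1]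
      have e4 : ∀ d, 1 ≤ d → d < c → d ≠ par c →
          A (c + 1) d (cur (c + 1) d) = A c d (cur c d) := fun d i1 i2 i3 => by
        rw [e3 d (by omega) i3, hA.frame c h2c (by omega) d i1 i2 i3 _ (h1 d i1 i2).1]
      refine ⟨fun d i1 i2 => ?_, ?_⟩
      · by_cases hdp : d = par c
        · rw [hdp, e1]; exact ⟨r1, b3⟩
        by_cases hdc : d = c
        · rw [hdc, e2]; exact ⟨r2, b4⟩
        rw [e4 d i1 (by omega) hdp, e3 d hdc hdp]
        exact h1 d i1 (by omega)
      · have hs := sum_Ico_merge (fun d => A (c + 1) d (cur (c + 1) d)) (fun d => A c d (cur c d))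
          hp1 hpc e4
        simp only [e1, e2] at hs
        rw [sum_Ico_succ_top h2c]
        omega
  have hlive : ∀ c, 2 ≤ c → c ≤ m → ∀ d, 1 ≤ d → d < c → cur c d < S ∧ A c d (cur c d) ≠ 0 :=
    fun c h2 hc => (key (c - 2) c (by omega) hc).1
  have hinit : ∀ d, 1 ≤ d → d < m → cur m d = initState d := fun d h1 h2 => by
    obtain ⟨i1, i2⟩ := hlive m hm le_rfl d h1 h2
    rw [hA.init d h1 h2 _ i1] at i2
    by_contra hne
    exact i2 (if_neg hne)
  refine ⟨⟨hinit, fun c h2 hc => ?_, fun c h2 hc => ?_, fun c h2 hc => ?_, fun c h2 hc => ?_,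
    fun c h2 hc d hd hdp => ?_⟩, ?_⟩
  · obtain ⟨hp1, hpc⟩ := hpar c h2 hc
    obtain ⟨a1, a2⟩ := hlive c h2 hc.le _ hp1 hpc
    exact ⟨_, (hA.choice c h2 hc _ a1 a2).1, rfl⟩
  · rw [hcur.step c h2 hc]; simp
  · rw [hcur.step c h2 hc, Function.update_of_ne (hpar c h2 hc).2.ne']; simp
  · obtain ⟨hp1, hpc⟩ := hpar c h2 hc
    obtain ⟨a1, a2⟩ := hlive c h2 hc.le _ hp1 hpc
    exact (hA.choice c h2 hc _ a1 a2).2.1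
  · rw [hcur.step c h2 hc, Function.update_of_ne hdp, Function.update_of_ne hd.ne]
  · have h1 := (key (m - 2) m (by omega) le_rfl).2
    have h2 : ∑ d ∈ Ico 1 m, A m d (cur m d) = m - 1 := by
      rw [sum_congr rfl (g := fun _ => 1)]
      · simp
      · intro d hd
        rw [mem_Ico] at hd
        rw [hA.init d hd.1 hd.2 _ (hlive m hm le_rfl d hd.1 hd.2).1, if_pos (hinit d hd.1 hd.2)]
    rw [h2] at h1
    exact h1

end Table

/-- Labels of the coalitions held by the nodes, found from the root downwards: `lab c d` is the name
of the coalition in which the coalition held by `d`, before the nodes below `c` are merged, ends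
up. The coalition of the root is named `0`, a coalition closed in the merge of `c` is named `c`. -/
structure IsLabelling (par : ℕ → ℕ) (q : ℕ → Rule) (m : ℕ) (lab : ℕ → ℕ → ℕ) : Prop where
  root : lab 2 1 = 0
  closed : ∀ c, 2 ≤ c → c < m → (q c).j = 0 → lab (c + 1) = Function.update (lab c) c c
  united : ∀ c, 2 ≤ c → c < m → (q c).j = 1 → lab (c + 1) = Function.update (lab c) c (lab c (par c))
  both : ∀ c, 2 ≤ c → c < m → (q c).j ≠ 0 → (q c).j ≠ 1 →
    lab (c + 1) = Function.update (Function.update (lab c) (par c) c) c c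

theorem IsLabelling.elim_heldBy {V : Type*} [Fintype V] [DecidableEq V] {par : ℕ → ℕ} {q : ℕ → Rule} {m : ℕ}
    {lab : ℕ → ℕ → ℕ} (h : IsLabelling par q m lab)
    (hpar : ∀ c, 2 ≤ c → c < m → 1 ≤ par c ∧ par c < c) (pos : V → ℕ) (v : V) (k c : ℕ)
    (hk : c + k = m) (h2 : 2 ≤ c) :
    Sum.elim (lab c) id (heldBy par q pos m c v) = lab m (2 * pos v + 1) := by
  induction k generalizing c with
  | zero =>
    obtain rfl : c = m := hk
    rw [heldBy_self]; rfl
  | succ k ih =>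
    rw [← ih (c + 1) (by omega) (by omega), heldBy_of_lt q (by omega)]
    have hc : c < m := by omega
    have hpc := (hpar c h2 hc).2
    rcases heldBy par q pos m (c + 1) v with d | d
    · simp only [glue]
      split_ifs with h0 hd h1 hd hd
      · rw [h.closed c h2 hc h0]; simp [hd]
      · rw [h.closed c h2 hc h0]; simp [hd]
      · rw [h.united c h2 hc h1]; simp [hd]
      · rw [h.united c h2 hc h1]; simp [hd]
      · rw [h.both c h2 hc h0 h1]
        rcases hd with hd | hd
        · simp [hd]
        · simp [hd, Function.update_of_ne hpc.ne]
      · rw [h.both c h2 hc h0 h1]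
        push Not at hd
        simp [hd.1, hd.2]
    · rfl

section Optimal
variable {V : Type*} [Fintype V] [DecidableEq V] {G : SimpleGraph V} [DecidableRel G.Adj]
  {pos tp rp : V → ℕ} {n : ℕ} {vx : ℕ → V} {par : ℕ → ℕ}

/-- The labels found by dynamic programming and backtracking are a labelling of maximum welfare: its
welfare is at least the gain of the run that was traced, which is at least the gain of any run, and
some run gains the maximum welfare. -/
theorem labelWelfare_le_of_isTable (h : IsBlockTree G pos tp rp n vx par) {T D : ℕ} {dl : ℕ → ℕ}
    (hD : 0 < D) (hdl : ∀ k < T, (dl k : ℚ) = D * (starVal (k + 1) - starVal k))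
    (hT : ∀ v, #(univ.filter (fun w => G.Adj v w)) < T) (hT0 : 0 < T) {S nr : ℕ} {rl : ℕ → Rule}
    (hall : ∀ r, IsRule T dl r ↔ ∃ q < nr, rl q = r) (hS : T + 6 ≤ S)
    {A : ℕ → ℕ → ℕ → ℕ} {ch : ℕ → ℕ → ℕ} (hA : IsTable S nr rl par (2 * n + 2) A ch)
    {cur lab : ℕ → ℕ → ℕ} (hcur : IsBacktrack rl par (2 * n + 2) ch cur)
    (hlab : IsLabelling par (fun c => rl (ch c (cur c (par c)))) (2 * n + 2) lab) (l' : V → V) :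
    labelWelfare G l' ≤ labelWelfare G (fun v => lab (2 * n + 2) (2 * pos v + 1)) := by
  have hpar : ∀ c, 2 ≤ c → c < 2 * n + 2 → 1 ≤ par c ∧ par c < c := fun c h2 hc => h.par_lt h2 hc
  have hrl : ∀ q < nr, (rl q).x < S ∧ (rl q).y < S ∧ (rl q).z < S := fun q hq => by
    have hr := (hall (rl q)).2 ⟨q, hq, rfl⟩
    generalize rl q = r at hr
    cases hr <;> simp only <;> omega
  have hR : (fun r => ∃ i < nr, rl i = r) = IsRule T dl := by
    funext r; exact propext (hall r).symm
  obtain ⟨l, hl, hs⟩ := h.exists_optimal_labelling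
  obtain ⟨st, q, hq, hend, hge⟩ :=
    exists_run h (h.isTidy hl hs) (D := D) (T := T) (dl := dl) (by exact_mod_cast hD) hdl hT
  obtain ⟨h1, h2⟩ := hA.le_of_isRun hpar hrl (by omega) (hR ▸ hq) (2 * n) 2 (by omega) le_rfl
  have h0 := (h1 1 le_rfl (by omega)).2
  rw [hend] at h0
  obtain ⟨h3, h4⟩ := hA.isRun_of_isBacktrack (by omega) hpar hrl (by omega) hcur h0
  have h5 := (hR ▸ h3).le_labelWelfare h (D := (D : ℚ)) (by exact_mod_cast hD) hT0 hdl
    hcur.root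
  obtain ⟨-, -, b1, b2, -⟩ := (hR ▸ h3).exists_account h (D := (D : ℚ)) (by exact_mod_cast hD) hT0
    hdl (2 * n) 2 (by omega) le_rfl
  have h6 : labelWelfare G (heldBy par (fun c => rl (ch c (cur c (par c)))) pos (2 * n + 2) 2) =
      labelWelfare G (fun v => lab (2 * n + 2) (2 * pos v + 1)) := by
    refine labelWelfare_congr G fun u v => ?_
    have e : ∀ v, lab (2 * n + 2) (2 * pos v + 1) = _ := fun v =>
      (hlab.elim_heldBy hpar pos v (2 * n) 2 (by omega) le_rfl).symm
    rw [e, e]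
    refine ⟨fun he => by rw [he], fun he => ?_⟩
    -- the name `0` of the root differs from the names of the closed coalitions
    have hc1 := b1 u
    have hc2 := b2 u
    have hc3 := b1 v
    have hc4 := b2 v
    generalize heldBy par (fun c => rl (ch c (cur c (par c)))) pos (2 * n + 2) 2 u = a at *
    generalize heldBy par (fun c => rl (ch c (cur c (par c)))) pos (2 * n + 2) 2 v = b at *
    rcases a with d | d <;> rcases b with d' | d'
    · have := hc1 d rfl
      have := hc3 d' rfl
      congr 1; omega
    · have := hc1 d rfl
      have := hc4 d' rfl
      obtain rfl : d = 1 := by omega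
      simp only [Sum.elim_inl, Sum.elim_inr, id_eq, hlab.root] at he
      omega
    · have := hc2 d rfl
      have := hc3 d' rfl
      obtain rfl : d' = 1 := by omega
      simp only [Sum.elim_inl, Sum.elim_inr, id_eq, hlab.root] at he
      omega
    · simpa using he
  rw [← h6]
  refine (hl l').trans (le_trans ?_ h5)
  rw [← sum_div, le_div_iff₀ (by exact_mod_cast hD), mul_comm]
  refine hge.trans ?_
  simp only [show Ico 1 2 = {1} from rfl, sum_singleton, hend] at h2
  have : ∑ c ∈ Ico 2 (2 * n + 2), (q c).w ≤
      ∑ c ∈ Ico 2 (2 * n + 2), (rl (ch c (cur c (par c)))).w := by omega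
  exact_mod_cast this

end Optimal

end FHG

namespace Imp

open Finset

/-! ### A language of bounded loops over arrays -/

/-- A configuration of a program with variables and `32` arrays. -/
structure Store where
  /-- values of the variables -/
  v : ℕ → ℕ
  /-- contents of the arrays -/
  a : Fin 32 → ℕ → ℕ

/-- Assignment to a variable. -/
def Store.setv (s : Store) (x k : ℕ) : Store := { s with v := Function.update s.v x k }

/-- Assignment to an array cell. -/
def Store.seta (s : Store) (b : Fin 32) (i k : ℕ) : Store :=
  { s with a := Function.update s.a b (Function.update (s.a b) i k) }

@[simp] theorem Store.setv_v (s : Store) (x k y : ℕ) :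
    (s.setv x k).v y = if y = x then k else s.v y := by simp [Store.setv, Function.update_apply]

@[simp] theorem Store.setv_a (s : Store) (x k : ℕ) : (s.setv x k).a = s.a := rfl

@[simp] theorem Store.seta_v (s : Store) (b : Fin 32) (i k : ℕ) : (s.seta b i k).v = s.v := rfl

@[simp] theorem Store.seta_a (s : Store) (b : Fin 32) (i k : ℕ) (c : Fin 32) :
    (s.seta b i k).a c = if c = b then Function.update (s.a b) i k else s.a c := by
  simp only [Store.seta, Function.update_apply]

@[simp] theorem Store.ite_v {p : Prop} [Decidable p] (s t : Store) (x : ℕ) :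
    (if p then s else t).v x = if p then s.v x else t.v x := by split_ifs <;> rfl

@[simp] theorem Store.ite_a {p : Prop} [Decidable p] (s t : Store) (b : Fin 32) :
    (if p then s else t).a b = if p then s.a b else t.a b := by split_ifs <;> rfl

/-- Expressions. The subtraction is truncated. -/
inductive Exp where
  /-- a constant -/
  | lit (k : ℕ)
  /-- a variable -/
  | var (x : ℕ)
  /-- a sum -/
  | add (e f : Exp)
  /-- a truncated difference -/
  | sub (e f : Exp)
  /-- an array entry -/
  | get (b : Fin 32) (e : Exp)

/-- The value of an expression. -/
@[simp] def Exp.eval (s : Store) : Exp → ℕ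
  | lit k => k
  | var x => s.v x
  | add e f => e.eval s + f.eval s
  | sub e f => e.eval s - f.eval s
  | get b e => s.a b (e.eval s)

/-- The number of machine steps for evaluating an expression. -/
def Exp.cost : Exp → ℕ
  | lit _ => 1
  | var _ => 2
  | add e f => e.cost + (f.cost + 1)
  | sub e f => e.cost + (f.cost + 1)
  | get _ e => e.cost + 9

/-- Commands. -/
inductive Cmd where
  /-- do nothing -/
  | skip
  /-- assign to a variable -/
  | set (x : ℕ) (e : Exp)
  /-- assign to the array cell with index `i` -/
  | put (b : Fin 32) (i e : Exp)
  /-- one command after the other -/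
  | seq (c d : Cmd)
  /-- if `e ≠ 0` then `c` else `d` -/
  | ite (e : Exp) (c d : Cmd)
  /-- run `c` for `x = 0, 1, …, e - 1`; the bound `e` is evaluated once, before the first round -/
  | forto (x : ℕ) (e : Exp) (c : Cmd)

/-- The store after `i` rounds of a loop with the round `f`. -/
def rounds (f : Store → Store) (x : ℕ) (s : Store) (i : ℕ) : Store :=
  Nat.rec s (fun j s' => f (s'.setv x j)) i

@[simp] theorem rounds_zero (f : Store → Store) (x : ℕ) (s : Store) : rounds f x s 0 = s := rfl

@[simp] theorem rounds_succ (f : Store → Store) (x : ℕ) (s : Store) (i : ℕ) :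
    rounds f x s (i + 1) = f ((rounds f x s i).setv x i) := rfl

/-- The store in which a command ends. -/
def Cmd.run : Cmd → Store → Store
  | skip, s => s
  | set x e, s => s.setv x (e.eval s)
  | put b i e, s => s.seta b (i.eval s) (e.eval s)
  | seq c d, s => d.run (c.run s)
  | ite e c d, s => if e.eval s ≠ 0 then c.run s else d.run s
  | forto x e c, s => rounds c.run x s (e.eval s)

/-- The number of machine steps for running a command. -/
def Cmd.cost : Cmd → Store → ℕ
  | skip, _ => 1
  | set _ e, _ => e.cost + 2
  | put _ i e, _ => i.cost + (8 + (e.cost + 1))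
  | seq c d, s => c.cost s + d.cost (c.run s)
  | ite e c d, s => e.cost + 1 + if e.eval s ≠ 0 then c.cost s else d.cost s
  | forto x e c, s => e.cost + 2 +
      ∑ i ∈ range (e.eval s), (c.cost ((rounds c.run x s i).setv x i) + 6)

@[simp] theorem Cmd.run_skip (s : Store) : skip.run s = s := rfl
@[simp] theorem Cmd.run_set (x : ℕ) (e : Exp) (s : Store) :
    (set x e).run s = s.setv x (e.eval s) := rfl
@[simp] theorem Cmd.run_put (b : Fin 32) (i e : Exp) (s : Store) :
    (put b i e).run s = s.seta b (i.eval s) (e.eval s) := rfl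
@[simp] theorem Cmd.run_seq (c d : Cmd) (s : Store) : (seq c d).run s = d.run (c.run s) := rfl
@[simp] theorem Cmd.run_ite (e : Exp) (c d : Cmd) (s : Store) :
    (ite e c d).run s = if e.eval s ≠ 0 then c.run s else d.run s := rfl

theorem Cmd.cost_seq (c d : Cmd) (s : Store) :
    (seq c d).cost s = c.cost s + d.cost (c.run s) := rfl

/-- Whether a command may assign to a variable. -/
def Cmd.writesVar : Cmd → ℕ → Bool
  | skip, _ => false
  | set x _, y => x == y
  | put _ _ _, _ => false
  | seq c d, y => c.writesVar y || d.writesVar y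
  | ite _ c d, y => c.writesVar y || d.writesVar y
  | forto x _ c, y => x == y || c.writesVar y

/-- Whether a command may assign to cells of an array. -/
def Cmd.writesArray : Cmd → Fin 32 → Bool
  | skip, _ => false
  | set _ _, _ => false
  | put b _ _, y => b == y
  | seq c d, y => c.writesArray y || d.writesArray y
  | ite _ c d, y => c.writesArray y || d.writesArray y
  | forto _ _ c, y => c.writesArray y

theorem Cmd.run_v (c : Cmd) (s : Store) {y : ℕ} (h : c.writesVar y = false) :
    (c.run s).v y = s.v y := by
  induction c generalizing s with
  | skip => rfl
  | set x e =>
    simp only [writesVar, beq_eq_false_iff_ne] at h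
    simp [h.symm]
  | put b i e => rfl
  | seq c d hc hd =>
    simp only [writesVar, Bool.or_eq_false_iff] at h
    rw [run_seq, hd _ h.2, hc _ h.1]
  | ite e c d hc hd =>
    simp only [writesVar, Bool.or_eq_false_iff] at h
    rw [run_ite]
    split_ifs
    · exact hc _ h.1
    · exact hd _ h.2
  | forto x e c hc =>
    simp only [writesVar, Bool.or_eq_false_iff, beq_eq_false_iff_ne] at h
    simp only [run]
    generalize e.eval s = k
    induction k with
    | zero => rfl
    | succ k ih => rw [rounds_succ, hc _ h.2, Store.setv_v, if_neg h.1.symm, ih]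

theorem Cmd.run_a (c : Cmd) (s : Store) {b : Fin 32} (h : c.writesArray b = false) :
    (c.run s).a b = s.a b := by
  induction c generalizing s with
  | skip => rfl
  | set x e => rfl
  | put b i e =>
    simp only [writesArray, beq_eq_false_iff_ne] at h
    simp [h.symm]
  | seq c d hc hd =>
    simp only [writesArray, Bool.or_eq_false_iff] at h
    rw [run_seq, hd _ h.2, hc _ h.1]
  | ite e c d hc hd =>
    simp only [writesArray, Bool.or_eq_false_iff] at h
    rw [run_ite]
    split_ifs
    · exact hc _ h.1
    · exact hd _ h.2
  | forto x e c hc =>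
    simp only [writesArray] at h
    simp only [run]
    generalize e.eval s = k
    induction k with
    | zero => rfl
    | succ k ih => rw [rounds_succ, hc _ h, Store.setv_a, ih]

/-- `s'` agrees with `s` wherever the command `c` does not write. -/
structure Agree (c : Cmd) (s s' : Store) : Prop where
  v : ∀ y, c.writesVar y = false → s'.v y = s.v y
  a : ∀ b, c.writesArray b = false → s'.a b = s.a b

theorem Cmd.agree_run (c : Cmd) (s : Store) : Agree c s (c.run s) :=
  ⟨fun _ h => c.run_v s h, fun _ h => c.run_a s h⟩

theorem Cmd.agree_rounds (x : ℕ) (e : Exp) (c : Cmd) (s : Store) (i : ℕ) :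
    Agree (forto x e c) s (rounds c.run x s i) :=
  (forto x (.lit i) c).agree_run s |> fun h => ⟨h.v, h.a⟩

/-- The rule for loops: an invariant, and a bound on the cost of each round. -/
theorem Cmd.forto_spec {x : ℕ} {e : Exp} {c : Cmd} {s : Store} {k : ℕ} (hk : e.eval s = k)
    (I : ℕ → Store → Prop) (B : ℕ) (h0 : I 0 s)
    (hstep : ∀ i < k, ∀ s', Agree (forto x e c) s s' → s' = rounds c.run x s i → I i s' →
      I (i + 1) (c.run (s'.setv x i)) ∧ c.cost (s'.setv x i) ≤ B) :
    I k ((forto x e c).run s) ∧ (forto x e c).cost s ≤ e.cost + 2 + k * (B + 6) := by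
  have hI : ∀ i ≤ k, I i (rounds c.run x s i) := by
    intro i
    induction i with
    | zero => exact fun _ => h0
    | succ i ih => exact fun hi => (hstep i hi _ (agree_rounds x e c s i) rfl (ih (by omega))).1
  refine ⟨by rw [run, hk]; exact hI k le_rfl, ?_⟩
  rw [cost, hk]
  refine Nat.add_le_add_left ?_ _
  have := sum_le_card_nsmul (range k) (fun i => c.cost ((rounds c.run x s i).setv x i) + 6) (B + 6)
    (fun i hi => by
      rw [mem_range] at hi
      exact Nat.add_le_add_right
        (hstep i hi _ (agree_rounds x e c s i) rfl (hI i hi.le)).2 _)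
  simpa using this

/-- Whether a command is free of loops. -/
def Cmd.loopFree : Cmd → Bool
  | skip | set _ _ | put _ _ _ => true
  | seq c d | ite _ c d => c.loopFree && d.loopFree
  | forto _ _ _ => false

/-- A bound on the cost of a command without loops. -/
def Cmd.bound : Cmd → ℕ
  | skip => 1
  | set _ e => e.cost + 2
  | put _ i e => i.cost + (8 + (e.cost + 1))
  | seq c d => c.bound + d.bound
  | ite e c d => e.cost + 1 + c.bound + d.bound
  | forto _ _ _ => 0

/-- The hypothesis can be checked by evaluation. -/
theorem Cmd.cost_le {c : Cmd} {B : ℕ} (h : (c.loopFree && c.bound.ble B) = true) (s : Store) :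
    c.cost s ≤ B := by
  rw [Bool.and_eq_true] at h
  refine le_trans ?_ (Nat.le_of_ble_eq_true h.2)
  replace h := h.1
  induction c generalizing s with
  | skip | set | put => exact le_rfl
  | seq c d hc hd =>
    simp only [loopFree, Bool.and_eq_true] at h
    exact Nat.add_le_add (hc s h.1) (hd _ h.2)
  | ite e c d hc hd =>
    simp only [loopFree, Bool.and_eq_true] at h
    have h1 := hc s h.1
    have h2 := hd s h.2
    simp only [cost, bound]
    split_ifs <;> omega
  | forto => simp [loopFree] at h

/-! ### Running the language on a random access machine -/

open RAM

/-- How a store is kept: register `0` holds the address `base` of the arrays, the variable `x` is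
kept in register `2 * x + 2`, and the entry `i` of the array `b` in the cell `base + 32 * i + b`. The
odd registers are free for intermediate results. -/
structure Encodes (base : ℕ) (s : Store) (σ : State) : Prop where
  reg_zero : σ.reg 0 = base
  v : ∀ x, σ.reg (2 * x + 2) = s.v x
  a : ∀ (b : Fin 32) i, σ.mem (base + 32 * i + (b : ℕ)) = s.a b i

/-- Multiply register `t` by `32` and add the address of the array `b`. -/
def addrProg (t u : ℕ) (b : Fin 32) : Prog :=
  .seq (.add t t t) <| .seq (.add t t t) <| .seq (.add t t t) <| .seq (.add t t t) <|
    .seq (.add t t t) <| .seq (.add t t 0) <| .seq (.const u b) (.add t t u)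

/-- Compilation of an expression; the result is left in register `2 * d + 1`. -/
def Exp.compile : ℕ → Exp → Prog
  | d, lit k => .const (2 * d + 1) k
  | d, var x => .seq (.const (2 * d + 1) 0) (.add (2 * d + 1) (2 * d + 1) (2 * x + 2))
  | d, add e f => .seq (e.compile d) (.seq (f.compile (d + 1))
      (.add (2 * d + 1) (2 * d + 1) (2 * d + 3)))
  | d, sub e f => .seq (e.compile d) (.seq (f.compile (d + 1))
      (.sub (2 * d + 1) (2 * d + 1) (2 * d + 3)))
  | d, get b e => .seq (e.compile d) (.seq (addrProg (2 * d + 1) (2 * d + 3) b)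
      (.load (2 * d + 1) (2 * d + 1)))

/-- Compilation of a command. Registers `2 * i + 1` with `i < d` are left alone. A loop keeps the
number of remaining rounds and the number of finished rounds in such registers. -/
def Cmd.compile : ℕ → Cmd → Prog
  | d, skip => .const (2 * d + 1) 0
  | d, set x e => .seq (e.compile d)
      (.seq (.const (2 * x + 2) 0) (.add (2 * x + 2) (2 * x + 2) (2 * d + 1)))
  | d, put b i e => .seq (i.compile d) (.seq (addrProg (2 * d + 1) (2 * d + 3) b)
      (.seq (e.compile (d + 1)) (.store (2 * d + 1) (2 * d + 3))))
  | d, seq c c' => .seq (c.compile d) (c'.compile d)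
  | d, ite e c c' => .seq (e.compile d) (.ite (2 * d + 1) (c.compile d) (c'.compile d))
  | d, forto x e c => .seq (e.compile d) (.seq (.const (2 * d + 3) 0)
      (.loop (2 * d + 1)
        (.seq (.const (2 * x + 2) 0) (.seq (.add (2 * x + 2) (2 * x + 2) (2 * d + 3))
          (.seq (c.compile (d + 3)) (.seq (.const (2 * d + 5) 1)
            (.seq (.add (2 * d + 3) (2 * d + 3) (2 * d + 5))
              (.sub (2 * d + 1) (2 * d + 1) (2 * d + 5)))))))))

theorem _root_.RAM.Exec.cast {p : Prog} {σ σ' : State} {t t' : ℕ} (h : Exec p σ t σ') (e : t = t') :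
    Exec p σ t' σ' := e ▸ h

theorem exec_addrProg {base t u : ℕ} (b : Fin 32) (σ : State) (h0 : σ.reg 0 = base) (ht : t ≠ 0)
    (htu : u ≠ t) :
    ∃ σ', Exec (addrProg t u b) σ 8 σ' ∧ σ'.reg t = base + 32 * σ.reg t + b ∧ σ'.mem = σ.mem ∧
      ∀ y, y ≠ t → y ≠ u → σ'.reg y = σ.reg y := by
  refine ⟨_, .seq (.add ..) <| .seq (.add ..) <| .seq (.add ..) <| .seq (.add ..) <|
    .seq (.add ..) <| .seq (.add ..) <| .seq (.const ..) (.add ..), ?_, ?_, ?_⟩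
  · simp [State.setReg, ht.symm, htu.symm, h0]
    ring
  · simp [State.setReg]
  · intro y h1 h2
    simp [State.setReg, h1, h2]

theorem Encodes.of_odd {base : ℕ} {s : Store} {σ σ' : State} (h : Encodes base s σ)
    (hm : σ'.mem = σ.mem) (hr : ∀ y, y % 2 = 0 → σ'.reg y = σ.reg y) : Encodes base s σ' :=
  ⟨by rw [hr 0 rfl, h.reg_zero], fun x => by rw [hr _ (by omega), h.v], fun b i => by rw [hm, h.a]⟩

theorem Exp.exec_compile {base : ℕ} {s : Store} (e : Exp) (d : ℕ) (σ : State)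
    (h : Encodes base s σ) : ∃ σ', Exec (e.compile d) σ e.cost σ' ∧ σ'.reg (2 * d + 1) = e.eval s ∧
      σ'.mem = σ.mem ∧ (∀ y, y % 2 = 0 → σ'.reg y = σ.reg y) ∧
      ∀ i < d, σ'.reg (2 * i + 1) = σ.reg (2 * i + 1) := by
  induction e generalizing d σ with
  | lit k =>
    refine ⟨_, .const .., ?_, rfl, ?_, ?_⟩
    · simp [State.setReg]
    · intro y hy
      simp [State.setReg, show y ≠ 2 * d + 1 by omega]
    · intro i hi
      simp [State.setReg, hi.ne]
  | var x =>
    refine ⟨_, .seq (.const ..) (.add ..), ?_, rfl, ?_, ?_⟩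
    · simp [State.setReg, show 2 * x + 2 ≠ 2 * d + 1 by omega, h.v]
    · intro y hy
      simp [State.setReg, show y ≠ 2 * d + 1 by omega]
    · intro i hi
      simp [State.setReg, hi.ne]
  | add e f he hf | sub e f he hf =>
    obtain ⟨σ₁, h1, h2, h3, h4, h5⟩ := he d σ h
    obtain ⟨σ₂, k1, k2, k3, k4, k5⟩ := hf (d + 1) σ₁ (h.of_odd h3 h4)
    rw [show 2 * (d + 1) + 1 = 2 * d + 3 by ring] at k2
    refine ⟨_, .seq h1 (.seq k1 (by constructor)), ?_, ?_, ?_, ?_⟩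
    · simp [State.setReg, k2, k5 d (by omega), h2]
    · simp [State.setReg, k3, h3]
    · intro y hy
      simp [State.setReg, show y ≠ 2 * d + 1 by omega, k4 y hy, h4 y hy]
    · intro i hi
      simp [State.setReg, hi.ne, k5 i (by omega), h5 i hi]
  | get b e he =>
    obtain ⟨σ₁, h1, h2, h3, h4, h5⟩ := he d σ h
    obtain ⟨σ₂, k1, k2, k3, k4⟩ := exec_addrProg (base := base) (t := 2 * d + 1) (u := 2 * d + 3) b
      σ₁ (by rw [h4 0 rfl, h.reg_zero]) (by omega) (by omega)
    refine ⟨_, .seq h1 (.seq k1 (.load ..)), ?_, ?_, ?_, ?_⟩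
    · simp [State.setReg, k2, h2, k3, h3, h.a]
    · simp [State.setReg, k3, h3]
    · intro y hy
      simp [State.setReg, show y ≠ 2 * d + 1 by omega,
        k4 y (by omega) (by omega), h4 y hy]
    · intro i hi
      simp [State.setReg, hi.ne, k4 (2 * i + 1) (by omega) (by omega), h5 i hi]

theorem Encodes.setv {base : ℕ} {s : Store} {σ σ' : State} (h : Encodes base s σ) {x k : ℕ}
    (hm : σ'.mem = σ.mem) (hx : σ'.reg (2 * x + 2) = k)
    (hr : ∀ y, y % 2 = 0 → y ≠ 2 * x + 2 → σ'.reg y = σ.reg y) : Encodes base (s.setv x k) σ' := by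
  refine ⟨by rw [hr 0 rfl (by omega), h.reg_zero], fun y => ?_, fun b i => by rw [hm, h.a]; rfl⟩
  rw [Store.setv_v]
  split_ifs with hy
  · rw [hy, hx]
  · rw [hr _ (by omega) (by omega), h.v]

theorem Cmd.exec_compile {base : ℕ} (c : Cmd) (d : ℕ) (s : Store) (σ : State)
    (h : Encodes base s σ) : ∃ σ', Exec (c.compile d) σ (c.cost s) σ' ∧ Encodes base (c.run s) σ' ∧
      ∀ i < d, σ'.reg (2 * i + 1) = σ.reg (2 * i + 1) := by
  induction c generalizing d s σ with
  | skip =>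
    refine ⟨_, .const .., h.of_odd rfl ?_, ?_⟩
    · intro y hy
      simp [State.setReg, show y ≠ 2 * d + 1 by omega]
    · intro i hi
      simp [State.setReg, hi.ne]
  | set x e =>
    obtain ⟨σ₁, h1, h2, h3, h4, h5⟩ := e.exec_compile d σ h
    refine ⟨_, .seq h1 (.seq (.const ..) (.add ..)), (h.of_odd h3 h4).setv rfl ?_ ?_, ?_⟩
    · simp only [State.setReg, Function.update_self]
      rw [Function.update_of_ne (by omega), h2, Nat.zero_add]
    · intro y hy hyx
      simp [State.setReg, hyx]
    · intro i hi
      simp only [State.setReg]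
      rw [Function.update_of_ne (by omega), Function.update_of_ne (by omega), h5 i hi]
  | put b j e =>
    obtain ⟨σ₁, h1, h2, h3, h4, h5⟩ := j.exec_compile d σ h
    obtain ⟨σ₂, k1, k2, k3, k4⟩ := exec_addrProg (base := base) (t := 2 * d + 1) (u := 2 * d + 3) b
      σ₁ (by rw [h4 0 rfl, h.reg_zero]) (by omega) (by omega)
    have hr : Encodes base s σ₂ := h.of_odd (k3.trans h3)
      (fun y hy => (k4 y (by omega) (by omega)).trans (h4 y hy))
    obtain ⟨σ₃, l1, l2, l3, l4, l5⟩ := e.exec_compile (d + 1) σ₂ hr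
    rw [show 2 * (d + 1) + 1 = 2 * d + 3 by ring] at l2
    refine ⟨_, .seq h1 (.seq k1 (.seq l1 (.store ..))), ?_, ?_⟩
    · have hr3 := hr.of_odd l3 l4
      refine ⟨hr3.reg_zero, hr3.v, fun b' i => ?_⟩
      simp only [State.setMem, l5 d (by omega), k2, h2, l2, Cmd.run, Store.seta_a]
      rw [Function.update_apply]
      split_ifs with e1 e2 e2
      · have hb : b' = b := Fin.ext (by have := b.2; have := b'.2; omega)
        have hi : i = j.eval s := by rw [hb] at e1; omega
        rw [hi, Function.update_self]
      · exact absurd (Fin.ext (by have := b.2; have := b'.2; omega)) e2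
      · rw [Function.update_of_ne, ← e2, hr3.a]
        rintro rfl
        exact e1 (by rw [e2])
      · exact hr3.a b' i
    · intro i hi
      simp only [State.setMem]
      rw [l5 i (by omega), k4 (2 * i + 1) (by omega) (by omega), h5 i hi]
  | seq c c' hc hc' =>
    obtain ⟨σ₁, h1, h2, h3⟩ := hc d s σ h
    obtain ⟨σ₂, k1, k2, k3⟩ := hc' d _ σ₁ h2
    exact ⟨σ₂, .seq h1 k1, k2, fun i hi => (k3 i hi).trans (h3 i hi)⟩
  | ite e c c' hc hc' =>
    obtain ⟨σ₁, h1, h2, h3, h4, h5⟩ := e.exec_compile d σ h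
    have hr := h.of_odd h3 h4
    by_cases he : e.eval s = 0
    · obtain ⟨σ₂, k1, k2, k3⟩ := hc' d _ σ₁ hr
      have hcost : (ite e c c').cost s = e.cost + (1 + c'.cost s) := by simp [cost, he]; ring
      refine ⟨σ₂, (Exec.seq h1 (.ite_false (h2.trans he) k1)).cast hcost.symm, ?_,
        fun i hi => (k3 i hi).trans (h5 i hi)⟩
      simpa [he] using k2
    · obtain ⟨σ₂, k1, k2, k3⟩ := hc d _ σ₁ hr
      have hcost : (ite e c c').cost s = e.cost + (1 + c.cost s) := by simp [cost, he]; ring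
      refine ⟨σ₂, (Exec.seq h1 (.ite_true (by rwa [h2]) k1)).cast hcost.symm, ?_,
        fun i hi => (k3 i hi).trans (h5 i hi)⟩
      simpa [he] using k2
  | forto x e c hc =>
    obtain ⟨σ₁, h1, h2, h3, h4, h5⟩ := e.exec_compile d σ h
    have hloop : ∀ k i (σ₀ : State), k + i = e.eval s → σ₀.reg (2 * d + 1) = k →
        σ₀.reg (2 * d + 3) = i → Encodes base (rounds c.run x s i) σ₀ →
        ∃ σ', Exec (.loop (2 * d + 1)
            (.seq (.const (2 * x + 2) 0) (.seq (.add (2 * x + 2) (2 * x + 2) (2 * d + 3))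
              (.seq (c.compile (d + 3)) (.seq (.const (2 * d + 5) 1)
                (.seq (.add (2 * d + 3) (2 * d + 3) (2 * d + 5))
                  (.sub (2 * d + 1) (2 * d + 1) (2 * d + 5)))))))) σ₀
            (∑ j ∈ Ico i (e.eval s), (c.cost ((rounds c.run x s j).setv x j) + 6) + 1) σ' ∧
          Encodes base (rounds c.run x s (e.eval s)) σ' ∧
          ∀ i < d, σ'.reg (2 * i + 1) = σ₀.reg (2 * i + 1) := by
      intro k
      induction k with
      | zero =>
        intro i σ₀ hi hk _ hr
        obtain rfl : i = e.eval s := by omega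
        exact ⟨σ₀, by simpa using Exec.loop_done hk, hr, fun _ _ => rfl⟩
      | succ k ih =>
        intro i σ₀ hi hk hi' hr
        have hr1 : Encodes base ((rounds c.run x s i).setv x i)
            ((σ₀.setReg (2 * x + 2) 0).setReg (2 * x + 2)
              ((σ₀.setReg (2 * x + 2) 0).reg (2 * x + 2) +
                (σ₀.setReg (2 * x + 2) 0).reg (2 * d + 3))) := by
          refine hr.setv rfl ?_ ?_
          · simp only [State.setReg, Function.update_self]
            rw [Function.update_of_ne (by omega), hi', Nat.zero_add]
          · intro y _ hyx
            simp [State.setReg, hyx]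
        obtain ⟨σ₂, k1, k2, k3⟩ := hc (d + 3) _ _ hr1
        have hodd : ∀ j < d + 3, σ₂.reg (2 * j + 1) = σ₀.reg (2 * j + 1) := fun j hj => by
          rw [k3 j hj]
          simp only [State.setReg]
          rw [Function.update_of_ne (by omega), Function.update_of_ne (by omega)]
        have o0 := hodd d (by omega)
        have o1 := hodd (d + 1) (by omega)
        rw [show 2 * (d + 1) + 1 = 2 * d + 3 by ring] at o1
        have hbody := Exec.seq (.const (2 * x + 2) 0 σ₀) (.seq (.add (2 * x + 2) (2 * x + 2)
          (2 * d + 3) _) (.seq k1 (.seq (.const (2 * d + 5) 1 _)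
            (.seq (.add (2 * d + 3) (2 * d + 3) (2 * d + 5) _)
              (.sub (2 * d + 1) (2 * d + 1) (2 * d + 5) _)))))
        generalize hσ3 : State.setReg _ (2 * d + 1) _ = σ₃ at hbody
        have hr3 : Encodes base (rounds c.run x s (i + 1)) σ₃ := by
          refine k2.of_odd (by rw [← hσ3]; rfl) fun y hy => ?_
          rw [← hσ3]
          simp [State.setReg, show y ≠ 2 * d + 1 by omega, show y ≠ 2 * d + 3 by omega,
            show y ≠ 2 * d + 5 by omega]
        obtain ⟨σ', l1, l2, l3⟩ := ih (i + 1) σ₃ (by omega)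
          (by rw [← hσ3]; simp [State.setReg, o0, hk]) (by rw [← hσ3]; simp [State.setReg, o1, hi'])
          hr3
        refine ⟨σ', ?_, l2, fun j hj => ?_⟩
        · rw [sum_eq_sum_Ico_succ_bot (by omega)]
          have := Exec.loop_step (by rw [hk]; omega) hbody l1
          convert this using 1
          ring
        · rw [l3 j hj, ← hσ3, ← hodd j (by omega)]
          simp only [State.setReg]
          rw [Function.update_of_ne (by omega), Function.update_of_ne (by omega),
            Function.update_of_ne (by omega)]
    obtain ⟨σ', k1, k2, k3⟩ := hloop (e.eval s) 0 (σ₁.setReg (2 * d + 3) 0) rfl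
      (by simp [State.setReg, h2]) (by simp [State.setReg])
      ((h.of_odd h3 h4).of_odd rfl (fun y hy => by
        simp [State.setReg, show y ≠ 2 * d + 3 by omega]))
    refine ⟨σ', ?_, k2, fun i hi => ?_⟩
    · have := Exec.seq h1 (.seq (.const (2 * d + 3) 0 σ₁) k1)
      rw [← range_eq_Ico] at this
      exact this.cast (by rw [cost]; ring)
    · rw [k3 i hi, ← h5 i hi]
      exact Function.update_of_ne (by omega) _ _

open RAM

/-! ### Input and output of the machine -/

/-- A loop that counts the register `r` down. -/
theorem exec_countdown {r : ℕ} {p : Prog} (I : ℕ → State → Prop) (B : ℕ)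
    (hr : ∀ k σ, I k σ → σ.reg r = k)
    (hstep : ∀ k σ, I (k + 1) σ → ∃ t σ', Exec p σ t σ' ∧ t ≤ B ∧ I k σ') (k : ℕ) (σ : State)
    (h : I k σ) : ∃ t σ', Exec (.loop r p) σ t σ' ∧ t ≤ k * (B + 1) + 1 ∧ I 0 σ' := by
  induction k generalizing σ with
  | zero => exact ⟨1, σ, .loop_done (hr 0 σ h), by omega, h⟩
  | succ k ih =>
    obtain ⟨t, σ₁, h1, h2, h3⟩ := hstep k σ h
    obtain ⟨t', σ₂, k1, k2, k3⟩ := ih σ₁ h3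
    refine ⟨_, σ₂, .loop_step (by rw [hr _ σ h]; omega) h1 k1, ?_, k3⟩
    rw [Nat.succ_mul]; omega

/-- Compute the length of the input, which is at the same time the address of the arrays. -/
def measureProg : Prog :=
  .seq (.const 3 0) <| .seq (.load 1 3) <| .seq (.add 5 1 3) <| .seq (.const 7 1) <|
    .seq (.add 0 1 7) <| .loop 5 <|
      .seq (.add 3 3 7) <| .seq (.load 9 3) <| .seq (.add 0 0 9) <| .sub 5 5 7

theorem exec_measureProg (w : ℕ → ℕ) :
    ∃ t σ, Exec measureProg ⟨fun _ => 0, w⟩ t σ ∧ t ≤ 5 * w 0 + 6 ∧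
      σ.reg 0 = 1 + w 0 + ∑ i ∈ range (w 0), w (1 + i) ∧ σ.reg 7 = 1 ∧ σ.mem = w := by
  obtain ⟨t, σ, h1, h2, -, -, -, h3, h4, h5⟩ := exec_countdown (r := 5)
    (p := .seq (.add 3 3 7) <| .seq (.load 9 3) <| .seq (.add 0 0 9) <| .sub 5 5 7)
    (fun k σ => k ≤ w 0 ∧ σ.reg 5 = k ∧ σ.reg 3 = w 0 - k ∧ σ.reg 7 = 1 ∧
      σ.mem = w ∧ σ.reg 0 = 1 + w 0 + ∑ i ∈ range (w 0 - k), w (1 + i))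
    4 (fun k σ h => h.2.1) (by
      rintro k σ ⟨h0, h1, h2, h3, h4, h5⟩
      refine ⟨_, _, .seq (.add ..) <| .seq (.load ..) <| .seq (.add ..) (.sub ..), le_rfl,
        by omega, ?_, ?_, ?_, ?_, ?_⟩
      · simp [State.setReg, h1, h3]
      · simp [State.setReg, h2, h3]; omega
      · simp [State.setReg, h3]
      · simp [State.setReg, h4]
      · simp only [State.setReg, Function.update_apply, h2, h3, h4, h5]
        norm_num
        rw [show w 0 - k = w 0 - (k + 1) + 1 by omega, sum_range_succ,
          add_comm 1 (w 0 - (k + 1))]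
        ring)
    (w 0)
    (((((State.mk (fun _ => 0) w).setReg 3 0).setReg 1 (w 0)).setReg 5 (w 0)).setReg 7 1
      |>.setReg 0 (w 0 + 1))
    ⟨le_rfl, by simp [State.setReg], by simp [State.setReg], by simp [State.setReg], rfl,
      by simp [State.setReg, add_comm]⟩
  refine ⟨1 + (1 + (1 + (1 + (1 + t)))), σ, .seq (.const ..) <| .seq (.load ..) <|
    .seq (.add ..) <| .seq (.const ..) <| .seq (.add ..) ?_, by omega, by simpa using h5, h3, h4⟩
  convert h1 using 1
  simp [State.setReg]

/-- Copy the input, whose length is in register `0`, to the first array. -/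
def copyProg : Prog :=
  .seq (.const 3 0) <| .seq (.add 5 0 3) <| .loop 5 <|
    .seq (.const 11 0) <| .seq (.add 11 11 3) <| .seq (addrProg 11 9 0) <| .seq (.load 9 3) <|
      .seq (.store 11 9) <| .seq (.add 3 3 7) <| .sub 5 5 7

theorem exec_copyProg (w : ℕ → ℕ) (L : ℕ) (hw : ∀ i, L ≤ i → w i = 0) (σ : State)
    (h0 : σ.reg 0 = L) (h7 : σ.reg 7 = 1) (hm : σ.mem = w) :
    ∃ t σ', Exec copyProg σ t σ' ∧ t ≤ 15 * L + 3 ∧ σ'.reg 0 = L ∧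
      ∀ (b : Fin 32) i, σ'.mem (L + 32 * i + (b : ℕ)) = if b = 0 then w i else 0 := by
  obtain ⟨t, σ', h1, h2, -, -, -, -, h3, h4, h5⟩ := exec_countdown (r := 5)
    (p := .seq (.const 11 0) <| .seq (.add 11 11 3) <| .seq (addrProg 11 9 0) <|
      .seq (.load 9 3) <| .seq (.store 11 9) <| .seq (.add 3 3 7) <| .sub 5 5 7)
    (fun k σ => k ≤ L ∧ σ.reg 5 = k ∧ σ.reg 3 = L - k ∧ σ.reg 7 = 1 ∧ σ.reg 0 = L ∧
      (∀ i < L, σ.mem i = w i) ∧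
      ∀ (b : Fin 32) i, σ.mem (L + 32 * i + (b : ℕ)) = if b = 0 ∧ i < L - k then w i else 0)
    14 (fun k σ h => h.2.1) (by
      rintro k σ ⟨h0, h1, h2, h3, h4, h5, h6⟩
      obtain ⟨σ₂, k1, k2, k3, k4⟩ := exec_addrProg (base := L) (t := 11) (u := 9) 0
        ((σ.setReg 11 0).setReg 11 ((σ.setReg 11 0).reg 11 + (σ.setReg 11 0).reg 3))
        (by simp [State.setReg, h4]) (by omega) (by omega)
      have k5 := k4 5 (by omega) (by omega)
      have k6 := k4 3 (by omega) (by omega)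
      have k7 := k4 7 (by omega) (by omega)
      have k8 := k4 0 (by omega) (by omega)
      simp [State.setReg, h1, h2, h3, h4] at k2 k3 k5 k6 k7 k8
      refine ⟨_, _, .seq (.const ..) <| .seq (.add ..) <| .seq k1 <| .seq (.load ..) <|
        .seq (.store ..) <| .seq (.add ..) (.sub ..), by omega,
        by omega, ?_, ?_, ?_, ?_, ?_, ?_⟩
      · simp [State.setReg, State.setMem, k5, k7]
      · simp [State.setReg, State.setMem, k6, k7]; omega
      · simp [State.setReg, State.setMem, k7]
      · simp [State.setReg, State.setMem, k8]
      · intro i hi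
        simp only [State.setReg, State.setMem]
        rw [Function.update_of_ne (a' := (_ : ℕ)), k3, h5 i hi]
        simp [k2]; omega
      · intro b i
        simp only [State.setReg, State.setMem, Function.update_apply]
        simp only [k2, k3, k6, h6]
        norm_num
        split_ifs with e1 e2 e2 e2
        · obtain rfl : i = L - (k + 1) := by omega
          exact h5 _ (by omega)
        · exact absurd ⟨Fin.ext (by simp; omega), by omega⟩ e2
        · rfl
        · obtain ⟨rfl, _⟩ := ‹b = 0 ∧ _›
          simp at e1 e2; omega
        · obtain ⟨rfl, _⟩ := ‹b = 0 ∧ i < L - k›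
          simp at e1 e2; omega
        · rfl)
    L ((σ.setReg 3 0).setReg 5 L)
    ⟨le_rfl, by simp [State.setReg], by simp [State.setReg], by simp [State.setReg, h7],
      by simp [State.setReg, h0], fun i _ => by rw [← hm]; rfl, fun b i => by
        simp only [State.setReg, hm]; rw [hw _ (by omega)]; simp⟩
  refine ⟨1 + (1 + t), σ', .seq (.const ..) <| .seq (.add ..) ?_, by omega, h3, fun b i => ?_⟩
  · convert h1 using 1
    simp [State.setReg, h0]
  · rw [h5]
    by_cases hi : i < L
    · simp [hi]
    · rw [hw i (by omega)]; simp

/-- Copy the first entries of the array `17` to the beginning of the memory; their number is in the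
variable `0`. -/
def writeProg : Prog :=
  .seq (.const 3 0) <| .seq (.add 5 2 3) <| .seq (.const 7 1) <| .loop 5 <|
    .seq (.const 11 0) <| .seq (.add 11 11 3) <| .seq (addrProg 11 9 17) <| .seq (.load 9 11) <|
      .seq (.store 3 9) <| .seq (.add 3 3 7) <| .sub 5 5 7

theorem exec_writeProg {base : ℕ} {s : Store} {σ : State} (h : Encodes base s σ)
    (hn : s.v 0 ≤ base) : ∃ t σ', Exec writeProg σ t σ' ∧ t ≤ 15 * s.v 0 + 4 ∧
      ∀ v < s.v 0, σ'.mem v = s.a 17 v := by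
  obtain ⟨t, σ', h1, h2, -, -, -, -, -, -, h5⟩ := exec_countdown (r := 5)
    (p := .seq (.const 11 0) <| .seq (.add 11 11 3) <| .seq (addrProg 11 9 17) <|
      .seq (.load 9 11) <| .seq (.store 3 9) <| .seq (.add 3 3 7) <| .sub 5 5 7)
    (fun k σ => k ≤ s.v 0 ∧ σ.reg 5 = k ∧ σ.reg 3 = s.v 0 - k ∧ σ.reg 7 = 1 ∧ σ.reg 0 = base ∧
      (∀ i, σ.mem (base + 32 * i + 17) = s.a 17 i) ∧ ∀ v < s.v 0 - k, σ.mem v = s.a 17 v)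
    14 (fun k σ h => h.2.1) (by
      rintro k σ ⟨h0, h1, h2, h3, h4, h5, h6⟩
      obtain ⟨σ₂, k1, k2, k3, k4⟩ := exec_addrProg (base := base) (t := 11) (u := 9) 17
        ((σ.setReg 11 0).setReg 11 ((σ.setReg 11 0).reg 11 + (σ.setReg 11 0).reg 3))
        (by simp [State.setReg, h4]) (by omega) (by omega)
      have k5 := k4 5 (by omega) (by omega)
      have k6 := k4 3 (by omega) (by omega)
      have k7 := k4 7 (by omega) (by omega)
      have k8 := k4 0 (by omega) (by omega)
      simp [State.setReg, h1, h2, h3, h4] at k2 k3 k5 k6 k7 k8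
      refine ⟨_, _, .seq (.const ..) <| .seq (.add ..) <| .seq k1 <| .seq (.load ..) <|
        .seq (.store ..) <| .seq (.add ..) (.sub ..), by omega,
        by omega, ?_, ?_, ?_, ?_, ?_, ?_⟩
      · simp [State.setReg, State.setMem, k5, k7]
      · simp [State.setReg, State.setMem, k6, k7]; omega
      · simp [State.setReg, State.setMem, k7]
      · simp [State.setReg, State.setMem, k8]
      · intro i
        simp only [State.setReg, State.setMem, Function.update_apply]
        simp only [k2, k3, k6, h5]
        norm_num
        intro e; omega
      · intro v hv
        simp only [State.setReg, State.setMem, Function.update_apply]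
        simp only [k2, k3, k6, h5]
        norm_num
        split_ifs with e
        · rw [e]
        · exact h6 v (by omega))
    (s.v 0) (((σ.setReg 3 0).setReg 5 (s.v 0)).setReg 7 1)
    ⟨le_rfl, by simp [State.setReg], by simp [State.setReg], by simp [State.setReg],
      by simp [State.setReg, h.reg_zero], fun i => h.a 17 i, fun v hv => by omega⟩
  refine ⟨1 + (1 + (1 + t)), σ', .seq (.const ..) <| .seq (.add ..) <| .seq (.const ..) ?_,
    by omega, fun v hv => h5 v (by omega)⟩
  convert h1 using 1
  simp [State.setReg, h.v 0]

/-- A program of the language is executed by a machine program, which copies the input to the array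
`0`, runs the compiled program, and copies the output from the array `17`. The length of the input
is determined from its first part, which lists `w 0` summands of its length. -/
theorem exists_prog (c : Cmd) : ∃ p : Prog, ∀ w : List ℕ,
    w.length = 1 + w.getD 0 0 + ∑ i ∈ range (w.getD 0 0), w.getD (1 + i) 0 →
    ∃ s : Store, (∀ b i, s.a b i = if b = 0 then w.getD i 0 else 0) ∧
      ((c.run s).v 0 = w.getD 0 0 → ∃ t σ, Exec p (initial w) t σ ∧
        t ≤ 35 * w.length + 13 + c.cost s ∧ ∀ v < w.getD 0 0, σ.mem v = (c.run s).a 17 v) := by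
  refine ⟨.seq measureProg (.seq copyProg (.seq (c.compile 0) writeProg)), fun w hw => ?_⟩
  obtain ⟨t₁, σ₁, a1, a2, a3, a4, a5⟩ := exec_measureProg (fun i => w.getD i 0)
  obtain ⟨t₂, σ₂, b1, b2, b3, b4⟩ := exec_copyProg (fun i => w.getD i 0) w.length
    (fun i hi => List.getD_eq_default _ _ hi) σ₁ (a3.trans hw.symm) a4 a5
  set s : Store := ⟨fun x => σ₂.reg (2 * x + 2), fun b i => if b = 0 then w.getD i 0 else 0⟩
    with hs
  refine ⟨s, fun _ _ => rfl, fun hv => ?_⟩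
  obtain ⟨σ₃, c1, c2, -⟩ := c.exec_compile 0 s σ₂ ⟨b3, fun _ => rfl, b4⟩
  obtain ⟨t₄, σ₄, d1, d2, d3⟩ := exec_writeProg c2 (by rw [hv]; omega)
  rw [hv] at d2 d3
  exact ⟨_, σ₄, .seq a1 (.seq b1 (.seq c1 d1)), by omega, d3⟩

end Imp

namespace FHG

open Finset Imp Imp.Exp Imp.Cmd

/-! ### Reading the graph -/

/-- One command after the other. -/
infixr:50 " ;; " => Imp.Cmd.seq

/-- The input word. -/
notation "aIn" => (0 : Fin 32)
/-- Where the adjacency list of a vertex starts. -/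
notation "aStart" => (1 : Fin 32)
/-- The position of a vertex in the search order, `0` if it has not been found yet. -/
notation "aPos" => (2 : Fin 32)
/-- The vertex at a position. -/
notation "aOrd" => (3 : Fin 32)
/-- The parent of a node. -/
notation "aPar" => (4 : Fin 32)
/-- The gain of adding a leaf to a star. -/
notation "aGain" => (5 : Fin 32)
/-- The state of the parent before the merge, for each rule. -/
notation "aX" => (6 : Fin 32)
/-- The state of the child before the merge, for each rule. -/
notation "aY" => (7 : Fin 32)
/-- The state of the parent after the merge, for each rule. -/
notation "aZ" => (8 : Fin 32)
/-- The gain of each rule. -/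
notation "aW" => (9 : Fin 32)
/-- The kind of each rule. -/
notation "aJ" => (10 : Fin 32)
/-- Where the row of a node starts. -/
notation "aRow" => (11 : Fin 32)
/-- The rows of the dynamic program, one after the other. -/
notation "aVal" => (12 : Fin 32)
/-- The row that is being computed. -/
notation "aNew" => (13 : Fin 32)
/-- The rules that attain the entries of the rows. -/
notation "aCh" => (14 : Fin 32)
/-- The states found by backtracking. -/
notation "aCur" => (15 : Fin 32)
/-- The labels of the nodes. -/
notation "aLab" => (16 : Fin 32)
/-- The output. -/
notation "aOut" => (17 : Fin 32)

/-- The variables `0` and `1` and the arrays `aIn` and `aStart` describe the graph `G` and a bound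
`Δ` on its degrees. -/
structure Reads {n : ℕ} (G : SimpleGraph (Fin n)) (Δ : ℕ) (s : Store) : Prop where
  size : s.v 0 = n
  bound : s.v 1 = Δ
  deg_le : ∀ v : Fin n, s.a aIn (1 + v) ≤ Δ
  adj : ∀ v : Fin n, ∀ k < s.a aIn (1 + v), ∃ u : Fin n,
    G.Adj v u ∧ s.a aIn (s.a aStart v + k) = u
  exists_eq : ∀ v u : Fin n, G.Adj v u → ∃ k < s.a aIn (1 + v), s.a aIn (s.a aStart v + k) = u

theorem Reads.congr {n : ℕ} {G : SimpleGraph (Fin n)} {Δ : ℕ} {s s' : Store} (h : Reads G Δ s)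
    (h0 : s'.v 0 = s.v 0) (h1 : s'.v 1 = s.v 1) (h2 : s'.a aIn = s.a aIn)
    (h3 : s'.a aStart = s.a aStart) : Reads G Δ s' := by
  refine ⟨h0.trans h.size, h1.trans h.bound, ?_, ?_, ?_⟩
  · rw [h2]; exact h.deg_le
  · rw [h2, h3]; exact h.adj
  · rw [h2, h3]; exact h.exists_eq

theorem getElem?_flatten {α : Type*} (L : List (List α)) {i k : ℕ} {l : List α} (hl : L[i]? = some l)
    (hk : k < l.length) : L.flatten[((L.take i).map List.length).sum + k]? = l[k]? := by
  induction L generalizing i with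
  | nil => simp at hl
  | cons a L ih =>
    cases i with
    | zero =>
      obtain rfl : a = l := by simpa using hl
      simp [List.getElem?_append_left hk]
    | succ i =>
      rw [List.flatten_cons, List.take_succ_cons, List.map_cons, List.sum_cons,
        List.getElem?_append_right (by omega), ← ih (by simpa using hl)]
      congr 1
      omega

section Word
variable {n : ℕ} (adj : Fin n → List (Fin n))

theorem inputWord_eq : inputWord adj = n :: (List.ofFn (fun v => (adj v).length) ++
    (List.ofFn adj).flatten.map Fin.val) := by
  simp only [inputWord, List.bind_eq_flatMap, List.pure_def, List.map_id']
  rw [List.map_eq_flatMap]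

theorem inputWord_zero : (inputWord adj).getD 0 0 = n := rfl

theorem inputWord_deg (v : Fin n) : (inputWord adj).getD (1 + v) 0 = (adj v).length := by
  rw [inputWord, List.getD_eq_getElem?_getD, add_comm, List.getElem?_cons_succ,
    List.getElem?_append_left (by simp)]
  simp

theorem sum_range_inputWord (i : ℕ) (hi : i ≤ n) :
    ∑ j ∈ range i, (inputWord adj).getD (1 + j) 0 =
      (((List.ofFn adj).take i).map List.length).sum := by
  induction i with
  | zero => simp
  | succ i ih =>
    rw [sum_range_succ, ih (by omega), inputWord_deg adj ⟨i, hi⟩,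
      List.take_succ_eq_append_getElem (by simpa using hi)]
    simp

theorem length_inputWord : (inputWord adj).length = 1 + (inputWord adj).getD 0 0 +
    ∑ i ∈ range ((inputWord adj).getD 0 0), (inputWord adj).getD (1 + i) 0 := by
  rw [inputWord_zero, sum_range_inputWord adj n le_rfl, List.take_of_length_le (by simp),
    inputWord_eq]
  simp only [List.length_cons, List.length_append, List.length_map, List.length_ofFn,
    List.length_flatten]
  ring

theorem inputWord_nb (v : Fin n) (k : ℕ) (hk : k < (adj v).length) :
    (inputWord adj).getD (n + 1 + ∑ j ∈ range v, (inputWord adj).getD (1 + j) 0 + k) 0 =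
      ((adj v)[k] : ℕ) := by
  rw [sum_range_inputWord adj v v.2.le, inputWord_eq, List.getD_eq_getElem?_getD,
    show n + 1 + (((List.ofFn adj).take v).map List.length).sum + k =
      n + ((((List.ofFn adj).take v).map List.length).sum + k) + 1 by ring,
    List.getElem?_cons_succ, List.getElem?_append_right (by simp), List.length_ofFn,
    Nat.add_sub_cancel_left, List.getElem?_map,
    getElem?_flatten (List.ofFn adj) (l := adj v) (by simp) hk]
  simp [hk]

/-- Prepare for the loop over the vertices. -/
def readInit : Cmd :=
  set 0 (get aIn (lit 0)) ;; set 1 (lit 0) ;; set 2 (add (var 0) (lit 1))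

/-- Note where the adjacency list of a vertex starts, and compare its length with the maximum. -/
def readBody : Cmd :=
  put aStart (var 3) (var 2) ;;
  set 2 (add (var 2) (get aIn (add (lit 1) (var 3)))) ;;
  ite (sub (get aIn (add (lit 1) (var 3))) (var 1)) (set 1 (get aIn (add (lit 1) (var 3)))) skip

/-- Compute where the adjacency lists start, and the maximum degree. -/
def readCmd : Cmd := readInit ;; forto 3 (var 0) readBody

theorem readCmd_spec {G : SimpleGraph (Fin n)} [DecidableRel G.Adj] (hadj : IsAdjacencyList G adj)
    {s : Store} (hs : ∀ i, s.a aIn i = (inputWord adj).getD i 0) :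
    Reads G G.maxDegree (readCmd.run s) ∧ readCmd.cost s ≤ 200 * n + 200 := by
  have hin : s.a aIn = fun i => (inputWord adj).getD i 0 := funext hs
  have hdeg : ∀ v, (adj v).length = G.degree v := fun v => by
    rw [← List.toFinset_card_of_nodup (hadj v).1, ← SimpleGraph.card_neighborFinset_eq_degree]
    congr 1
    ext w
    simp [(hadj v).2 w]
  have hv0 : (readInit.run s).v 0 = n := by simp [readInit, hin, inputWord]
  have hcost : readInit.cost s ≤ 100 := cost_le rfl s
  obtain ⟨⟨h1, h2, h3, h4⟩, h5⟩ := forto_spec (x := 3) (e := var 0) (c := readBody)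
    (s := readInit.run s) (k := n) (by simpa using hv0)
    (fun i s' => s'.v 2 = n + 1 + ∑ j ∈ range i, (inputWord adj).getD (1 + j) 0 ∧
      (∀ j < i, s'.a aStart j = n + 1 + ∑ j ∈ range j, (inputWord adj).getD (1 + j) 0) ∧
      (∀ j < i, (inputWord adj).getD (1 + j) 0 ≤ s'.v 1) ∧ s'.v 1 ≤ G.maxDegree)
    100 ⟨by simp [readInit, hin, inputWord], by simp, by simp, by simp [readInit]⟩ (by
      rintro i hi s' ha - ⟨i1, i2, i3, i4⟩
      refine ⟨?_, cost_le rfl _⟩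
      have hin' : s'.a aIn = fun i => (inputWord adj).getD i 0 :=
        (ha.a aIn rfl).trans ((Cmd.run_a _ _ rfl).trans hin)
      have hd := G.degree_le_maxDegree ⟨i, hi⟩
      rw [← hdeg, ← inputWord_deg] at hd
      have e1 : (readBody.run (s'.setv 3 i)).v 2 = s'.v 2 + (inputWord adj).getD (1 + i) 0 := by
        simp [readBody, hin']
      have e2 : (readBody.run (s'.setv 3 i)).a aStart =
          Function.update (s'.a aStart) i (s'.v 2) := by
        simp [readBody]
      have e3 : (readBody.run (s'.setv 3 i)).v 1 =
          if (inputWord adj).getD (1 + i) 0 - s'.v 1 = 0 then s'.v 1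
            else (inputWord adj).getD (1 + i) 0 := by
        simp [readBody, hin']
      rw [e1, e2, e3]
      refine ⟨by rw [sum_range_succ]; omega, fun j hj => ?_, fun j hj => ?_, ?_⟩
      · rcases Nat.lt_succ_iff_lt_or_eq.1 hj with hj | rfl
        · rw [Function.update_of_ne (by omega), i2 j hj]
        · rw [Function.update_self, i1]
      · rcases Nat.lt_succ_iff_lt_or_eq.1 hj with hj | rfl
        · have := i3 j hj
          split_ifs <;> omega
        · split_ifs <;> omega
      · split_ifs
        · exact i4
        · exact hd)
  have hrun : readCmd.run s = (forto 3 (var 0) readBody).run (readInit.run s) := rfl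
  refine ⟨?_, by rw [readCmd, cost_seq]; simp only [Exp.cost] at h5; omega⟩
  have hv0' : (readCmd.run s).v 0 = n := by rw [hrun, Cmd.run_v _ _ rfl, hv0]
  have hin' : (readCmd.run s).a aIn = fun i => (inputWord adj).getD i 0 := by
    rw [Cmd.run_a _ _ rfl, hin]
  rw [hrun] at hv0' hin' ⊢
  have hmax := le_antisymm h4 (G.maxDegree_le_of_forall_degree_le _ fun v => by
    rw [← hdeg, ← inputWord_deg]; exact h3 v v.2)
  refine ⟨hv0', hmax, fun v => ?_, fun v k hk => ?_, fun v u huv => ?_⟩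
  · rw [hin', ← hmax]; exact h3 v v.2
  · simp only [hin', inputWord_deg] at hk
    refine ⟨(adj v)[k], ((hadj v).2 _).1 (List.getElem_mem hk), ?_⟩
    rw [h2 v v.2, hin']
    exact inputWord_nb adj v k hk
  · obtain ⟨k, hk, rfl⟩ := List.mem_iff_getElem.1 (((hadj v).2 u).2 huv)
    refine ⟨k, by rw [hin']; simpa only [inputWord_deg] using hk, ?_⟩
    rw [h2 v v.2, hin']
    exact inputWord_nb adj v k hk

end Word

/-! ### Search order -/

/-- The vertices found so far have the positions `1, …, t`, with inverse `O`; each but the first of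
its component has a neighbour before it. -/
structure IsFound {n : ℕ} (G : SimpleGraph (Fin n)) (P O : ℕ → ℕ) (t : ℕ) : Prop where
  le : ∀ v : Fin n, P v ≤ t
  ord : ∀ v : Fin n, P v ≠ 0 → O (P v) = v
  exists_eq : ∀ j, 1 ≤ j → j ≤ t → ∃ v : Fin n, P v = j
  step : ∀ v : Fin n, P v ≠ 0 → (∃ u : Fin n, G.Adj u v ∧ P u ≠ 0 ∧ P u < P v) ∨
    ∀ u w : Fin n, P u ≠ 0 → P u < P v → (P w = 0 ∨ P v ≤ P w) → ¬ G.Adj u w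

section
variable {n : ℕ} {G : SimpleGraph (Fin n)} {P O : ℕ → ℕ} {t : ℕ}

theorem IsFound.push (h : IsFound G P O t) {v : Fin n} (hv : P v = 0)
    (hstep : (∃ u : Fin n, G.Adj u v ∧ P u ≠ 0) ∨
      ∀ u w : Fin n, P u ≠ 0 → P w = 0 → ¬ G.Adj u w) :
    IsFound G (Function.update P v (t + 1)) (Function.update O (t + 1) v) (t + 1) := by
  have hself : Function.update P v (t + 1) v = t + 1 := Function.update_self ..
  have hne : ∀ u : Fin n, u ≠ v → Function.update P v (t + 1) u = P u := fun u hu =>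
    Function.update_of_ne (fun e => hu (Fin.ext e)) _ _
  refine ⟨fun u => ?_, fun u hu => ?_, fun j h1 hj => ?_, fun u hu => ?_⟩
  · by_cases huv : u = v
    · rw [huv, hself]
    · rw [hne u huv]; exact (h.le u).trans (Nat.le_succ t)
  · by_cases huv : u = v
    · rw [huv, hself, Function.update_self]
    · rw [hne u huv] at hu ⊢
      rw [Function.update_of_ne (by have := h.le u; omega), h.ord u hu]
  · rcases Nat.lt_succ_iff_lt_or_eq.1 (Nat.lt_succ_of_le hj) with hj' | rfl
    · obtain ⟨u, hu⟩ := h.exists_eq j h1 (by omega)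
      refine ⟨u, ?_⟩
      rw [hne u (fun e => by rw [e, hv] at hu; exact absurd h1 (by simp [← hu])), hu]
    · exact ⟨v, hself⟩
  · by_cases huv : u = v
    · subst huv
      rw [hself]
      rcases hstep with ⟨x, hx, hx0⟩ | hno
      · refine Or.inl ⟨x, hx, ?_⟩
        have := h.le x
        rw [hne x hx.ne]; omega
      · refine Or.inr fun x w hx hxt hw => ?_
        have hxv : x ≠ u := by rintro rfl; omega
        rw [hne x hxv] at hx
        by_cases hwv : w = u
        · rw [hwv]; exact hno x u hx hv
        · rw [hne w hwv] at hw
          have := h.le w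
          exact hno x w hx (by omega)
    · rw [hne u huv] at hu ⊢
      have hut := h.le u
      rcases h.step u hu with ⟨x, hx, hx0, hxu⟩ | hno
      · refine Or.inl ⟨x, hx, ?_⟩
        rw [hne x (fun e => hx0 (by rw [e, hv]))]
        exact ⟨hx0, hxu⟩
      · refine Or.inr fun x w hx hxt hw => ?_
        have hxv : x ≠ v := by rintro rfl; omega
        rw [hne x hxv] at hx hxt
        refine hno x w hx hxt ?_
        by_cases hwv : w = v
        · left; rw [hwv, hv]
        · rwa [hne w hwv] at hw

theorem IsFound.le_card (h : IsFound G P O t) : t ≤ n := by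
  choose f hf using fun j : Fin t => h.exists_eq (j + 1) (by omega) (by omega)
  have := Fintype.card_le_of_injective f fun i j hij => by
    have h1 := hf i
    rw [hij, hf j] at h1
    exact Fin.ext (by omega)
  simpa using this

theorem IsFound.card_le (h : IsFound G P O t) (hall : ∀ v : Fin n, P v ≠ 0) : n ≤ t := by
  have := Fintype.card_le_of_injective
    (fun v : Fin n => (⟨P v - 1, by have := hall v; have := h.le v; omega⟩ : Fin t))
    fun u v huv => by
      simp only [Fin.mk.injEq] at huv
      have h1 := h.ord u (hall u)
      have h2 : P u = P v := by have := hall u; have := hall v; omega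
      rw [h2, h.ord v (hall v)] at h1
      exact Fin.ext h1.symm
  simpa using this

/-- Append the vertex in the variable `x` to the queue. -/
def pushCmd (x : ℕ) : Cmd :=
  set 4 (add (var 4) (lit 1)) ;; put aPos (var x) (var 4) ;; put aOrd (var 4) (var x)

/-- Look at one neighbour. -/
def scanBody : Cmd :=
  set 10 (get aIn (add (get aStart (var 8)) (var 9))) ;;
  ite (get aPos (var 10)) skip (pushCmd 10)

/-- Look at all neighbours of the vertex in the variable `8`. -/
def scanCmd : Cmd := forto 9 (get aIn (add (lit 1) (var 8))) scanBody

/-- Process the next vertex of the queue or, if there is none, advance in the list of all vertices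
and append the vertex found there to the queue, unless it has been found before. -/
def searchBody : Cmd :=
  ite (sub (var 4) (var 5))
    (set 5 (add (var 5) (lit 1)) ;; set 8 (get aOrd (var 5)) ;; scanCmd)
    (ite (get aPos (var 6)) skip (pushCmd 6) ;; set 6 (add (var 6) (lit 1)))

/-- Prepare the search. -/
def searchInit : Cmd := set 4 (lit 0) ;; set 5 (lit 0) ;; set 6 (lit 0)

/-- Search the graph, one component after the other. In each of `2 * n` rounds one of `n` vertices
leaves the queue or one of `n` starting points is tried. -/
def searchCmd : Cmd := searchInit ;; forto 7 (add (var 0) (var 0)) searchBody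

theorem scanCmd_spec {Δ : ℕ} {s : Store} (hr : Reads G Δ s)
    (hf : IsFound G (s.a aPos) (s.a aOrd) (s.v 4)) {v : Fin n} (hv : s.v 8 = v)
    (hv0 : s.a aPos v ≠ 0) :
    (IsFound G ((scanCmd.run s).a aPos) ((scanCmd.run s).a aOrd) ((scanCmd.run s).v 4) ∧
      (∀ u : Fin n, s.a aPos u ≠ 0 → (scanCmd.run s).a aPos u = s.a aPos u) ∧
      (∀ u : Fin n, G.Adj v u → (scanCmd.run s).a aPos u ≠ 0) ∧ s.v 4 ≤ (scanCmd.run s).v 4) ∧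
      scanCmd.cost s ≤ 30 + Δ * 106 := by
  obtain ⟨⟨h1, h2, h3, h5⟩, h4⟩ := forto_spec (x := 9) (e := get aIn (add (lit 1) (var 8)))
    (c := scanBody) (s := s) (k := s.a aIn (1 + v)) (by simp [hv])
    (fun i s' => IsFound G (s'.a aPos) (s'.a aOrd) (s'.v 4) ∧
      (∀ u : Fin n, s.a aPos u ≠ 0 → s'.a aPos u = s.a aPos u) ∧
      (∀ k < i, s'.a aPos (s.a aIn (s.a aStart v + k)) ≠ 0) ∧ s.v 4 ≤ s'.v 4)
    100 ⟨hf, fun _ _ => rfl, by simp, le_rfl⟩ (by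
      rintro i hi s' ha - ⟨i1, i2, i3, i4⟩
      refine ⟨?_, cost_le rfl _⟩
      have a1 := ha.a aIn rfl
      have a2 := ha.a aStart rfl
      have a3 := ha.v 8 rfl
      obtain ⟨u, hvu, hu⟩ := hr.adj v i hi
      by_cases hu0 : s'.a aPos u = 0
      · have e1 : (scanBody.run (s'.setv 9 i)).v 4 = s'.v 4 + 1 := by
          simp [scanBody, pushCmd, a1, a2, a3, hv, hu, hu0]
        have e2 : (scanBody.run (s'.setv 9 i)).a aPos =
            Function.update (s'.a aPos) u (s'.v 4 + 1) := by
          simp [scanBody, pushCmd, a1, a2, a3, hv, hu, hu0]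
        have e3 : (scanBody.run (s'.setv 9 i)).a aOrd =
            Function.update (s'.a aOrd) (s'.v 4 + 1) u := by
          simp [scanBody, pushCmd, a1, a2, a3, hv, hu, hu0]
        rw [e1, e2, e3]
        refine ⟨i1.push hu0 (Or.inl ⟨v, hvu, by rw [i2 v hv0]; exact hv0⟩), fun w hw => ?_,
          fun k hk => ?_, by omega⟩
        · rw [Function.update_of_ne, i2 w hw]
          intro e
          rw [← e, i2 w hw] at hu0
          exact hw hu0
        · rw [Function.update_apply]
          split_ifs with e
          · omega
          · rcases Nat.lt_succ_iff_lt_or_eq.1 hk with hk | rfl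
            · exact i3 k hk
            · exact absurd hu e
      · have e1 : (scanBody.run (s'.setv 9 i)).v 4 = s'.v 4 := by
          simp [scanBody, pushCmd, a1, a2, a3, hv, hu, hu0]
        have e2 : (scanBody.run (s'.setv 9 i)).a aPos = s'.a aPos := by
          simp [scanBody, pushCmd, a1, a2, a3, hv, hu, hu0]
        have e3 : (scanBody.run (s'.setv 9 i)).a aOrd = s'.a aOrd := by
          simp [scanBody, pushCmd, a1, a2, a3, hv, hu, hu0]
        rw [e1, e2, e3]
        refine ⟨i1, i2, fun k hk => ?_, i4⟩
        rcases Nat.lt_succ_iff_lt_or_eq.1 hk with hk | rfl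
        · exact i3 k hk
        · rw [hu]; exact hu0)
  refine ⟨⟨h1, h2, fun u hu => ?_, h5⟩, h4.trans ?_⟩
  · obtain ⟨k, hk, hku⟩ := hr.exists_eq v u hu
    have := h3 k hk
    rwa [hku] at this
  · have := Nat.mul_le_mul_right 106 (hr.deg_le v)
    simp only [Exp.cost]
    omega

/-- The search finds all vertices. Its invariant: the variable `4` counts the vertices found, `5` those
of them whose neighbours have all been found, and `6` the starting points tried. -/
theorem searchCmd_spec {Δ : ℕ} {s : Store} (hr : Reads G Δ s) (hs : ∀ i, s.a aPos i = 0) :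
    (IsFound G ((searchCmd.run s).a aPos) ((searchCmd.run s).a aOrd) n ∧
      ∀ v : Fin n, (searchCmd.run s).a aPos v ≠ 0) ∧
      searchCmd.cost s ≤ 100 + 2 * n * (200 + Δ * 106) := by
  obtain ⟨⟨h1, h2, h3, h4, h5⟩, h6⟩ := forto_spec (x := 7) (e := add (var 0) (var 0))
    (c := searchBody) (s := searchInit.run s) (k := 2 * n)
    (by simp [searchInit, hr.size, two_mul])
    (fun i s' => IsFound G (s'.a aPos) (s'.a aOrd) (s'.v 4) ∧ s'.v 5 + s'.v 6 = i ∧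
      s'.v 5 ≤ s'.v 4 ∧
      (∀ v : Fin n, s'.a aPos v ≠ 0 → s'.a aPos v ≤ s'.v 5 →
        ∀ u, G.Adj v u → s'.a aPos u ≠ 0) ∧
      (∀ v : Fin n, v < s'.v 6 → s'.a aPos v ≠ 0))
    (180 + Δ * 106) (by
      refine ⟨⟨?_, ?_, ?_, ?_⟩, ?_, ?_, ?_, ?_⟩
      all_goals simp [searchInit, hs]
      all_goals intros; omega) (by
      rintro i hi s' ha - ⟨i1, i2, i3, i4, i5⟩
      have hr' : Reads G Δ s' := hr.congr ((ha.v 0 rfl).trans (Cmd.run_v _ _ rfl))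
        ((ha.v 1 rfl).trans (Cmd.run_v _ _ rfl)) ((ha.a aIn rfl).trans (Cmd.run_a _ _ rfl))
        ((ha.a aStart rfl).trans (Cmd.run_a _ _ rfl))
      by_cases hq : s'.v 4 - s'.v 5 = 0
      · have hcost : searchBody.cost (s'.setv 7 i) ≤ 180 + Δ * 106 := by
          have h1 : searchBody.cost (s'.setv 7 i) = 6 +
              (ite (get aPos (var 6)) skip (pushCmd 6) ;; set 6 (add (var 6) (lit 1))).cost
                (s'.setv 7 i) := by
            simp [searchBody, Cmd.cost, Exp.cost, hq]
          have h2 : (ite (get aPos (var 6)) skip (pushCmd 6) ;; set 6 (add (var 6) (lit 1))).cost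
              (s'.setv 7 i) ≤ 100 := cost_le rfl _
          omega
        have hhead : s'.v 5 = s'.v 4 := by omega
        have hclosed : ∀ u w : Fin n, s'.a aPos u ≠ 0 → s'.a aPos w = 0 → ¬ G.Adj u w :=
          fun u w hu hw huw => i4 u hu (by rw [hhead]; exact i1.le u) w huw hw
        -- if all starting points have been tried, then all vertices have left the queue
        have hlt : s'.v 6 < n := by
          by_contra hge
          have := i1.card_le fun v => i5 v (by omega)
          omega
        refine ⟨?_, hcost⟩
        have e5 : (searchBody.run (s'.setv 7 i)).v 5 = s'.v 5 := by
          simp [searchBody, pushCmd, hq]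
        have e6 : (searchBody.run (s'.setv 7 i)).v 6 = s'.v 6 + 1 := by
          simp [searchBody, pushCmd, hq]
        by_cases hp : s'.a aPos (s'.v 6) = 0
        · have e4 : (searchBody.run (s'.setv 7 i)).v 4 = s'.v 4 + 1 := by
            simp [searchBody, pushCmd, hq, hp]
          have eP : (searchBody.run (s'.setv 7 i)).a aPos =
              Function.update (s'.a aPos) (s'.v 6) (s'.v 4 + 1) := by
            simp [searchBody, pushCmd, hq, hp]
          have eO : (searchBody.run (s'.setv 7 i)).a aOrd =
              Function.update (s'.a aOrd) (s'.v 4 + 1) (s'.v 6) := by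
            simp [searchBody, pushCmd, hq, hp]
          rw [e4, e5, e6, eP, eO]
          refine ⟨i1.push (v := ⟨s'.v 6, hlt⟩) hp (Or.inr hclosed), by omega, by omega,
            fun v hv hv5 u hvu => ?_, fun v hv => ?_⟩
          · rw [Function.update_apply] at hv hv5 ⊢
            split_ifs at hv hv5 ⊢ with ev eu eu
            · omega
            · omega
            · omega
            · exact i4 v hv hv5 u hvu
          · rw [Function.update_apply]
            split_ifs with ev
            · omega
            · exact i5 v (by omega)
        · have e4 : (searchBody.run (s'.setv 7 i)).v 4 = s'.v 4 := by
            simp [searchBody, hq, hp]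
          have eP : (searchBody.run (s'.setv 7 i)).a aPos = s'.a aPos := by
            simp [searchBody, hq, hp]
          have eO : (searchBody.run (s'.setv 7 i)).a aOrd = s'.a aOrd := by
            simp [searchBody, hq, hp]
          rw [e4, e5, e6, eP, eO]
          refine ⟨i1, by omega, i3, i4, fun v hv => ?_⟩
          by_cases ev : (v : ℕ) = s'.v 6
          · rw [ev]; exact hp
          · exact i5 v (by omega)
      · obtain ⟨v, hv⟩ := i1.exists_eq (s'.v 5 + 1) (by omega) (by omega)
        have hov := i1.ord v (by omega)
        rw [hv] at hov
        set s₂ := (set 5 (add (var 5) (lit 1)) ;; set 8 (get aOrd (var 5))).run (s'.setv 7 i)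
          with hs₂
        have p4 : s₂.v 4 = s'.v 4 := by simp [hs₂]
        have p5 : s₂.v 5 = s'.v 5 + 1 := by simp [hs₂]
        have p6 : s₂.v 6 = s'.v 6 := by simp [hs₂]
        have p8 : s₂.v 8 = v := by simp [hs₂, hov]
        have pP : s₂.a aPos = s'.a aPos := by simp [hs₂]
        have pO : s₂.a aOrd = s'.a aOrd := by simp [hs₂]
        obtain ⟨⟨k1, k2, k3, k5⟩, k4⟩ := scanCmd_spec (s := s₂) (Δ := Δ)
          (hr'.congr (by simp [hs₂]) (by simp [hs₂]) (by simp [hs₂]) (by simp [hs₂]))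
          (by rw [p4, pP, pO]; exact i1) p8 (by rw [pP]; omega)
        have hrun : searchBody.run (s'.setv 7 i) = scanCmd.run s₂ := by
          simp [searchBody, hq, hs₂]
        have hcost : searchBody.cost (s'.setv 7 i) ≤ 180 + Δ * 106 := by
          have h1 : searchBody.cost (s'.setv 7 i) = 6 +
              (set 5 (add (var 5) (lit 1)) ;; set 8 (get aOrd (var 5)) ;; scanCmd).cost
                (s'.setv 7 i) := by
            simp [searchBody, Cmd.cost, Exp.cost, hq]
          have h2 : (set 5 (add (var 5) (lit 1)) ;; set 8 (get aOrd (var 5)) ;; scanCmd).cost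
              (s'.setv 7 i) = 6 + (13 + scanCmd.cost s₂) := rfl
          omega
        refine ⟨?_, hcost⟩
        have q5 : (scanCmd.run s₂).v 5 = s'.v 5 + 1 := (Cmd.run_v _ _ rfl).trans p5
        have q6 : (scanCmd.run s₂).v 6 = s'.v 6 := (Cmd.run_v _ _ rfl).trans p6
        rw [pP] at k2
        rw [hrun, q5, q6]
        refine ⟨k1, by omega, by omega, fun w hw hw5 u hwu => ?_, fun w hw => ?_⟩
        · by_cases hw0 : s'.a aPos w = 0
          · -- a vertex that is new comes after the end of the old queue
            obtain ⟨x, hx⟩ := i1.exists_eq _ (Nat.pos_of_ne_zero hw) (by omega)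
            have e1 := k1.ord x (by rw [k2 x (by omega), hx]; exact hw)
            rw [k2 x (by omega), hx, k1.ord w hw] at e1
            rw [← Fin.ext e1] at hx
            omega
          · rw [k2 w hw0] at hw5
            rcases Nat.lt_succ_iff_lt_or_eq.1 (Nat.lt_succ_of_le hw5) with hlt | heq
            · have := i4 w hw0 (by omega) u hwu
              rw [k2 u this]; exact this
            · have e1 := i1.ord w hw0
              rw [heq, hov] at e1
              rw [← Fin.ext e1] at hwu
              exact k3 u hwu
        · have := i5 w hw
          rw [k2 w this]; exact this)
  have hrun : searchCmd.run s = (forto 7 (add (var 0) (var 0)) searchBody).run (searchInit.run s) :=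
    rfl
  rw [← hrun] at h1 h2 h3 h4 h5
  have ht := h1.le_card
  have hall : ∀ v : Fin n, (searchCmd.run s).a aPos v ≠ 0 := fun v => h5 v (by omega)
  have ht' := h1.card_le hall
  refine ⟨⟨by rwa [le_antisymm ht ht'] at h1, hall⟩, ?_⟩
  have hc : searchInit.cost s ≤ 50 := cost_le rfl s
  have hm : 2 * n * (180 + Δ * 106 + 6) ≤ 2 * n * (200 + Δ * 106) :=
    Nat.mul_le_mul_left _ (by omega)
  rw [searchCmd, cost_seq]
  simp only [Exp.cost] at h6
  omega

theorem IsFound.isSearchOrder (h : IsFound G P O t) (hall : ∀ v : Fin n, P v ≠ 0) :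
    IsSearchOrder G (fun v : Fin n => P v) where
  inj u v huv := by
    have h1 := h.ord u (hall u)
    simp only at huv
    rw [huv, h.ord v (hall v)] at h1
    exact Fin.ext h1.symm
  one_le_pos v := Nat.pos_of_ne_zero (hall v)
  step v := (h.step v (hall v)).imp (fun ⟨u, h1, _, h2⟩ => ⟨u, h1, h2⟩)
    fun h1 u w h2 h3 => h1 u w (hall u) h2 (Or.inr h3)

end

/-! ### The tree of vertices and blocks -/

/-- Prepare the search for the first neighbour. -/
def topInit : Cmd :=
  set 8 (get aOrd (add (var 7) (lit 1))) ;; set 5 (add (var 7) (lit 1)) ;;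
  set 6 (add (var 7) (lit 1))

/-- Compare the position of a neighbour with the least one found so far. -/
def topBody : Cmd :=
  set 10 (get aPos (get aIn (add (get aStart (var 8)) (var 9)))) ;;
  ite (sub (var 5) (var 10)) (set 5 (var 10)) skip

/-- Compare the position of a neighbour with the second least one found so far. -/
def nameBody : Cmd :=
  set 10 (get aPos (get aIn (add (get aStart (var 8)) (var 9)))) ;;
  ite (sub (var 10) (var 5)) (ite (sub (var 6) (var 10)) (set 6 (var 10)) skip) skip

/-- Store the parents of the two nodes of a position. -/
def linkCmd : Cmd :=
  set 11 (add (add (var 7) (var 7)) (lit 2)) ;;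
  put aPar (add (var 11) (lit 1)) (add (var 6) (var 6)) ;;
  ite (sub (add (var 7) (lit 1)) (var 5))
    (put aPar (var 11) (add (add (var 5) (var 5)) (lit 1))) (put aPar (var 11) (lit 1))

/-- Find the parents of the two nodes of a position. -/
def parentBody : Cmd :=
  topInit ;; forto 9 (get aIn (add (lit 1) (var 8))) topBody ;;
  forto 9 (get aIn (add (lit 1) (var 8))) nameBody ;; linkCmd

/-- Find the parents of all nodes. -/
def parentCmd : Cmd := forto 7 (var 0) parentBody

/-- The first neighbour of `v` has the position `a` (`0` if there is none before `v`), and the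
second one, or `v` itself, has the position `b`. -/
structure IsTopName {n : ℕ} (G : SimpleGraph (Fin n)) (P : ℕ → ℕ) (v : Fin n) (a b : ℕ) : Prop where
  top : (a = 0 ∧ ∀ u, G.Adj v u → P v < P u) ∨
    ∃ w, G.Adj v w ∧ P w = a ∧ P w < P v ∧ ∀ u, G.Adj v u → a ≤ P u
  name : b ≤ P v ∧ a < b ∧ (b = P v ∨ ∃ w, G.Adj v w ∧ P w = b) ∧
    ∀ u, G.Adj v u → a < P u → b ≤ P u

section
variable {n : ℕ} {G : SimpleGraph (Fin n)}

theorem parentBody_spec {Δ i : ℕ} {s : Store} (hr : Reads G Δ s)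
    (hinj : ∀ u v : Fin n, s.a aPos u = s.a aPos v → u = v) {v : Fin n}
    (hv : s.a aPos v = i + 1) (hov : s.a aOrd (i + 1) = v) :
    (∃ a b, (parentBody.run (s.setv 7 i)).a aPar =
      Function.update (Function.update (s.a aPar) (2 * (i + 1) + 1) (2 * b)) (2 * (i + 1))
        (2 * a + 1) ∧ IsTopName G (s.a aPos) v a b) ∧
      parentBody.cost (s.setv 7 i) ≤ 300 + Δ * 212 := by
  set s₁ := topInit.run (s.setv 7 i) with hs₁
  have a8 : s₁.v 8 = v := by simp [hs₁, topInit, hov]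
  have a5 : s₁.v 5 = i + 1 := by simp [hs₁, topInit]
  have a6 : s₁.v 6 = i + 1 := by simp [hs₁, topInit]
  have a7 : s₁.v 7 = i := by simp [hs₁, topInit]
  have aa : s₁.a = s.a := by simp [hs₁, topInit]
  obtain ⟨⟨h1, h2, h3⟩, h4⟩ := forto_spec (x := 9) (e := get aIn (add (lit 1) (var 8)))
    (c := topBody) (s := s₁) (k := s.a aIn (1 + v)) (by simp [a8, aa])
    (fun j s' => s'.v 5 ≤ i + 1 ∧ (s'.v 5 = i + 1 ∨ ∃ u, G.Adj v u ∧ s.a aPos u = s'.v 5) ∧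
      ∀ k < j, s'.v 5 ≤ s.a aPos (s.a aIn (s.a aStart v + k)))
    100 ⟨a5.le, Or.inl a5, by simp⟩ (by
      rintro j hj s' ha - ⟨i1, i2, i3⟩
      refine ⟨?_, cost_le rfl _⟩
      obtain ⟨u, hvu, hu⟩ := hr.adj v j hj
      have b0 : s'.a aPos = s.a aPos := (ha.a _ rfl).trans (by rw [aa])
      have b1 : s'.a aIn = s.a aIn := (ha.a _ rfl).trans (by rw [aa])
      have b2 : s'.a aStart = s.a aStart := (ha.a _ rfl).trans (by rw [aa])
      have b3 : s'.v 8 = v := (ha.v _ rfl).trans a8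
      have e : (topBody.run (s'.setv 9 j)).v 5 =
          if s'.v 5 - s.a aPos u = 0 then s'.v 5 else s.a aPos u := by
        simp [topBody, b0, b1, b2, b3, hu]
      rw [e]
      split_ifs with hlt
      · refine ⟨i1, i2, fun k hk => ?_⟩
        rcases Nat.lt_succ_iff_lt_or_eq.1 hk with hk | rfl
        · exact i3 k hk
        · rw [hu]; omega
      · refine ⟨by omega, Or.inr ⟨u, hvu, rfl⟩, fun k hk => ?_⟩
        rcases Nat.lt_succ_iff_lt_or_eq.1 hk with hk | rfl
        · have := i3 k hk; omega
        · rw [hu])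
  set s₂ := (forto 9 (get aIn (add (lit 1) (var 8))) topBody).run s₁ with hs₂
  have c8 : s₂.v 8 = v := (Cmd.run_v _ _ rfl).trans a8
  have c6 : s₂.v 6 = i + 1 := (Cmd.run_v _ _ rfl).trans a6
  have c7 : s₂.v 7 = i := (Cmd.run_v _ _ rfl).trans a7
  have ca : ∀ b, s₂.a b = s.a b := fun b =>
    (Cmd.run_a (forto 9 (get aIn (add (lit 1) (var 8))) topBody) s₁ (b := b) rfl).trans (by rw [aa])
  obtain ⟨⟨g1, g2, g3⟩, g4⟩ := forto_spec (x := 9) (e := get aIn (add (lit 1) (var 8)))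
    (c := nameBody) (s := s₂) (k := s.a aIn (1 + v)) (by simp [c8, ca])
    (fun j s' => s'.v 6 ≤ i + 1 ∧
      (s'.v 6 = i + 1 ∨ s₂.v 5 < s'.v 6 ∧ ∃ u, G.Adj v u ∧ s.a aPos u = s'.v 6) ∧
      ∀ k < j, s₂.v 5 < s.a aPos (s.a aIn (s.a aStart v + k)) →
        s'.v 6 ≤ s.a aPos (s.a aIn (s.a aStart v + k)))
    100 ⟨c6.le, Or.inl c6, by simp⟩ (by
      rintro j hj s' ha - ⟨i1, i2, i3⟩
      refine ⟨?_, cost_le rfl _⟩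
      obtain ⟨u, hvu, hu⟩ := hr.adj v j hj
      have b0 : s'.a aPos = s.a aPos := (ha.a _ rfl).trans (ca _)
      have b1 : s'.a aIn = s.a aIn := (ha.a _ rfl).trans (ca _)
      have b2 : s'.a aStart = s.a aStart := (ha.a _ rfl).trans (ca _)
      have b3 : s'.v 8 = v := (ha.v _ rfl).trans c8
      have b4 : s'.v 5 = s₂.v 5 := ha.v _ rfl
      have e : (nameBody.run (s'.setv 9 j)).v 6 =
          if s.a aPos u - s₂.v 5 = 0 then s'.v 6
            else if s'.v 6 - s.a aPos u = 0 then s'.v 6 else s.a aPos u := by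
        simp [nameBody, b0, b1, b2, b3, b4, hu]
      rw [e]
      split_ifs with h1 h2
      · refine ⟨i1, i2, fun k hk => ?_⟩
        rcases Nat.lt_succ_iff_lt_or_eq.1 hk with hk | rfl
        · exact i3 k hk
        · rw [hu]; omega
      · refine ⟨i1, i2, fun k hk => ?_⟩
        rcases Nat.lt_succ_iff_lt_or_eq.1 hk with hk | rfl
        · exact i3 k hk
        · rw [hu]; omega
      · refine ⟨by omega, Or.inr ⟨by omega, u, hvu, rfl⟩, fun k hk => ?_⟩
        rcases Nat.lt_succ_iff_lt_or_eq.1 hk with hk | rfl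
        · have := i3 k hk; omega
        · rw [hu]; omega)
  set s₃ := (forto 9 (get aIn (add (lit 1) (var 8))) nameBody).run s₂ with hs₃
  have d5 : s₃.v 5 = s₂.v 5 := Cmd.run_v _ _ rfl
  have d7 : s₃.v 7 = i := (Cmd.run_v _ _ rfl).trans c7
  have dp : s₃.a aPar = s.a aPar := (Cmd.run_a _ _ rfl).trans (ca _)
  have hrun : parentBody.run (s.setv 7 i) = linkCmd.run s₃ := rfl
  have ne : ∀ u, G.Adj v u → s.a aPos u ≠ i + 1 := fun u hvu e =>
    hvu.ne (hinj v u (hv.trans e.symm))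
  have h3' : ∀ u, G.Adj v u → s₂.v 5 ≤ s.a aPos u := fun u hvu => by
    obtain ⟨k, hk, hku⟩ := hr.exists_eq v u hvu
    have := h3 k hk
    rwa [hku] at this
  have g3' : ∀ u, G.Adj v u → s₂.v 5 < s.a aPos u → s₃.v 6 ≤ s.a aPos u := fun u hvu => by
    obtain ⟨k, hk, hku⟩ := hr.exists_eq v u hvu
    have := g3 k hk
    rwa [hku] at this
  constructor
  · refine ⟨if s₂.v 5 = i + 1 then 0 else s₂.v 5, s₃.v 6, ?_, ?_, ?_⟩
    · rw [hrun]
      have hne : i + 1 - s₂.v 5 = 0 ↔ s₂.v 5 = i + 1 := by omega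
      have he : i + i + 2 = 2 * (i + 1) := by ring
      by_cases h : s₂.v 5 = i + 1
      · simp [linkCmd, d5, d7, dp, h, he, two_mul]
      · simp [linkCmd, d5, d7, dp, hne, h, he, two_mul]
    · by_cases h : s₂.v 5 = i + 1
      · rw [if_pos h]
        exact Or.inl ⟨rfl, fun u hvu => by have := h3' u hvu; have := ne u hvu; omega⟩
      · rw [if_neg h]
        rcases h2 with h2 | ⟨u, hvu, hu⟩
        · exact absurd h2 h
        · exact Or.inr ⟨u, hvu, hu, by omega, h3'⟩
    · refine ⟨by omega, ?_, ?_, fun u hvu hu => ?_⟩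
      · split_ifs <;> omega
      · rcases g2 with g2 | ⟨-, g2⟩
        · left; omega
        · exact Or.inr g2
      · have := ne u hvu
        have := h3' u hvu
        by_cases h : s₂.v 5 = i + 1
        · omega
        · rw [if_neg h] at hu
          exact g3' u hvu hu
  · have hm := Nat.mul_le_mul_right 106 (hr.deg_le v)
    have k1 : topInit.cost (s.setv 7 i) ≤ 60 := cost_le rfl _
    have k2 : linkCmd.cost s₃ ≤ 180 := cost_le rfl _
    have hc : parentBody.cost (s.setv 7 i) = topInit.cost (s.setv 7 i) +
      ((forto 9 (get aIn (add (lit 1) (var 8))) topBody).cost s₁ +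
        ((forto 9 (get aIn (add (lit 1) (var 8))) nameBody).cost s₂ + linkCmd.cost s₃)) := rfl
    simp only [Exp.cost] at h4 g4
    omega

/-- The two least positions in the adjacency list of each vertex determine the tree of vertices and
blocks. -/
theorem parentCmd_spec [DecidableRel G.Adj] (hG : IsBlockGraph G) (hn : 0 < n) {Δ : ℕ}
    {s : Store} (hr : Reads G Δ s)
    (hf : IsFound G (s.a aPos) (s.a aOrd) n) (hall : ∀ v : Fin n, s.a aPos v ≠ 0) :
    (∃ (tp rp : Fin n → ℕ) (vx : ℕ → Fin n), IsBlockTree G (fun v : Fin n => s.a aPos v) tp rp n vx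
      ((parentCmd.run s).a aPar)) ∧ parentCmd.cost s ≤ 10 + n * (306 + Δ * 212) := by
  have hso := hf.isSearchOrder hall
  obtain ⟨h1, h2⟩ := forto_spec (x := 7) (e := var 0) (c := parentBody) (s := s) (k := n)
    hr.size
    (fun i s' => ∀ v : Fin n, s.a aPos v ≤ i → ∃ a b, s'.a aPar (2 * s.a aPos v + 1) = 2 * b ∧
      s'.a aPar (2 * s.a aPos v) = 2 * a + 1 ∧ IsTopName G (s.a aPos) v a b)
    (300 + Δ * 212) (fun v hv => absurd (Nat.le_zero.1 hv) (hall v)) (by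
      rintro i hi s' ha - i1
      have hr' : Reads G Δ s' := hr.congr (ha.v _ rfl) (ha.v _ rfl) (ha.a _ rfl) (ha.a _ rfl)
      have b0 : s'.a aPos = s.a aPos := ha.a _ rfl
      have b1 : s'.a aOrd = s.a aOrd := ha.a _ rfl
      obtain ⟨v, hv⟩ := hf.exists_eq (i + 1) (by omega) (by omega)
      have hov := hf.ord v (hall v)
      rw [hv] at hov
      obtain ⟨⟨a, b, k1, k2⟩, k3⟩ := parentBody_spec (i := i) hr'
        (fun u w huw => hso.inj (by rwa [b0] at huw)) (v := v) (by rw [b0, hv]) (by rw [b1, hov])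
      refine ⟨fun u hu => ?_, k3⟩
      rw [k1]
      rw [b0] at k2
      rcases Nat.lt_succ_iff_lt_or_eq.1 (Nat.lt_succ_of_le hu) with hlt | heq
      · rw [Function.update_of_ne (by omega), Function.update_of_ne (by omega),
          Function.update_of_ne (by omega), Function.update_of_ne (by omega)]
        exact i1 u (by omega)
      · obtain rfl : u = v := hso.inj (heq.trans hv.symm)
        refine ⟨a, b, ?_, ?_, k2⟩
        · rw [heq, Function.update_of_ne (by omega), Function.update_self]
        · rw [heq, Function.update_self])
  refine ⟨?_, h2.trans ?_⟩
  rotate_left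
  · rw [Nat.add_right_comm 300]
    exact Nat.add_le_add_right (by decide) _
  choose tp rp k1 k2 k3 using fun v : Fin n => h1 v (hf.le v)
  have hvx : ∀ i, ∃ v : Fin n, 1 ≤ i → i ≤ n → s.a aPos v = i := fun i => by
    by_cases hi : 1 ≤ i ∧ i ≤ n
    · obtain ⟨v, hv⟩ := hf.exists_eq i hi.1 hi.2
      exact ⟨v, fun _ _ => hv⟩
    · exact ⟨⟨0, hn⟩, fun h h' => absurd ⟨h, h'⟩ hi⟩
  choose vx hvx using hvx
  exact ⟨tp, rp, vx, hso.isBlockOrder hG (fun v => (k3 v).top) (fun v => (k3 v).name),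
    hso.one_le_pos, hf.le, hvx, k1, k2⟩

end

/-! ### Gains and rules -/

/-- The gain of adding a leaf to a star with `k` leaves, multiplied by `N!`. -/
def gain (N k : ℕ) : ℕ := 2 * ∏ j ∈ range N, if j = k ∨ j = k + 1 then 1 else j + 1

theorem gain_eq {N k : ℕ} (hk : k + 1 < N) :
    (gain N k : ℚ) = (Nat.factorial N : ℕ) * (starVal (k + 1) - starVal k) := by
  have h1 : k ∈ range N := by simp; omega
  have h2 : k + 1 ∈ (range N).erase k := by simp; omega
  have h3 : ∏ j ∈ range N, (if j = k ∨ j = k + 1 then 1 else j + 1) =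
      ∏ j ∈ ((range N).erase k).erase (k + 1), (j + 1) := by
    rw [← mul_prod_erase _ _ h1, ← mul_prod_erase _ _ h2]
    simp only [true_or, or_true, if_true, one_mul]
    refine prod_congr rfl fun j hj => if_neg ?_
    rw [mem_erase, mem_erase] at hj
    exact fun h => h.elim hj.2.1 hj.1
  rw [starVal_succ_sub, gain, h3, ← prod_range_add_one_eq_factorial, ← mul_prod_erase _ _ h1,
    ← mul_prod_erase _ _ h2]
  push_cast
  have : (k : ℚ) + 1 ≠ 0 := by positivity
  have : (k : ℚ) + 2 ≠ 0 := by positivity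
  have : (k : ℚ) + 1 + 1 ≠ 0 := by positivity
  field_simp
  ring

/-- Multiply the variable `4` by the number after the variable `3`, by repeated addition. -/
def mulCmd : Cmd :=
  set 5 (lit 0) ;; forto 6 (add (var 3) (lit 1)) (set 5 (add (var 5) (var 4))) ;; set 4 (var 5)

/-- Multiply the variable `4` by the next factor of the gain. -/
def factorBody : Cmd :=
  ite (add (sub (var 3) (var 2)) (sub (var 2) (var 3)))
    (ite (add (sub (var 3) (add (var 2) (lit 1))) (sub (add (var 2) (lit 1)) (var 3)))
      mulCmd skip) skip

/-- Compute one gain. -/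
def gainBody : Cmd :=
  set 4 (lit 2) ;; forto 3 (add (var 1) (lit 2)) factorBody ;; put aGain (var 2) (var 4)

/-- Compute the gains of adding a leaf to a star, for stars with at most `Δ` leaves. -/
def gainCmd : Cmd := forto 2 (add (var 1) (lit 1)) gainBody

theorem mulCmd_spec (s : Store) : (mulCmd.run s).v 4 = s.v 4 * (s.v 3 + 1) ∧
    mulCmd.cost s ≤ 20 + (s.v 3 + 1) * 20 := by
  obtain ⟨⟨h1, h2⟩, h3⟩ := forto_spec (x := 6) (e := add (var 3) (lit 1))
    (c := set 5 (add (var 5) (var 4))) (s := s.setv 5 0) (k := s.v 3 + 1) (by simp)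
    (fun i s' => s'.v 5 = s.v 4 * i ∧ s'.v 4 = s.v 4) 10 ⟨by simp, by simp⟩ (by
      rintro i hi s' ha - ⟨i1, i2⟩
      refine ⟨⟨?_, ?_⟩, cost_le rfl _⟩
      · simp [i1, i2, mul_add]
      · simp [i2])
  refine ⟨?_, ?_⟩
  · simp only [mulCmd, run_seq, run_set, Exp.eval, Store.setv_v, if_true]
    exact h1
  · have : mulCmd.cost s = 3 + ((forto 6 (add (var 3) (lit 1)) (set 5 (add (var 5) (var 4)))).cost
      (s.setv 5 0) + 4) := rfl
    simp only [Exp.cost] at h3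
    omega

theorem gainBody_spec {Δ k : ℕ} {s : Store} (hs : s.v 1 = Δ) (hk : s.v 2 = k) :
    (gainBody.run s).a aGain = Function.update (s.a aGain) k (gain (Δ + 2) k) ∧
      gainBody.cost s ≤ 50 + (Δ + 2) * (66 + (Δ + 2) * 20) := by
  obtain ⟨h1, h3⟩ := forto_spec (x := 3) (e := add (var 1) (lit 2))
    (c := factorBody) (s := s.setv 4 2) (k := Δ + 2) (by simp [hs])
    (fun i s' => s'.v 4 = 2 * ∏ j ∈ range i, if j = k ∨ j = k + 1 then 1 else j + 1)
    (60 + (Δ + 2) * 20) (by simp) (by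
      rintro i hi s' ha - i1
      have a2 : s'.v 2 = k := (ha.v 2 rfl).trans (by simp [hk])
      obtain ⟨m1, m2⟩ := mulCmd_spec (s'.setv 3 i)
      simp only [Store.setv_v, if_true] at m1 m2
      have c1 : i - k + (k - i) = 0 ↔ i = k := by omega
      have c2 : i - (k + 1) + (k + 1 - i) = 0 ↔ i = k + 1 := by omega
      have hm : (i + 1) * 20 ≤ (Δ + 2) * 20 := Nat.mul_le_mul_right _ (by omega)
      rw [prod_range_succ, ← mul_assoc, ← i1]
      simp only [factorBody, run_ite, run_skip, Cmd.cost, Exp.cost, Exp.eval, Store.setv_v, if_true,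
        a2, Ne, show ¬ (2 = 3) by omega, if_false, c1, c2]
      by_cases e1 : i = k
      · simp [e1]; omega
      by_cases e2 : i = k + 1
      · simp [e2]; omega
      simp only [e1, e2, not_false_eq_true, if_true, or_self, if_false]
      refine ⟨by simpa using m1, by omega⟩)
  have e2 : ((forto 3 (add (var 1) (lit 2)) factorBody).run (s.setv 4 2)).v 2 = k :=
    (Cmd.run_v _ _ rfl).trans (by simp [hk])
  have e3 : ((forto 3 (add (var 1) (lit 2)) factorBody).run (s.setv 4 2)).a aGain = s.a aGain :=
    Cmd.run_a _ _ rfl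
  refine ⟨?_, ?_⟩
  · have hrun : gainBody.run s = (put aGain (var 2) (var 4)).run
      ((forto 3 (add (var 1) (lit 2)) factorBody).run (s.setv 4 2)) := rfl
    rw [hrun, run_put]
    simp only [Exp.eval, Store.seta_a, if_true, e2, e3, h1, gain]
  · have : gainBody.cost s = 3 + ((forto 3 (add (var 1) (lit 2)) factorBody).cost (s.setv 4 2) +
      13) := rfl
    simp only [Exp.cost] at h3
    have : (Δ + 2) * (60 + (Δ + 2) * 20 + 6) = (Δ + 2) * (66 + (Δ + 2) * 20) := by ring
    omega

theorem gainCmd_spec {Δ : ℕ} {s : Store} (hs : s.v 1 = Δ) :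
    (∀ k < Δ + 1, (gainCmd.run s).a aGain k = gain (Δ + 2) k) ∧
      gainCmd.cost s ≤ 10 + (Δ + 1) * (56 + (Δ + 2) * (66 + (Δ + 2) * 20)) := by
  obtain ⟨h1, h3⟩ := forto_spec (x := 2) (e := add (var 1) (lit 1))
    (c := gainBody) (s := s) (k := Δ + 1) (by simp [hs])
    (fun i s' => ∀ k < i, s'.a aGain k = gain (Δ + 2) k)
    (50 + (Δ + 2) * (66 + (Δ + 2) * 20)) (by simp) (by
      rintro i hi s' ha - i1
      obtain ⟨k1, k2⟩ := gainBody_spec (Δ := Δ) (k := i) (s := s'.setv 2 i)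
        ((ha.v 1 rfl).trans hs) (by simp)
      refine ⟨fun k hk => ?_, k2⟩
      rw [k1, Function.update_apply]
      split_ifs with e
      · rw [e]
      · exact i1 k (by omega))
  refine ⟨h1, h3.trans ?_⟩
  have : 50 + (Δ + 2) * (66 + (Δ + 2) * 20) + 6 = 56 + (Δ + 2) * (66 + (Δ + 2) * 20) := by ring
  rw [this]
  exact Nat.add_le_add_right (by decide) _

/-- A rule whose components are given by expressions. -/
structure Template where
  /-- state of the parent before the merge -/
  x : Exp
  /-- state of the child before the merge -/
  y : Exp
  /-- state of the parent after the merge -/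
  z : Exp
  /-- gain -/
  w : Exp
  /-- kind -/
  j : ℕ

/-- The rule described by a template. -/
def Template.eval (t : Template) (s : Store) : Rule :=
  ⟨t.x.eval s, t.y.eval s, t.z.eval s, t.w.eval s, t.j⟩

/-- The rule in line `q` of the list of rules. -/
def ruleAt (s : Store) (q : ℕ) : Rule := ⟨s.a aX q, s.a aY q, s.a aZ q, s.a aW q, s.a aJ q⟩

/-- The expression depends only on the variable `2` and on the gains. -/
def IsStable (e : Exp) : Prop :=
  ∀ s s' : Store, s'.v 2 = s.v 2 → s'.a aGain = s.a aGain → e.eval s' = e.eval s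

/-- All expressions of the template are stable. -/
def Template.IsStable (t : Template) : Prop :=
  FHG.IsStable t.x ∧ FHG.IsStable t.y ∧ FHG.IsStable t.z ∧ FHG.IsStable t.w

/-- Append one rule to the list of rules, whose length is in the variable `7`. -/
def appendRule (t : Template) : Cmd :=
  put aX (var 7) t.x ;; put aY (var 7) t.y ;; put aZ (var 7) t.z ;; put aW (var 7) t.w ;;
  put aJ (var 7) (lit t.j) ;; set 7 (add (var 7) (lit 1))

/-- Append rules to the list of rules. -/
def appendRules : List Template → Cmd
  | [] => skip
  | t :: L => appendRule t ;; appendRules L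

/-- The list of rules has length `N` and consists of the rules with the property `R`. -/
def Lists (s : Store) (N : ℕ) (R : Rule → Prop) : Prop :=
  s.v 7 = N ∧ ∀ r, R r ↔ ∃ q < N, ruleAt s q = r

theorem Lists.congr {s : Store} {N : ℕ} {R R' : Rule → Prop} (h : Lists s N R)
    (hR : ∀ r, R' r ↔ R r) : Lists s N R' :=
  ⟨h.1, fun r => (hR r).trans (h.2 r)⟩

theorem appendRule_spec {s : Store} {N : ℕ} {R : Rule → Prop} (h : Lists s N R) (t : Template)
    (ht : t.IsStable) : Lists ((appendRule t).run s) (N + 1) (fun r => R r ∨ t.eval s = r) ∧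
      ((appendRule t).run s).v 2 = s.v 2 ∧ ((appendRule t).run s).a aGain = s.a aGain := by
  obtain ⟨h0, h1⟩ := h
  obtain ⟨hx, hy, hz, hw⟩ := ht
  have eX : ((appendRule t).run s).a aX = Function.update (s.a aX) N (t.x.eval s) := by
    simp [appendRule, h0]
  have eY : ((appendRule t).run s).a aY = Function.update (s.a aY) N (t.y.eval s) := by
    simp only [appendRule, run_seq, run_put, run_set, Store.setv_a]
    rw [hy s]
    all_goals simp [h0]
  have eZ : ((appendRule t).run s).a aZ = Function.update (s.a aZ) N (t.z.eval s) := by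
    simp only [appendRule, run_seq, run_put, run_set, Store.setv_a]
    rw [hz s]
    all_goals simp [h0]
  have eW : ((appendRule t).run s).a aW = Function.update (s.a aW) N (t.w.eval s) := by
    simp only [appendRule, run_seq, run_put, run_set, Store.setv_a]
    rw [hw s]
    all_goals simp [h0]
  have eJ : ((appendRule t).run s).a aJ = Function.update (s.a aJ) N t.j := by
    simp [appendRule, h0]
  refine ⟨⟨by simp [appendRule, h0], fun r => ?_⟩, by simp [appendRule], by simp [appendRule]⟩
  have e1 : ∀ q < N, ruleAt ((appendRule t).run s) q = ruleAt s q := fun q hq => by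
    simp only [ruleAt, eX, eY, eZ, eW, eJ, Function.update_of_ne hq.ne]
  have e2 : ruleAt ((appendRule t).run s) N = t.eval s := by
    simp only [ruleAt, eX, eY, eZ, eW, eJ, Function.update_self, Template.eval]
  simp only [h1]
  constructor
  · rintro (⟨q, hq, rfl⟩ | rfl)
    · exact ⟨q, by omega, e1 q hq⟩
    · exact ⟨N, by omega, e2⟩
  · rintro ⟨q, hq, rfl⟩
    rcases Nat.lt_succ_iff_lt_or_eq.1 hq with hq | rfl
    · exact Or.inl ⟨q, hq, (e1 q hq).symm⟩
    · exact Or.inr e2.symm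

theorem appendRules_spec {s : Store} {N : ℕ} {R : Rule → Prop} (h : Lists s N R)
    (L : List Template) (hL : ∀ t ∈ L, t.IsStable) :
    Lists ((appendRules L).run s) (N + L.length) (fun r => R r ∨ ∃ t ∈ L, t.eval s = r) := by
  induction L generalizing s N R with
  | nil => exact h.congr (by simp)
  | cons t L ih =>
    obtain ⟨h1, h2, h3⟩ := appendRule_spec h t (hL t (by simp))
    have h4 := ih h1 fun t' ht' => hL t' (by simp [ht'])
    have he : ∀ t' ∈ L, t'.eval ((appendRule t).run s) = t'.eval s := fun t' ht' => by
      obtain ⟨hx, hy, hz, hw⟩ := hL t' (by simp [ht'])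
      simp only [Template.eval, hx _ _ h2 h3, hy _ _ h2 h3, hz _ _ h2 h3, hw _ _ h2 h3]
    rw [List.length_cons, show N + (L.length + 1) = N + 1 + L.length by ring]
    refine h4.congr fun r => ?_
    rw [or_assoc]
    refine or_congr Iff.rfl ?_
    constructor
    · rintro ⟨t', ht', rfl⟩
      rcases List.mem_cons.1 ht' with rfl | ht'
      · exact Or.inl rfl
      · exact Or.inr ⟨t', ht', he t' ht'⟩
    · rintro (rfl | ⟨t', ht', rfl⟩)
      · exact ⟨t, by simp, rfl⟩
      · exact ⟨t', by simp [ht'], (he t' ht').symm⟩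

theorem appendLoop_spec {s : Store} {N : ℕ} {R : Rule → Prop} (h : Lists s N R)
    (L : List Template) (hL : ∀ t ∈ L, t.IsStable) {B k : ℕ} {e : Exp} (hk : e.eval s = k)
    (hB : ((appendRules L).loopFree && (appendRules L).bound.ble B) = true)
    (hg : (forto 2 e (appendRules L)).writesArray aGain = false) :
    Lists ((forto 2 e (appendRules L)).run s) (N + k * L.length)
      (fun r => R r ∨ ∃ m < k, ∃ t ∈ L, t.eval (s.setv 2 m) = r) ∧
      (forto 2 e (appendRules L)).cost s ≤ e.cost + 2 + k * (B + 6) := by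
  have h0 : Lists s (N + 0 * L.length)
      (fun r => R r ∨ ∃ m < 0, ∃ t ∈ L, t.eval (s.setv 2 m) = r) := by
    rw [Nat.zero_mul, Nat.add_zero]
    exact h.congr (by simp)
  refine forto_spec hk (fun i s' => Lists s' (N + i * L.length)
      (fun r => R r ∨ ∃ m < i, ∃ t ∈ L, t.eval (s.setv 2 m) = r)) B h0 ?_
  rintro i hi s' ha - i1
  have i2 : Lists (s'.setv 2 i) _ _ := ⟨(by simp : (s'.setv 2 i).v 7 = s'.v 7).trans i1.1, i1.2⟩
  refine ⟨?_, cost_le hB _⟩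
  rw [Nat.succ_mul, ← add_assoc]
  refine (appendRules_spec i2 L hL).congr fun r => ?_
  have he : ∀ t ∈ L, t.eval (s'.setv 2 i) = t.eval (s.setv 2 i) := fun t ht => by
    obtain ⟨hx, hy, hz, hw⟩ := hL t ht
    have h2 : (s'.setv 2 i).v 2 = (s.setv 2 i).v 2 := by simp
    have h3 : (s'.setv 2 i).a aGain = (s.setv 2 i).a aGain := ha.a aGain hg
    simp only [Template.eval, hx _ _ h2 h3, hy _ _ h2 h3, hz _ _ h2 h3, hw _ _ h2 h3]
  rw [or_assoc]
  refine or_congr Iff.rfl ?_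
  constructor
  · rintro ⟨m, hm, t, ht, rfl⟩
    rcases Nat.lt_succ_iff_lt_or_eq.1 hm with hm | rfl
    · exact Or.inl ⟨m, hm, t, ht, rfl⟩
    · exact Or.inr ⟨t, ht, he t ht⟩
  · rintro (⟨m, hm, t, ht, rfl⟩ | ⟨t, ht, rfl⟩)
    · exact ⟨m, by omega, t, ht, rfl⟩
    · exact ⟨i, by omega, t, ht, (he t ht).symm⟩

/-- The rules that leave the states as they are. -/
def skipRules : List Template :=
  [⟨lit 0, add (lit 4) (var 2), lit 0, lit 0, 0⟩, ⟨lit 1, add (lit 4) (var 2), lit 1, lit 0, 0⟩,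
    ⟨lit 2, add (lit 4) (var 2), lit 2, lit 0, 0⟩, ⟨lit 3, add (lit 4) (var 2), lit 3, lit 0, 0⟩,
    ⟨add (lit 4) (var 2), lit 1, add (lit 4) (var 2), lit 0, 0⟩,
    ⟨add (lit 4) (var 2), lit 2, add (lit 4) (var 2), lit 0, 0⟩,
    ⟨add (lit 4) (var 2), lit 3, add (lit 4) (var 2), lit 0, 0⟩]

/-- The rules that add a leaf to a star. -/
def starRules : List Template :=
  [⟨lit 1, add (lit 5) (var 2), lit 0, get aGain (var 2), 1⟩,
    ⟨lit 2, add (lit 5) (var 2), lit 1, get aGain (var 2), 2⟩,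
    ⟨add (lit 5) (var 2), lit 2, add (lit 6) (var 2), get aGain (var 2), 1⟩]

/-- The other rules. -/
def cliqueRules : List Template :=
  [⟨lit 1, lit 5, lit 2, lit 0, 1⟩, ⟨lit 2, lit 5, lit 3, get aGain (lit 0), 1⟩,
    ⟨lit 3, lit 5, lit 3, get aGain (lit 0), 1⟩, ⟨lit 0, lit 5, lit 1, lit 0, 2⟩,
    ⟨lit 5, lit 2, lit 4, get aGain (lit 0), 1⟩, ⟨lit 5, lit 3, lit 4, get aGain (lit 0), 1⟩,
    ⟨lit 5, lit 0, lit 4, lit 0, 1⟩]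

/-- Make the list of rules. -/
def rulesCmd : Cmd :=
  set 7 (lit 0) ;; forto 2 (add (var 1) (lit 3)) (appendRules skipRules) ;;
  forto 2 (add (var 1) (lit 1)) (appendRules starRules) ;; appendRules cliqueRules

/-- There are `7 * (Δ + 3)` rules that keep the states, `3 * (Δ + 1)` rules for stars, and `7` others. -/
theorem rulesCmd_spec {Δ : ℕ} {s : Store} (hs : s.v 1 = Δ) :
    Lists (rulesCmd.run s) (10 * Δ + 31) (IsRule (Δ + 1) (s.a aGain)) ∧
      rulesCmd.cost s ≤ 1500 * Δ + 5000 := by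
  have hst : ∀ L ∈ [skipRules, starRules, cliqueRules], ∀ t ∈ L, t.IsStable := by
    simp only [skipRules, starRules, cliqueRules, List.forall_mem_cons, Template.IsStable, IsStable]
    simp +contextual
  have h0 : Lists (s.setv 7 0) 0 (fun _ => False) := ⟨by simp, by simp⟩
  obtain ⟨h1, c1⟩ := appendLoop_spec (B := 1000) h0 skipRules (hst _ (by simp)) (k := Δ + 3)
    (e := add (var 1) (lit 3)) (by simp [hs]) rfl rfl
  set s₁ := (forto 2 (add (var 1) (lit 3)) (appendRules skipRules)).run (s.setv 7 0) with hs₁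
  have g1 : s₁.a aGain = s.a aGain := Cmd.run_a _ _ rfl
  have v1 : s₁.v 1 = Δ := (Cmd.run_v _ _ rfl).trans hs
  obtain ⟨h2, c2⟩ := appendLoop_spec (B := 400) h1 starRules (hst _ (by simp)) (k := Δ + 1)
    (e := add (var 1) (lit 1)) (by simp [v1]) rfl rfl
  set s₂ := (forto 2 (add (var 1) (lit 1)) (appendRules starRules)).run s₁ with hs₂
  have g2 : s₂.a aGain = s.a aGain := (Cmd.run_a _ _ rfl).trans g1
  have h3 := appendRules_spec h2 cliqueRules (hst _ (by simp))
  refine ⟨?_, ?_⟩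
  · have hN : 0 + (Δ + 3) * skipRules.length + (Δ + 1) * starRules.length + cliqueRules.length =
        10 * Δ + 31 := by simp [skipRules, starRules, cliqueRules]; ring
    rw [hN] at h3
    refine h3.congr fun r => ?_
    constructor
    · rintro h
      cases h with
      | skipVertex m b hm hb =>
        refine Or.inl (Or.inl (Or.inr ⟨m, by omega, ?_⟩))
        interval_cases b <;> simp [skipRules, Template.eval]
      | skipBlock m b hm hb =>
        refine Or.inl (Or.inl (Or.inr ⟨m, by omega, ?_⟩))
        interval_cases b <;> simp [skipRules, Template.eval]
      | promise k hk =>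
        refine Or.inl (Or.inr ⟨k, by omega, ?_⟩)
        simp [starRules, Template.eval, g1]
      | absorb k hk =>
        refine Or.inl (Or.inr ⟨k, by omega, ?_⟩)
        simp [starRules, Template.eval, g1]
      | leafBelow k hk =>
        refine Or.inl (Or.inr ⟨k, by omega, ?_⟩)
        simp [starRules, Template.eval, g1]
      | _ =>
        refine Or.inr ?_
        simp [cliqueRules, Template.eval, g2]
    · rintro (((h | ⟨m, hm, h⟩) | ⟨m, hm, h⟩) | h)
      · exact h.elim
      · simp only [skipRules, List.mem_cons, List.not_mem_nil, or_false, exists_eq_or_imp,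
          exists_eq_left, Template.eval, Exp.eval, Store.setv_v, if_true] at h
        rcases h with rfl | rfl | rfl | rfl | rfl | rfl | rfl
        · exact .skipVertex m 0 (by omega) (by omega)
        · exact .skipVertex m 1 (by omega) (by omega)
        · exact .skipVertex m 2 (by omega) (by omega)
        · exact .skipVertex m 3 (by omega) (by omega)
        · exact .skipBlock m 0 (by omega) (by omega)
        · exact .skipBlock m 1 (by omega) (by omega)
        · exact .skipBlock m 2 (by omega) (by omega)
      · simp only [starRules, List.mem_cons, List.not_mem_nil, or_false, exists_eq_or_imp,
          exists_eq_left, Template.eval, Exp.eval, Store.setv_v, Store.setv_a, if_true, g1] at h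
        rcases h with rfl | rfl | rfl
        · exact .promise m hm
        · exact .absorb m hm
        · exact .leafBelow m hm
      · simp only [cliqueRules, List.mem_cons, List.not_mem_nil, or_false, exists_eq_or_imp,
          exists_eq_left, Template.eval, Exp.eval, g2] at h
        rcases h with rfl | rfl | rfl | rfl | rfl | rfl | rfl
        · exact .start
        · exact .second
        · exact .further
        · exact .fulfil
        · exact .topPair
        · exact .topClique
        · exact .topLeaf
  · have hc : rulesCmd.cost s =
      3 + ((forto 2 (add (var 1) (lit 3)) (appendRules skipRules)).cost (s.setv 7 0) +
      ((forto 2 (add (var 1) (lit 1)) (appendRules starRules)).cost s₁ +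
        (appendRules cliqueRules).cost s₂)) := rfl
    have h4 : (appendRules cliqueRules).cost s₂ ≤ 1000 := cost_le rfl _
    simp only [Exp.cost] at c1 c2
    omega

/-! ### The rows of the dynamic program -/

theorem row_inj {S c c' z z' : ℕ} (hz : z < S) (hz' : z' < S) :
    c * S + z = c' * S + z' ↔ c = c' ∧ z = z' := by
  refine ⟨fun h => ?_, fun h => by rw [h.1, h.2]⟩
  have hc : c = c' := by
    have h1 : (c * S + z) / S = (c' * S + z') / S := by rw [h]
    rwa [Nat.mul_comm, Nat.mul_add_div (by omega), Nat.mul_comm c', Nat.mul_add_div (by omega),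
      Nat.div_eq_of_lt hz, Nat.div_eq_of_lt hz', Nat.add_zero, Nat.add_zero] at h1
  subst hc
  exact ⟨rfl, by omega⟩

/-- Prepare the rows. -/
def rowInit : Cmd := set 8 (add (var 1) (lit 7)) ;; set 10 (lit 0)

/-- Make the rows of the two nodes of a position. -/
def rowBody : Cmd :=
  set 11 (add (var 9) (var 9)) ;;
  put aRow (var 11) (var 10) ;; put aVal (add (var 10) (lit 1)) (lit 1) ;;
  set 10 (add (var 10) (var 8)) ;;
  put aRow (add (var 11) (lit 1)) (var 10) ;; put aVal (add (var 10) (lit 5)) (lit 1) ;;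
  set 10 (add (var 10) (var 8))

/-- Make the row of the root. -/
def rowRoot : Cmd :=
  put aVal (add (get aRow (lit 1)) (lit 5)) (lit 0) ;;
  put aVal (add (get aRow (lit 1)) (lit 4)) (lit 1)

/-- Make the initial rows. -/
def rowCmd : Cmd := rowInit ;; forto 9 (add (var 0) (lit 1)) rowBody ;; rowRoot

theorem rowCmd_spec {n Δ : ℕ} {s : Store} (h0 : s.v 0 = n) (h1 : s.v 1 = Δ)
    (hval : ∀ i, s.a aVal i = 0) :
    ((rowCmd.run s).v 8 = Δ + 7 ∧ (∀ c < 2 * n + 2, (rowCmd.run s).a aRow c = c * (Δ + 7)) ∧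
      ∀ d, 1 ≤ d → d < 2 * n + 2 → ∀ z < Δ + 7,
        (rowCmd.run s).a aVal (d * (Δ + 7) + z) = if z = initState d then 1 else 0) ∧
      rowCmd.cost s ≤ 200 + (n + 1) * 206 := by
  obtain ⟨⟨i1, i2, i3⟩, c1⟩ := forto_spec (x := 9) (e := add (var 0) (lit 1)) (c := rowBody)
    (s := rowInit.run s) (k := n + 1) (by simp [rowInit, h0])
    (fun i s' => s'.v 10 = 2 * i * (Δ + 7) ∧ (∀ c < 2 * i, s'.a aRow c = c * (Δ + 7)) ∧
      ∀ c, ∀ z < Δ + 7, s'.a aVal (c * (Δ + 7) + z) =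
        if c < 2 * i ∧ z = (if c % 2 = 0 then 1 else 5) then 1 else 0)
    200 ⟨by simp [rowInit], by simp, by simp [rowInit, hval]⟩ (by
      rintro i hi s' ha - ⟨i1, i2, i3⟩
      refine ⟨?_, cost_le rfl _⟩
      have a8 : s'.v 8 = Δ + 7 := (ha.v 8 rfl).trans (by simp [rowInit, h1])
      have hii : i + i = 2 * i := by ring
      have hm : (2 * i + 1) * (Δ + 7) = 2 * i * (Δ + 7) + (Δ + 7) := by ring
      have e10 : (rowBody.run (s'.setv 9 i)).v 10 = 2 * (i + 1) * (Δ + 7) := by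
        simp [rowBody, i1, a8]; ring
      have eR : (rowBody.run (s'.setv 9 i)).a aRow = Function.update (Function.update (s'.a aRow)
          (2 * i) (2 * i * (Δ + 7))) (2 * i + 1) ((2 * i + 1) * (Δ + 7)) := by
        simp [rowBody, i1, a8, hii, hm]
      have eV : (rowBody.run (s'.setv 9 i)).a aVal = Function.update (Function.update (s'.a aVal)
          (2 * i * (Δ + 7) + 1) 1) ((2 * i + 1) * (Δ + 7) + 5) 1 := by
        simp [rowBody, i1, a8, hm]
      rw [e10, eR, eV]
      refine ⟨rfl, fun c hc => ?_, fun c z hz => ?_⟩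
      · rw [Function.update_apply, Function.update_apply]
        split_ifs with e1 e2
        · rw [e1]
        · rw [e2]
        · exact i2 c (by omega)
      · rw [Function.update_apply, Function.update_apply, i3 c z hz]
        simp only [row_inj hz (by omega : 5 < Δ + 7), row_inj hz (by omega : 1 < Δ + 7)]
        by_cases e1 : c = 2 * i + 1
        · subst e1
          have : (2 * i + 1) % 2 = 1 := by omega
          by_cases hz5 : z = 5
          · simp [hz5, this]; omega
          · simp [hz5, this]
        by_cases e2 : c = 2 * i
        · subst e2
          by_cases hz1 : z = 1
          · simp [hz1]
          · simp [hz1]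
        have : c < 2 * i ↔ c < 2 * (i + 1) := by omega
        simp [e1, e2, this])
  set s₁ := (forto 9 (add (var 0) (lit 1)) rowBody).run (rowInit.run s) with hs₁
  have v8 : s₁.v 8 = Δ + 7 := (Cmd.run_v _ _ rfl).trans (by simp [rowInit, h1])
  have hrun : rowCmd.run s = rowRoot.run s₁ := rfl
  have eR : (rowRoot.run s₁).a aRow = s₁.a aRow := by simp [rowRoot]
  have eV : (rowRoot.run s₁).a aVal = Function.update (Function.update (s₁.a aVal)
      (1 * (Δ + 7) + 5) 0) (1 * (Δ + 7) + 4) 1 := by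
    simp [rowRoot, i2 1 (by omega)]
  refine ⟨⟨?_, fun c hc => ?_, fun d hd hdn z hz => ?_⟩, ?_⟩
  · rw [hrun, Cmd.run_v _ _ rfl, v8]
  · rw [hrun, eR, i2 c (by omega)]
  · rw [hrun, eV, Function.update_apply, Function.update_apply, i3 d z hz, initState]
    simp only [row_inj hz (by omega : 4 < Δ + 7), row_inj hz (by omega : 5 < Δ + 7)]
    by_cases e1 : d = 1
    · subst e1
      by_cases e4 : z = 4
      · simp [e4]
      · by_cases e5 : z = 5 <;> simp [e4, e5]
    · have : d < 2 * (n + 1) := by omega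
      simp [e1, this]
  · have hc : rowCmd.cost s = rowInit.cost s +
      ((forto 9 (add (var 0) (lit 1)) rowBody).cost (rowInit.run s) + rowRoot.cost s₁) := rfl
    have k1 : rowInit.cost s ≤ 20 := cost_le rfl _
    have k2 : rowRoot.cost s₁ ≤ 100 := cost_le rfl _
    simp only [Exp.cost] at c1
    omega

/-- Prepare a merge. -/
def mergeInit : Cmd :=
  set 10 (sub (add (add (var 0) (var 0)) (lit 1)) (var 9)) ;; set 11 (get aRow (var 10)) ;;
  set 12 (get aRow (get aPar (var 10)))

/-- Clear an entry of the new row. -/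
def clearBody : Cmd := put aNew (var 13) (lit 0)

/-- Try one rule. -/
def tryBody : Cmd :=
  set 14 (get aVal (add (var 12) (get aX (var 13)))) ;;
  set 15 (get aVal (add (var 11) (get aY (var 13)))) ;;
  ite (var 14) (ite (var 15)
    (set 14 (add (add (var 14) (var 15)) (get aW (var 13))) ;;
      ite (sub (var 14) (get aNew (get aZ (var 13))))
        (put aNew (get aZ (var 13)) (var 14) ;;
          put aCh (add (var 11) (get aZ (var 13))) (var 13)) skip) skip) skip

/-- Copy an entry of the new row to the row of the parent. -/
def copyBody : Cmd := put aVal (add (var 12) (var 13)) (get aNew (var 13))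

/-- Merge one node into its parent. -/
def mergeBody : Cmd :=
  mergeInit ;; forto 13 (var 8) clearBody ;; forto 13 (var 7) tryBody ;; forto 13 (var 8) copyBody

/-- Merge all nodes, the last one first. -/
def mergeCmd : Cmd := forto 9 (add (var 0) (var 0)) mergeBody

/-- The rule `r` can be applied to the rows `a` of the parent and `b` of the child. -/
def Rule.Fits (r : Rule) (a b : ℕ → ℕ) : Prop := a r.x ≠ 0 ∧ b r.y ≠ 0

/-- The value obtained by the rule `r` from the rows `a` of the parent and `b` of the child. -/
def Rule.value (r : Rule) (a b : ℕ → ℕ) : ℕ := a r.x + b r.y + r.w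

/-- Trying all rules computes the maxima of their values, and for each of them a rule that attains it.
-/
theorem tryLoop_spec {S N c p : ℕ} {s : Store} (h7 : s.v 7 = N) (h11 : s.v 11 = c * S)
    (h12 : s.v 12 = p * S) (hz : ∀ q < N, (ruleAt s q).z < S) (hnew : ∀ z < S, s.a aNew z = 0)
    {a b : ℕ → ℕ} (ha : a = fun z => s.a aVal (p * S + z)) (hb : b = fun z => s.a aVal (c * S + z)) :
    ((∀ q < N, (ruleAt s q).Fits a b → (ruleAt s q).value a b ≤
        ((forto 13 (var 7) tryBody).run s).a aNew (ruleAt s q).z) ∧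
      (∀ z < S, ((forto 13 (var 7) tryBody).run s).a aNew z ≠ 0 →
        ∃ q < N, ((forto 13 (var 7) tryBody).run s).a aCh (c * S + z) = q ∧ (ruleAt s q).z = z ∧
          (ruleAt s q).Fits a b ∧
          ((forto 13 (var 7) tryBody).run s).a aNew z = (ruleAt s q).value a b) ∧
      ∀ x, (∀ z < S, x ≠ c * S + z) →
        ((forto 13 (var 7) tryBody).run s).a aCh x = s.a aCh x) ∧
      (forto 13 (var 7) tryBody).cost s ≤ 4 + N * 256 := by
  obtain ⟨h, hc⟩ := forto_spec (x := 13) (e := var 7) (c := tryBody) (s := s) (k := N) h7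
    (fun i s' => (∀ q < i, (ruleAt s q).Fits a b → (ruleAt s q).value a b ≤
        s'.a aNew (ruleAt s q).z) ∧
      (∀ z < S, s'.a aNew z ≠ 0 → ∃ q < i, s'.a aCh (c * S + z) = q ∧ (ruleAt s q).z = z ∧
        (ruleAt s q).Fits a b ∧ s'.a aNew z = (ruleAt s q).value a b) ∧
      ∀ x, (∀ z < S, x ≠ c * S + z) → s'.a aCh x = s.a aCh x)
    250 ⟨by simp, fun z hz h => absurd (hnew z hz) h, fun _ _ => rfl⟩ (by
      rintro i hi s' hag - ⟨i1, i2, i3⟩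
      refine ⟨?_, cost_le rfl _⟩
      have a11 : s'.v 11 = c * S := (hag.v _ rfl).trans h11
      have a12 : s'.v 12 = p * S := (hag.v _ rfl).trans h12
      have aV : s'.a aVal = s.a aVal := hag.a _ rfl
      have ax : s'.a aX = s.a aX := hag.a _ rfl
      have ay : s'.a aY = s.a aY := hag.a _ rfl
      have az : s'.a aZ = s.a aZ := hag.a _ rfl
      have aw : s'.a aW = s.a aW := hag.a _ rfl
      have rx : a (ruleAt s i).x = s.a aVal (p * S + s.a aX i) := by rw [ha]; rfl
      have ry : b (ruleAt s i).y = s.a aVal (c * S + s.a aY i) := by rw [hb]; rfl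
      have hzi : s.a aZ i < S := hz i hi
      -- nothing changes if the rule does not fit or is not better
      have hkeep : (¬ (ruleAt s i).Fits a b ∨ (ruleAt s i).value a b ≤ s'.a aNew (s.a aZ i)) →
          (tryBody.run (s'.setv 13 i)).a aNew = s'.a aNew ∧
            (tryBody.run (s'.setv 13 i)).a aCh = s'.a aCh := by
        intro h
        simp only [Rule.Fits, Rule.value, rx, ry] at h
        by_cases e1 : s.a aVal (p * S + s.a aX i) = 0
        · simp [tryBody, a11, a12, aV, ax, ay, e1]
        by_cases e2 : s.a aVal (c * S + s.a aY i) = 0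
        · simp [tryBody, a11, a12, aV, ax, ay, e1, e2]
        have h := h.resolve_left (fun hn => hn ⟨e1, e2⟩)
        have hw : (ruleAt s i).w = s.a aW i := rfl
        rw [hw] at h
        have e3 : s.a aVal (p * S + s.a aX i) + s.a aVal (c * S + s.a aY i) + s.a aW i -
            s'.a aNew (s.a aZ i) = 0 := by omega
        simp [tryBody, a11, a12, aV, ax, ay, az, aw, e1, e2, e3]
      by_cases hfit : (ruleAt s i).Fits a b
      · by_cases hle : (ruleAt s i).value a b ≤ s'.a aNew (s.a aZ i)
        · obtain ⟨k1, k2⟩ := hkeep (Or.inr hle)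
          rw [k1, k2]
          refine ⟨fun q hq hf => ?_, fun z hz h => ?_, i3⟩
          · rcases Nat.lt_succ_iff_lt_or_eq.1 hq with hq | rfl
            · exact i1 q hq hf
            · exact hle
          · obtain ⟨q, hq, h⟩ := i2 z hz h
            exact ⟨q, by omega, h⟩
        · have hfit' := hfit
          have hle' := hle
          simp only [Rule.Fits, Rule.value, rx, ry] at hfit' hle'
          have hw : (ruleAt s i).w = s.a aW i := rfl
          rw [hw] at hle'
          have e3 : ¬ s.a aVal (p * S + s.a aX i) + s.a aVal (c * S + s.a aY i) + s.a aW i -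
              s'.a aNew (s.a aZ i) = 0 := by omega
          have k1 : (tryBody.run (s'.setv 13 i)).a aNew =
              Function.update (s'.a aNew) (s.a aZ i) ((ruleAt s i).value a b) := by
            simp [tryBody, a11, a12, aV, ax, ay, az, aw, hfit'.1, hfit'.2, e3, Rule.value, rx, ry,
              hw]
          have k2 : (tryBody.run (s'.setv 13 i)).a aCh =
              Function.update (s'.a aCh) (c * S + s.a aZ i) i := by
            simp [tryBody, a11, a12, aV, ax, ay, az, aw, hfit'.1, hfit'.2, e3]
          rw [k1, k2]
          refine ⟨fun q hq hf => ?_, fun z hz h => ?_, fun x hx => ?_⟩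
          · rw [Function.update_apply]
            rcases Nat.lt_succ_iff_lt_or_eq.1 hq with hq | rfl
            · have := i1 q hq hf
              split_ifs with e
              · rw [e] at this; omega
              · exact this
            · exact le_of_eq (if_pos rfl).symm
          · by_cases e : z = s.a aZ i
            · subst e
              exact ⟨i, by omega, Function.update_self .., rfl, hfit, Function.update_self ..⟩
            · rw [Function.update_of_ne e] at h ⊢
              rw [Function.update_of_ne fun h' => e ((row_inj hz hzi).1 h').2]
              obtain ⟨q, hq, h⟩ := i2 z hz h
              exact ⟨q, by omega, h⟩
          · rw [Function.update_of_ne (hx _ hzi)]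
            exact i3 x hx
      · obtain ⟨k1, k2⟩ := hkeep (Or.inl hfit)
        rw [k1, k2]
        refine ⟨fun q hq hf => ?_, fun z hz h => ?_, i3⟩
        · rcases Nat.lt_succ_iff_lt_or_eq.1 hq with hq | rfl
          · exact i1 q hq hf
          · exact absurd hf hfit
        · obtain ⟨q, hq, h⟩ := i2 z hz h
          exact ⟨q, by omega, h⟩)
  exact ⟨h, hc.trans (by simp [Exp.cost])⟩

theorem mergeBody_spec {n S N i c p : ℕ} {s : Store} (h0 : s.v 0 = n) (h7 : s.v 7 = N)
    (h8 : s.v 8 = S) (hi : c + i = 2 * n + 1) (hp : s.a aPar c = p) (hrc : s.a aRow c = c * S)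
    (hrp : s.a aRow p = p * S) (hz : ∀ q < N, (ruleAt s q).z < S) {a b a' : ℕ → ℕ}
    (ha : a = fun z => s.a aVal (p * S + z)) (hb : b = fun z => s.a aVal (c * S + z))
    (ha' : a' = fun z => (mergeBody.run (s.setv 9 i)).a aVal (p * S + z)) :
    ((∀ q < N, (ruleAt s q).Fits a b → (ruleAt s q).value a b ≤ a' (ruleAt s q).z) ∧
      (∀ z < S, a' z ≠ 0 → ∃ q < N, (mergeBody.run (s.setv 9 i)).a aCh (c * S + z) = q ∧
        (ruleAt s q).z = z ∧ (ruleAt s q).Fits a b ∧ a' z = (ruleAt s q).value a b) ∧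
      (∀ x, (∀ z < S, x ≠ c * S + z) → (mergeBody.run (s.setv 9 i)).a aCh x = s.a aCh x) ∧
      ∀ x, (∀ z < S, x ≠ p * S + z) → (mergeBody.run (s.setv 9 i)).a aVal x = s.a aVal x) ∧
      mergeBody.cost (s.setv 9 i) ≤ 200 + S * 70 + N * 256 := by
  set s₁ := mergeInit.run (s.setv 9 i) with hs₁
  have b10 : n + n + 1 - i = c := by omega
  have b11 : s₁.v 11 = c * S := by simp [hs₁, mergeInit, h0, b10, hrc]
  have b12 : s₁.v 12 = p * S := by simp [hs₁, mergeInit, h0, b10, hp, hrp]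
  have b7 : s₁.v 7 = N := by simp [hs₁, mergeInit, h7]
  have b8 : s₁.v 8 = S := by simp [hs₁, mergeInit, h8]
  have ba : s₁.a = s.a := by simp [hs₁, mergeInit]
  obtain ⟨k1, k2⟩ := forto_spec (x := 13) (e := var 8) (c := clearBody) (s := s₁) (k := S) b8
    (fun i s' => ∀ z < i, s'.a aNew z = 0) 20 (by simp) (by
      rintro i hi s' hag - i1
      refine ⟨fun z hz => ?_, cost_le rfl _⟩
      have e : (clearBody.run (s'.setv 13 i)).a aNew = Function.update (s'.a aNew) i 0 := by
        simp [clearBody]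
      rw [e, Function.update_apply]
      split_ifs with h
      · rfl
      · exact i1 z (by omega))
  set s₂ := (forto 13 (var 8) clearBody).run s₁ with hs₂
  have d11 : s₂.v 11 = c * S := (Cmd.run_v _ _ rfl).trans b11
  have d12 : s₂.v 12 = p * S := (Cmd.run_v _ _ rfl).trans b12
  have d7 : s₂.v 7 = N := (Cmd.run_v _ _ rfl).trans b7
  have d8 : s₂.v 8 = S := (Cmd.run_v _ _ rfl).trans b8
  have da : ∀ b, b ≠ aNew → s₂.a b = s.a b := fun b hb =>
    (Cmd.run_a (forto 13 (var 8) clearBody) s₁ (by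
      simpa [Cmd.writesArray, clearBody] using hb.symm)).trans (by rw [ba])
  have dr : ∀ q, ruleAt s₂ q = ruleAt s q := fun q => by
    simp only [ruleAt, da aX (by decide), da aY (by decide), da aZ (by decide), da aW (by decide),
      da aJ (by decide)]
  obtain ⟨⟨t1, t2, t3⟩, t4⟩ := tryLoop_spec (s := s₂) (a := a) (b := b) d7 d11 d12
    (fun q hq => by rw [dr]; exact hz q hq) k1 (by rw [ha, da aVal (by decide)])
    (by rw [hb, da aVal (by decide)])
  simp only [dr] at t1 t2
  set s₃ := (forto 13 (var 7) tryBody).run s₂ with hs₃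
  have f12 : s₃.v 12 = p * S := (Cmd.run_v _ _ rfl).trans d12
  have f8 : s₃.v 8 = S := (Cmd.run_v _ _ rfl).trans d8
  have fV : s₃.a aVal = s.a aVal := (Cmd.run_a _ _ rfl).trans (da _ (by decide))
  obtain ⟨⟨g1, g2⟩, g3⟩ := forto_spec (x := 13) (e := var 8) (c := copyBody) (s := s₃) (k := S) f8
    (fun i s' => (∀ z < i, s'.a aVal (p * S + z) = s₃.a aNew z) ∧
      ∀ x, (∀ z < S, x ≠ p * S + z) → s'.a aVal x = s.a aVal x) 30
    ⟨by simp, fun _ _ => by rw [fV]⟩ (by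
      rintro i hi s' hag - ⟨i1, i2⟩
      refine ⟨?_, cost_le rfl _⟩
      have e : (copyBody.run (s'.setv 13 i)).a aVal =
          Function.update (s'.a aVal) (p * S + i) (s₃.a aNew i) := by
        simp [copyBody, hag.a aNew rfl, hag.v 12 rfl, f12]
      rw [e]
      refine ⟨fun z hz => ?_, fun x hx => ?_⟩
      · rw [Function.update_apply]
        split_ifs with h
        · rw [show z = i by omega]
        · exact i1 z (by omega)
      · rw [Function.update_of_ne (hx i hi)]
        exact i2 x hx)
  have hrun : mergeBody.run (s.setv 9 i) = (forto 13 (var 8) copyBody).run s₃ := rfl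
  have hch : (mergeBody.run (s.setv 9 i)).a aCh = s₃.a aCh := by
    rw [hrun]; exact Cmd.run_a _ _ rfl
  rw [← hrun] at g1 g2
  have hnew : ∀ z < S, a' z = s₃.a aNew z := fun z hz => by rw [ha']; exact g1 z hz
  refine ⟨⟨fun q hq hf => ?_, fun z hz h => ?_, fun x hx => ?_, g2⟩, ?_⟩
  · rw [hnew _ (hz q hq)]
    exact t1 q hq hf
  · rw [hnew z hz] at h ⊢
    rw [hch]
    exact t2 z hz h
  · rw [hch, t3 x hx, da _ (by decide)]
  · have hc : mergeBody.cost (s.setv 9 i) = mergeInit.cost (s.setv 9 i) +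
      ((forto 13 (var 8) clearBody).cost s₁ + ((forto 13 (var 7) tryBody).cost s₂ +
        (forto 13 (var 8) copyBody).cost s₃)) := rfl
    have l1 : mergeInit.cost (s.setv 9 i) ≤ 100 := cost_le rfl _
    simp only [Exp.cost] at k2 g3
    omega

theorem mergeCmd_spec {n S N : ℕ} {s : Store} (h0 : s.v 0 = n) (h7 : s.v 7 = N) (h8 : s.v 8 = S)
    (hrow : ∀ c < 2 * n + 2, s.a aRow c = c * S)
    (hinit : ∀ d, 1 ≤ d → d < 2 * n + 2 → ∀ z < S,
      s.a aVal (d * S + z) = if z = initState d then 1 else 0)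
    (hpar : ∀ c, 2 ≤ c → c < 2 * n + 2 → 1 ≤ s.a aPar c ∧ s.a aPar c < c)
    (hrl : ∀ q < N, (ruleAt s q).x < S ∧ (ruleAt s q).y < S ∧ (ruleAt s q).z < S) :
    (∃ A, IsTable S N (ruleAt s) (s.a aPar) (2 * n + 2) A
      (fun c z => (mergeCmd.run s).a aCh (c * S + z))) ∧
      mergeCmd.cost s ≤ 10 + 2 * n * (206 + S * 70 + N * 256) := by
  set A : ℕ → ℕ → ℕ → ℕ := fun c d z =>
    (rounds mergeBody.run 9 s (2 * n + 2 - c)).a aVal (d * S + z) with hA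
  obtain ⟨h, hc⟩ := forto_spec (x := 9) (e := add (var 0) (var 0)) (c := mergeBody) (s := s)
    (k := 2 * n) (by simp [h0, two_mul])
    (fun i s' => ∀ c, 2 * n + 2 - i ≤ c → c < 2 * n + 2 →
      (∀ q < N, (ruleAt s q).Fits (A (c + 1) (s.a aPar c)) (A (c + 1) c) →
        (ruleAt s q).value (A (c + 1) (s.a aPar c)) (A (c + 1) c) ≤
          A c (s.a aPar c) (ruleAt s q).z) ∧
      (∀ z < S, A c (s.a aPar c) z ≠ 0 → ∃ q < N, s'.a aCh (c * S + z) = q ∧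
        (ruleAt s q).z = z ∧ (ruleAt s q).Fits (A (c + 1) (s.a aPar c)) (A (c + 1) c) ∧
        A c (s.a aPar c) z = (ruleAt s q).value (A (c + 1) (s.a aPar c)) (A (c + 1) c)) ∧
      ∀ d, d ≠ s.a aPar c → ∀ z < S, A c d z = A (c + 1) d z)
    (200 + S * 70 + N * 256) (by intro c h1 h2; omega) (by
      rintro i hi s' hag hs' i1
      have hr : ∀ q, ruleAt s' q = ruleAt s q := fun q => by
        simp only [ruleAt, hag.a aX rfl, hag.a aY rfl, hag.a aZ rfl, hag.a aW rfl, hag.a aJ rfl]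
      obtain ⟨c, hci⟩ : ∃ c, c + i = 2 * n + 1 := ⟨2 * n + 1 - i, by omega⟩
      obtain ⟨hp1, hpc⟩ := hpar c (by omega) (by omega)
      have hA1 : ∀ d z, A (c + 1) d z = s'.a aVal (d * S + z) := fun d z => by
        rw [hA, hs']
        simp only [show 2 * n + 2 - (c + 1) = i by omega]
      have hA0 : ∀ d z, A c d z = (mergeBody.run (s'.setv 9 i)).a aVal (d * S + z) := fun d z => by
        rw [hA, hs']
        simp only [show 2 * n + 2 - c = i + 1 by omega]
        rfl
      obtain ⟨⟨k1, k2, k3, k4⟩, k5⟩ := mergeBody_spec (s := s') (i := i) (c := c)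
        (p := s.a aPar c) (S := S) (N := N) (n := n) (a := A (c + 1) (s.a aPar c))
        (b := A (c + 1) c) (a' := A c (s.a aPar c)) ((hag.v _ rfl).trans h0)
        ((hag.v _ rfl).trans h7) ((hag.v _ rfl).trans h8) hci (by rw [hag.a aPar rfl])
        (by rw [hag.a aRow rfl]; exact hrow c (by omega))
        (by rw [hag.a aRow rfl]; exact hrow _ (by omega))
        (fun q hq => by rw [hr]; exact (hrl q hq).2.2) (funext fun z => hA1 _ z)
        (funext fun z => hA1 _ z) (funext fun z => hA0 _ z)
      refine ⟨fun c' h1 h2 => ?_, k5⟩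
      by_cases hcc : c' = c
      · subst hcc
        simp only [hr] at k1 k2
        refine ⟨k1, k2, fun d hd z hz => ?_⟩
        rw [hA0, hA1]
        exact k4 _ fun z' hz' h => hd ((row_inj hz hz').1 h).1
      · obtain ⟨l1, l2, l3⟩ := i1 c' (by omega) h2
        refine ⟨l1, fun z hz h => ?_, l3⟩
        rw [k3 _ fun z' hz' h => hcc ((row_inj hz hz').1 h).1]
        exact l2 z hz h)
  refine ⟨⟨A, ⟨fun d h1 h2 z hz => ?_, fun c h2 hc q hq h3 h4 => ?_, fun c h2 hc z hz h3 => ?_,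
    fun c h2 hc d h3 h4 h5 z hz => ?_⟩⟩, ?_⟩
  · rw [hA]
    simp only [Nat.sub_self, rounds_zero]
    exact hinit d h1 h2 z hz
  · exact (h c (by omega) hc).1 q hq ⟨h3, h4⟩
  · obtain ⟨q, hq, e, h5, h6, h7⟩ := (h c (by omega) hc).2.1 z hz h3
    have e' : (mergeCmd.run s).a aCh (c * S + z) = q := e
    simp only [e']
    exact ⟨hq, h5, h6.1, h6.2, h7⟩
  · exact (h c (by omega) hc).2.2 d h5 z hz
  · refine hc.trans ?_
    have : 200 + S * 70 + N * 256 + 6 = 206 + S * 70 + N * 256 := by ring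
    rw [this]
    exact Nat.add_le_add_right (by decide) _

/-! ### Backtracking and output -/

/-- Start at the root. -/
def backInit : Cmd := put aCur (lit 1) (lit 4) ;; put aLab (lit 1) (lit 0)

/-- Find the states before the merge of a node, and the label of the coalition held by it. -/
def backBody : Cmd :=
  set 10 (add (var 9) (lit 2)) ;; set 11 (get aPar (var 10)) ;;
  set 12 (get aCh (add (get aRow (var 10)) (get aCur (var 11)))) ;;
  put aCur (var 10) (get aY (var 12)) ;; put aCur (var 11) (get aX (var 12)) ;;
  ite (get aJ (var 12))
    (ite (sub (get aJ (var 12)) (lit 1))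
      (put aLab (var 11) (var 10) ;; put aLab (var 10) (var 10))
      (put aLab (var 10) (get aLab (var 11))))
    (put aLab (var 10) (var 10))

/-- Follow the choices of the dynamic program from the root downwards. -/
def backCmd : Cmd := backInit ;; forto 9 (add (var 0) (var 0)) backBody

theorem backCmd_spec {n S : ℕ} {s : Store} (h0 : s.v 0 = n)
    (hrow : ∀ c < 2 * n + 2, s.a aRow c = c * S) {par : ℕ → ℕ} (hp : s.a aPar = par)
    {rl : ℕ → Rule} (hrl : ruleAt s = rl) {ch : ℕ → ℕ → ℕ}
    (hch : ∀ c z, ch c z = s.a aCh (c * S + z)) :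
    (∃ cur lab, IsBacktrack rl par (2 * n + 2) ch cur ∧
      IsLabelling par (fun c => rl (ch c (cur c (par c)))) (2 * n + 2) lab ∧
      (backCmd.run s).a aLab = lab (2 * n + 2)) ∧ backCmd.cost s ≤ 100 + 2 * n * 306 := by
  subst hp hrl
  set R : ℕ → Store := fun i => rounds backBody.run 9 (backInit.run s) i with hR
  have hag : ∀ i, Agree (forto 9 (add (var 0) (var 0)) backBody) (backInit.run s) (R i) :=
    fun i => agree_rounds 9 _ backBody _ i
  have hstep : ∀ i, i < 2 * n → ∃ q, q = ch (i + 2) ((R i).a aCur (s.a aPar (i + 2))) ∧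
      (R (i + 1)).a aCur = Function.update (Function.update ((R i).a aCur) (i + 2)
        (ruleAt s q).y) (s.a aPar (i + 2)) (ruleAt s q).x ∧
      (R (i + 1)).a aLab = if (ruleAt s q).j = 0 then Function.update ((R i).a aLab) (i + 2) (i + 2)
        else if (ruleAt s q).j - 1 = 0 then
          Function.update ((R i).a aLab) (i + 2) ((R i).a aLab (s.a aPar (i + 2)))
        else Function.update (Function.update ((R i).a aLab) (s.a aPar (i + 2)) (i + 2)) (i + 2)
          (i + 2) := by
    intro i hi
    refine ⟨_, rfl, ?_, ?_⟩
    all_goals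
      have e : R (i + 1) = backBody.run ((R i).setv 9 i) := rfl
      have ap : (R i).a aPar = s.a aPar := ((hag i).a _ rfl).trans (Cmd.run_a _ _ rfl)
      have ac : (R i).a aCh = s.a aCh := ((hag i).a _ rfl).trans (Cmd.run_a _ _ rfl)
      have ar : (R i).a aRow (i + 2) = (i + 2) * S := by
        rw [((hag i).a aRow rfl).trans (Cmd.run_a _ _ rfl)]; exact hrow _ (by omega)
      have ax : (R i).a aX = s.a aX := ((hag i).a _ rfl).trans (Cmd.run_a _ _ rfl)
      have ay : (R i).a aY = s.a aY := ((hag i).a _ rfl).trans (Cmd.run_a _ _ rfl)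
      have aj : (R i).a aJ = s.a aJ := ((hag i).a _ rfl).trans (Cmd.run_a _ _ rfl)
      rw [e, hch]
      simp [backBody, ap, ac, ar, ax, ay, aj, ruleAt]
    by_cases h1 : s.a aJ (s.a aCh ((i + 2) * S + (R i).a aCur (s.a aPar (i + 2)))) = 0
    · exact (if_pos h1).trans (if_pos h1).symm
    · refine (if_neg h1).trans (Eq.trans ?_ (if_neg h1).symm)
      by_cases h2 : s.a aJ (s.a aCh ((i + 2) * S + (R i).a aCur (s.a aPar (i + 2)))) - 1 = 0
      · exact (if_pos h2).trans (if_pos h2).symm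
      · exact (if_neg h2).trans (if_neg h2).symm
  have hstep' : ∀ c, 2 ≤ c → c < 2 * n + 2 → ∃ q,
      q = ch c ((R (c - 2)).a aCur (s.a aPar c)) ∧
      (R (c + 1 - 2)).a aCur = Function.update (Function.update ((R (c - 2)).a aCur) c
        (ruleAt s q).y) (s.a aPar c) (ruleAt s q).x ∧
      (R (c + 1 - 2)).a aLab = if (ruleAt s q).j = 0 then Function.update ((R (c - 2)).a aLab) c c
        else if (ruleAt s q).j - 1 = 0 then
          Function.update ((R (c - 2)).a aLab) c ((R (c - 2)).a aLab (s.a aPar c))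
        else Function.update (Function.update ((R (c - 2)).a aLab) (s.a aPar c) c) c c := by
    intro c h2 hc
    obtain ⟨i, rfl⟩ : ∃ i, c = i + 2 := ⟨c - 2, by omega⟩
    exact hstep i (by omega)
  refine ⟨⟨fun c => (R (c - 2)).a aCur, fun c => (R (c - 2)).a aLab, ⟨?_, fun c h2 hc => ?_⟩,
    ⟨?_, fun c h2 hc hj => ?_, fun c h2 hc hj => ?_, fun c h2 hc hj hj' => ?_⟩, ?_⟩, ?_⟩
  · simp [hR, backInit]
  · obtain ⟨q, rfl, h1, -⟩ := hstep' c h2 hc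
    exact h1
  · simp [hR, backInit]
  · obtain ⟨q, rfl, -, h1⟩ := hstep' c h2 hc
    rw [h1, if_pos hj]
  · obtain ⟨q, rfl, -, h1⟩ := hstep' c h2 hc
    have hj : (ruleAt s (ch c ((R (c - 2)).a aCur (s.a aPar c)))).j = 1 := hj
    rw [h1, hj, if_neg one_ne_zero, if_pos rfl]
  · obtain ⟨q, rfl, -, h1⟩ := hstep' c h2 hc
    have hj2 : (ruleAt s (ch c ((R (c - 2)).a aCur (s.a aPar c)))).j - 1 ≠ 0 :=
      Nat.sub_ne_zero_of_lt (by
        have h1 : (ruleAt s (ch c ((R (c - 2)).a aCur (s.a aPar c)))).j ≠ 0 := hj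
        have h2 : (ruleAt s (ch c ((R (c - 2)).a aCur (s.a aPar c)))).j ≠ 1 := hj'
        omega)
    rw [h1, if_neg hj, if_neg hj2]
  · have : (add (var 0) (var 0)).eval (backInit.run s) = 2 * n := by simp [backInit, h0, two_mul]
    simp only [backCmd, run_seq, Nat.add_sub_cancel, hR]
    rw [Cmd.run, this]
  · obtain ⟨-, hc⟩ := forto_spec (x := 9) (e := add (var 0) (var 0)) (c := backBody)
      (s := backInit.run s) (k := 2 * n) (by simp [backInit, h0, two_mul]) (fun _ _ => True) 300
      trivial (fun _ _ _ _ _ _ => ⟨trivial, cost_le rfl _⟩)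
    have h1 : backInit.cost s ≤ 50 := cost_le rfl s
    have h2 : backCmd.cost s = backInit.cost s +
      (forto 9 (add (var 0) (var 0)) backBody).cost (backInit.run s) := rfl
    simp only [Exp.cost] at hc
    omega

/-- Write the label of a vertex. -/
def outBody : Cmd :=
  set 10 (get aPos (var 9)) ;;
  put aOut (var 9) (get aLab (add (add (var 10) (var 10)) (lit 1)))

/-- Write the labels of all vertices. -/
def outCmd : Cmd := forto 9 (var 0) outBody

theorem outCmd_spec {n : ℕ} {s : Store} (h0 : s.v 0 = n) :
    (∀ v < n, (outCmd.run s).a aOut v = s.a aLab (2 * s.a aPos v + 1)) ∧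
      outCmd.cost s ≤ 10 + n * 106 := by
  obtain ⟨h, hc⟩ := forto_spec (x := 9) (e := var 0) (c := outBody) (s := s) (k := n) h0
    (fun i s' => ∀ v < i, s'.a aOut v = s.a aLab (2 * s.a aPos v + 1)) 100 (by simp) (by
      rintro i hi s' ha - i1
      refine ⟨fun v hv => ?_, cost_le rfl _⟩
      have e : (outBody.run (s'.setv 9 i)).a aOut =
          Function.update (s'.a aOut) i (s.a aLab (2 * s.a aPos i + 1)) := by
        simp [outBody, ha.a aPos rfl, ha.a aLab rfl, two_mul]
      rw [e, Function.update_apply]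
      split_ifs with hvi
      · rw [hvi]
      · exact i1 v (by omega))
  exact ⟨h, hc.trans (Nat.add_le_add_right (by decide) _)⟩

/-! ### The algorithm -/

/-- The algorithm: read the graph, find a search order and the tree of vertices and blocks, make the
list of rules, run the dynamic program, and trace an optimal solution. -/
def welfareCmd : Cmd :=
  readCmd ;; searchCmd ;; parentCmd ;; gainCmd ;; rulesCmd ;; rowCmd ;; mergeCmd ;; backCmd ;; outCmd

/-- Every monomial that occurs in the running time is at most `n * max D 1 ^ 4`. -/
theorem monomials_le {n : ℕ} (hn : 0 < n) (D : ℕ) :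
    1 ≤ n * max D 1 ^ 4 ∧ n ≤ n * max D 1 ^ 4 ∧ n * D ≤ n * max D 1 ^ 4 ∧ D ≤ n * max D 1 ^ 4 ∧
      D ^ 2 ≤ n * max D 1 ^ 4 ∧ D ^ 3 ≤ n * max D 1 ^ 4 := by
  have hM : D ≤ max D 1 := le_max_left _ _
  have hM1 : 1 ≤ max D 1 := le_max_right _ _
  generalize max D 1 = M at hM hM1
  have h : ∀ k ≤ 4, D ^ k ≤ M ^ 4 := fun k hk =>
    (Nat.pow_le_pow_left hM k).trans (Nat.pow_le_pow_right hM1 hk)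
  have h' : ∀ k ≤ 4, D ^ k ≤ n * M ^ 4 := fun k hk =>
    (h k hk).trans (Nat.le_mul_of_pos_left _ hn)
  have h0 := h' 0 (by omega)
  have h1 := h' 1 (by omega)
  have g0 := Nat.mul_le_mul_left n (h 0 (by omega))
  have g1 := Nat.mul_le_mul_left n (h 1 (by omega))
  simp only [pow_zero, pow_one, mul_one] at h0 h1 g0 g1
  exact ⟨h0, g0, g1, h1, h' 2 (by omega), h' 3 (by omega)⟩

theorem length_inputWord_le {n : ℕ} {G : SimpleGraph (Fin n)} [DecidableRel G.Adj]
    {adj : Fin n → List (Fin n)} (hadj : IsAdjacencyList G adj) :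
    (inputWord adj).length ≤ 1 + n + n * G.maxDegree := by
  have hdeg : ∀ v, (adj v).length ≤ G.maxDegree := fun v => by
    have h : (adj v).toFinset = G.neighborFinset v := by
      ext w
      simp [(hadj v).2 w]
    rw [← List.toFinset_card_of_nodup (hadj v).1, h, SimpleGraph.card_neighborFinset_eq_degree]
    exact G.degree_le_maxDegree v
  have h := Finset.sum_le_card_nsmul (Finset.range n)
    (fun i => (inputWord adj).getD (1 + i) 0) G.maxDegree fun i hi => by
      have hv := inputWord_deg adj ⟨i, Finset.mem_range.1 hi⟩
      simp only at hv ⊢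
      rw [hv]
      exact hdeg _
  rw [Finset.card_range, smul_eq_mul] at h
  rw [length_inputWord, inputWord_zero]
  exact Nat.add_le_add_left h _

/-- The sum of the running times of the parts. -/
theorem cost_sum_le {n D k₁ k₂ k₃ k₄ k₅ k₆ k₇ k₈ k₉ : ℕ} (hn : 0 < n) (c₁ : k₁ ≤ 200 * n + 200)
    (c₂ : k₂ ≤ 100 + 2 * n * (200 + D * 106)) (c₃ : k₃ ≤ 10 + n * (306 + D * 212))
    (c₄ : k₄ ≤ 10 + (D + 1) * (56 + (D + 2) * (66 + (D + 2) * 20))) (c₅ : k₅ ≤ 1500 * D + 5000)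
    (c₆ : k₆ ≤ 200 + (n + 1) * 206)
    (c₇ : k₇ ≤ 10 + 2 * n * (206 + (D + 7) * 70 + (10 * D + 31) * 256))
    (c₈ : k₈ ≤ 100 + 2 * n * 306) (c₉ : k₉ ≤ 10 + n * 106) :
    k₁ + (k₂ + (k₃ + (k₄ + (k₅ + (k₆ + (k₇ + (k₈ + k₉))))))) ≤
      100000 * (n * max D 1 ^ 4) := by
  obtain ⟨x1, x2, x3, x4, x5, x6⟩ := monomials_le hn D
  generalize n * max D 1 ^ 4 = B at *
  have e : (200 * n + 200) + ((100 + 2 * n * (200 + D * 106)) + ((10 + n * (306 + D * 212)) +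
      ((10 + (D + 1) * (56 + (D + 2) * (66 + (D + 2) * 20))) + ((1500 * D + 5000) +
      ((200 + (n + 1) * 206) + ((10 + 2 * n * (206 + (D + 7) * 70 + (10 * D + 31) * 256)) +
      ((100 + 2 * n * 306) + (10 + n * 106)))))))) =
      20 * D ^ 3 + 166 * D ^ 2 + 1914 * D + 6114 + 19094 * n + 5684 * (n * D) := by
    ring
  omega

/-- The algorithm computes a labelling of maximum welfare. -/
theorem welfareCmd_spec {n : ℕ} {G : SimpleGraph (Fin n)} [DecidableRel G.Adj] (hn : 0 < n)
    (hG : IsBlockGraph G) {adj : Fin n → List (Fin n)} (hadj : IsAdjacencyList G adj) {s : Store}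
    (hs : ∀ b i, s.a b i = if b = 0 then (inputWord adj).getD i 0 else 0) :
    (welfareCmd.run s).v 0 = n ∧
    (∀ l' : Fin n → Fin n,
      labelWelfare G l' ≤ labelWelfare G (fun v => (welfareCmd.run s).a aOut v)) ∧
    welfareCmd.cost s ≤ 100000 * (n * max G.maxDegree 1 ^ 4) := by
  obtain ⟨r1, c1⟩ := readCmd_spec adj hadj (s := s) (fun i => by rw [hs]; simp)
  set Δ := G.maxDegree with hΔ
  set s₁ := readCmd.run s with hs₁
  clear_value s₁
  have z1 : ∀ b, b ≠ aIn → b ≠ aStart → ∀ i, s₁.a b i = 0 := fun b h1 h2 i => by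
    rw [hs₁, Cmd.run_a _ _ (by simpa [readCmd, readInit, readBody, Cmd.writesArray] using h2.symm),
      hs, if_neg h1]
  obtain ⟨⟨f2, p2⟩, c2⟩ := searchCmd_spec r1 (z1 _ (by decide) (by decide))
  set s₂ := searchCmd.run s₁ with hs₂
  clear_value s₂
  have r2 : Reads G Δ s₂ := by
    rw [hs₂]
    exact r1.congr (Cmd.run_v _ _ rfl) (Cmd.run_v _ _ rfl) (Cmd.run_a _ _ rfl) (Cmd.run_a _ _ rfl)
  obtain ⟨⟨tp, rp, vx, t3⟩, c3⟩ := parentCmd_spec hG hn r2 f2 p2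
  set s₃ := parentCmd.run s₂ with hs₃
  clear_value s₃
  have v31 : s₃.v 1 = Δ := by rw [hs₃, Cmd.run_v _ _ rfl, r2.bound]
  obtain ⟨g4, c4⟩ := gainCmd_spec v31
  set s₄ := gainCmd.run s₃ with hs₄
  clear_value s₄
  have v41 : s₄.v 1 = Δ := by rw [hs₄, Cmd.run_v _ _ rfl, v31]
  obtain ⟨l5, c5⟩ := rulesCmd_spec v41
  set s₅ := rulesCmd.run s₄ with hs₅
  clear_value s₅
  have v51 : s₅.v 1 = Δ := by rw [hs₅, Cmd.run_v _ _ rfl, v41]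
  have v50 : s₅.v 0 = n := by
    rw [hs₅, Cmd.run_v _ _ rfl, hs₄, Cmd.run_v _ _ rfl, hs₃, Cmd.run_v _ _ rfl, r2.size]
  have z5 : ∀ i, s₅.a aVal i = 0 := fun i => by
    rw [hs₅, Cmd.run_a _ _ rfl, hs₄, Cmd.run_a _ _ rfl, hs₃, Cmd.run_a _ _ rfl, hs₂,
      Cmd.run_a _ _ rfl, z1 _ (by decide) (by decide)]
  obtain ⟨⟨e6, w6, i6⟩, c6⟩ := rowCmd_spec v50 v51 z5
  set s₆ := rowCmd.run s₅ with hs₆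
  clear_value s₆
  have v60 : s₆.v 0 = n := by rw [hs₆, Cmd.run_v _ _ rfl, v50]
  have v67 : s₆.v 7 = 10 * Δ + 31 := by rw [hs₆, Cmd.run_v _ _ rfl, l5.1]
  have p6 : s₆.a aPar = s₃.a aPar := by
    rw [hs₆, Cmd.run_a _ _ rfl, hs₅, Cmd.run_a _ _ rfl, hs₄, Cmd.run_a _ _ rfl]
  have q6 : ruleAt s₆ = ruleAt s₅ := funext fun q => by
    simp only [ruleAt, hs₆, Cmd.run_a rowCmd s₅ (b := aX) rfl, Cmd.run_a rowCmd s₅ (b := aY) rfl,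
      Cmd.run_a rowCmd s₅ (b := aZ) rfl, Cmd.run_a rowCmd s₅ (b := aW) rfl,
      Cmd.run_a rowCmd s₅ (b := aJ) rfl]
  have hrl : ∀ q < 10 * Δ + 31, (ruleAt s₆ q).x < Δ + 7 ∧ (ruleAt s₆ q).y < Δ + 7 ∧
      (ruleAt s₆ q).z < Δ + 7 := fun q hq => by
    have hr := (l5.2 (ruleAt s₆ q)).2 ⟨q, hq, by rw [q6]⟩
    generalize ruleAt s₆ q = r at hr
    cases hr <;> simp only <;> omega
  obtain ⟨⟨A, hA⟩, c7⟩ := mergeCmd_spec v60 v67 e6 w6 i6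
    (fun c h2 hc => by rw [p6]; exact t3.par_lt h2 hc) hrl
  set s₇ := mergeCmd.run s₆ with hs₇
  clear_value s₇
  have v70 : s₇.v 0 = n := by rw [hs₇, Cmd.run_v _ _ rfl, v60]
  have p7 : s₇.a aPar = s₃.a aPar := by rw [hs₇, Cmd.run_a _ _ rfl, p6]
  have w7 : ∀ c < 2 * n + 2, s₇.a aRow c = c * (Δ + 7) := by
    rw [hs₇, Cmd.run_a _ _ rfl]; exact w6
  have q7 : ruleAt s₇ = ruleAt s₅ := by
    rw [← q6]
    exact funext fun q => by
      simp only [ruleAt, hs₇, Cmd.run_a mergeCmd s₆ (b := aX) rfl,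
        Cmd.run_a mergeCmd s₆ (b := aY) rfl, Cmd.run_a mergeCmd s₆ (b := aZ) rfl,
        Cmd.run_a mergeCmd s₆ (b := aW) rfl, Cmd.run_a mergeCmd s₆ (b := aJ) rfl]
  obtain ⟨⟨cur, lab, hcur, hlab, e8⟩, c8⟩ := backCmd_spec v70 w7 p7 q7
    (ch := fun c z => s₇.a aCh (c * (Δ + 7) + z)) (fun _ _ => rfl)
  set s₈ := backCmd.run s₇ with hs₈
  clear_value s₈
  have v80 : s₈.v 0 = n := by rw [hs₈, Cmd.run_v _ _ rfl, v70]
  have p8 : s₈.a aPos = s₂.a aPos := by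
    rw [hs₈, Cmd.run_a _ _ rfl, hs₇, Cmd.run_a _ _ rfl, hs₆, Cmd.run_a _ _ rfl, hs₅,
      Cmd.run_a _ _ rfl, hs₄, Cmd.run_a _ _ rfl, hs₃, Cmd.run_a _ _ rfl]
  obtain ⟨o9, c9⟩ := outCmd_spec v80
  have hrun : welfareCmd.run s = outCmd.run s₈ := by
    simp only [welfareCmd, run_seq, hs₈, hs₇, hs₆, hs₅, hs₄, hs₃, hs₂, hs₁]
  have v90 : (outCmd.run s₈).v 0 = n := by rw [Cmd.run_v _ _ rfl, v80]
  refine ⟨by rw [hrun, v90], fun l' => ?_, ?_⟩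
  · have hout : (fun v : Fin n => (welfareCmd.run s).a aOut v) =
        fun v : Fin n => lab (2 * n + 2) (2 * s₂.a aPos v + 1) := funext fun v => by
      rw [hrun, o9 v v.2, e8, p8]
    rw [hout]
    have h4 : ∀ k < Δ + 1, (s₄.a aGain k : ℚ) =
        (Nat.factorial (Δ + 2) : ℕ) * (starVal (k + 1) - starVal k) := fun k hk => by
      rw [g4 k hk]; exact gain_eq (by omega)
    rw [q6, p6] at hA
    refine labelWelfare_le_of_isTable t3 (T := Δ + 1) (Nat.factorial_pos _) h4 (fun v => ?_)
      (Nat.succ_pos _) l5.2 le_rfl hA hcur hlab l'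
    have h1 := G.degree_le_maxDegree v
    rw [← SimpleGraph.card_neighborFinset_eq_degree, SimpleGraph.neighborFinset_eq_filter] at h1
    exact Nat.lt_succ_of_le h1
  · have hc : welfareCmd.cost s = readCmd.cost s + (searchCmd.cost s₁ + (parentCmd.cost s₂ +
      (gainCmd.cost s₃ + (rulesCmd.cost s₄ + (rowCmd.cost s₅ + (mergeCmd.cost s₆ +
        (backCmd.cost s₇ + outCmd.cost s₈))))))) := by
      rw [welfareCmd, cost_seq, ← hs₁, cost_seq, ← hs₂, cost_seq, ← hs₃, cost_seq, ← hs₄, cost_seq,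
        ← hs₅, cost_seq, ← hs₆, cost_seq, ← hs₇, cost_seq, ← hs₈]
    rw [hc]
    exact cost_sum_le hn c1 c2 c3 c4 c5 c6 c7 c8 c9

end FHG

theorem theorem2 :
    ∃ (p : RAM.Prog) (c : ℕ),
      ∀ (n : ℕ) (G : SimpleGraph (Fin n)) [DecidableRel G.Adj] (adj : Fin n → List (Fin n)),
        0 < n → FHG.IsBlockGraph G → FHG.IsAdjacencyList G adj →
          ∃ (t : ℕ) (s : RAM.State),
            RAM.Exec p (RAM.initial (FHG.inputWord adj)) t s ∧
            t ≤ c * (n * (max G.maxDegree 1) ^ 4) ∧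
            ∃ P : Finpartition (Finset.univ : Finset (Fin n)),
              FHG.IsMaxWelfare G P ∧
              ∀ u v : Fin n, s.mem (u : ℕ) = s.mem (v : ℕ) ↔ P.part u = P.part v := by
  obtain ⟨p, hp⟩ := Imp.exists_prog FHG.welfareCmd
  refine ⟨p, 200000, fun n G _ adj hn hG hadj => ?_⟩
  obtain ⟨s, hs, h⟩ := hp (FHG.inputWord adj) (FHG.length_inputWord adj)
  obtain ⟨h1, h2, h3⟩ := FHG.welfareCmd_spec hn hG hadj hs
  obtain ⟨t, σ, e1, e2, e3⟩ := h h1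
  rw [FHG.inputWord_zero] at e3
  refine ⟨t, σ, e1, ?_, ?_⟩
  · have hlen := FHG.length_inputWord_le hadj
    obtain ⟨x1, x2, x3, -⟩ := FHG.monomials_le hn G.maxDegree
    omega
  · classical
    have hiff : ∀ u v : Fin n, (FHG.welfareCmd.run s).a aOut u = (FHG.welfareCmd.run s).a aOut v ↔
        (Finpartition.ofSetoid (Setoid.ker fun v : Fin n => (FHG.welfareCmd.run s).a aOut v)).part u =
        (Finpartition.ofSetoid
          (Setoid.ker fun v : Fin n => (FHG.welfareCmd.run s).a aOut v)).part v := fun u v => by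
      rw [← Finpartition.mem_part_iff_part_eq_part _ (Finset.mem_univ _) (Finset.mem_univ _),
        Finpartition.mem_part_ofSetoid_iff_rel]
      exact eq_comm
    refine ⟨_, fun Q => ?_, fun u v => by rw [e3 u u.2, e3 v v.2]; exact hiff u v⟩
    rw [FHG.welfare_eq_labelWelfare G Q Q.part fun _ _ => Iff.rfl,
      FHG.welfare_eq_labelWelfare G _ _ hiff]
    obtain ⟨l', hl'⟩ := FHG.exists_vertex_labelling (G := G) Q.part
    rw [← hl']
    exact h2 l'
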